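/- Let $d\ge 2$ and $k\ge 1$ be integers, and let $f:\mathbb{R}^d\to[0,\infty)$ be a bounded measurable probability density. For each $n$ let $\mathcal{X}_n$ be a set of $n$ points drawn independently from the distribution with density $f$. For $r>0$ let $VR(\mathcal{X}_n;r)$ be the random Vietoris–Rips complex, i.e. the clique complex of the graph on $\mathcal{X}_n$ in which distinct points $x,y$ are joined by an edge whenever $|x-y|<2r$, and let $\beta_k=\dim_{\mathbb{Q}} H_k(VR(\mathcal{X}_n;r_n);\mathbb{Q})$. There is a constant $c>0$, depending only on $d$, $k$ and $f$, such that the following holds for every $\epsilon>0$ and every sequence $r_n>0$ with $r_n=O(n^{-1/d-\epsilon})$. 1. If $n^{2k+2}r_n^{d(2k+1)}\to 0$ as $n\to\infty$, then $\beta_k=0$ asymptotically almost surely, i.e. $\mathbb{P}[\beta_k=0]\to 1$. 2. If $n^{2k+2}r_n^{d(2k+1)}\to\alpha\in(0,\infty)$ as $n\to\infty$, then for all sufficiently large $n$ $$d_{TV}(\beta_k,Y)\le c\,\alpha\, n r_n^d,$$ where $Y$ is a Poisson random variable with $\mathbb{E}[Y]=\mathbb{E}[\beta_k]$, and $d_{TV}(X,Y)=\sup_g|\mathbb{E}[g(X)]-\mathbb{E}[g(Y)]|$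 with the supremum over all continuous functions $g$ bounded by one in absolute value. 3. If $n^{2k+2}r_n^{d(2k+1)}\to\infty$ as $n\to\infty$, then $$\frac{\beta_k-\mathbb{E}[\beta_k]}{\sqrt{\mathrm{Var}[\beta_k]}}\Rightarrow\mathcal{N}(0,1),$$ i.e. the normalized Betti number converges in distribution to a standard normal variable. -/

import Mathlib

open MeasureTheory ProbabilityTheory Filter Asymptotics
open scoped Topology NNReal ENNReal

noncomputable section

namespace RandomRips

/-- The clique complex of a graph `G`: its faces are the nonempty finite sets of pairwise adjacent
vertices. -/
def cliqueComplex {V : Type*} (G : SimpleGraph V) : AbstractSimplicialComplex V where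
  faces := {s | s.Nonempty ∧ G.IsClique (s : Set V)}
  isRelLowerSet_faces := fun _ hs =>
    ⟨hs.1, fun _ hts ht => ⟨ht, hs.2.subset (Finset.coe_subset.2 hts)⟩⟩
  singleton_mem := fun v => ⟨Finset.singleton_nonempty v, by simp⟩

section Homology

variable {V : Type*} [LinearOrder V] (Δ : AbstractSimplicialComplex V)

/-- The `k`-dimensional faces: those with `k + 1` vertices. -/
abbrev Face (k : ℕ) : Type _ := {s : Finset V // s ∈ Δ.faces ∧ s.card = k + 1}

/-- Simplicial `k`-chains with rational coefficients. Every face is oriented by the order of its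
vertices. -/
abbrev Chain (k : ℕ) : Type _ := Face Δ k →₀ ℚ

/-- The facet of a face `s` obtained by deleting the vertex `v`. -/
def Face.facet {k : ℕ} (s : Face Δ (k + 1)) (v : s.1) : Face Δ k :=
  ⟨s.1.erase v.1, by
    have hc : (s.1.erase v.1).card = k + 1 := by
      rw [Finset.card_erase_of_mem v.2, s.2.2, Nat.add_sub_cancel]
    exact ⟨(Δ.isRelLowerSet_faces s.2.1).2 (Finset.erase_subset _ _)
      (Finset.card_pos.1 (by omega)), hc⟩⟩

/-- The simplicial boundary map from `(k + 1)`-chains to `k`-chains,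
`∂ [v₀ < ⋯ < vₖ₊₁] = ∑ i, (-1) ^ i [v₀, …, v̂ᵢ, …, vₖ₊₁]`: the position of a vertex `v` of `s` is the
number of vertices of `s` that are smaller than `v`. -/
def boundary (k : ℕ) : Chain Δ (k + 1) →ₗ[ℚ] Chain Δ k :=
  Finsupp.linearCombination ℚ fun s : Face Δ (k + 1) =>
    ∑ v : s.1, Finsupp.single (s.facet Δ v) ((-1 : ℚ) ^ (s.1.filter (· < v.1)).card)

/-- The `k`-cycles (unreduced: every `0`-chain is a cycle). -/
def cycles : (k : ℕ) → Submodule ℚ (Chain Δ k)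
  | 0 => ⊤
  | k + 1 => LinearMap.ker (boundary Δ k)

/-- Simplicial homology with rational coefficients: cycles modulo boundaries. -/
abbrev Homology (k : ℕ) : Type _ :=
  cycles Δ k ⧸ (LinearMap.range (boundary Δ k)).submoduleOf (cycles Δ k)

/-- The `k`-th Betti number, the dimension of the `k`-th rational homology. -/
def betti (k : ℕ) : ℕ := Module.finrank ℚ (Homology Δ k)

end Homology

/-- The geometric graph on a finite family of points of Euclidean space: two distinct members of the
family are adjacent when their distance is less than `2 r`. -/
def geometricGraph {d n : ℕ} (x : Fin n → EuclideanSpace ℝ (Fin d)) (r : ℝ) :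
    SimpleGraph (Fin n) where
  Adj i j := i ≠ j ∧ dist (x i) (x j) < 2 * r
  symm := ⟨fun i j h => ⟨h.1.symm, by rw [dist_comm]; exact h.2⟩⟩
  loopless := ⟨fun _ h => h.1 rfl⟩

/-- The Vietoris–Rips complex of a finite family of points: the clique complex of its geometric
graph. -/
def vietorisRips {d n : ℕ} (x : Fin n → EuclideanSpace ℝ (Fin d)) (r : ℝ) :
    AbstractSimplicialComplex (Fin n) :=
  cliqueComplex (geometricGraph x r)

/-- `X 1, …, X n` are independent random points, each with density `f`. -/
structure IsIIDSample {d n : ℕ} {Ω : Type*} [MeasurableSpace Ω] (P : Measure Ω)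
    (X : Fin n → Ω → EuclideanSpace ℝ (Fin d)) (f : EuclideanSpace ℝ (Fin d) → ℝ) : Prop where
  measurable : ∀ i, Measurable (X i)
  indep : iIndepFun X P
  law : ∀ i, P.map (X i) = volume.withDensity fun x => ENNReal.ofReal (f x)

/-- Total variation distance, normalized as the supremum of `|∫ g dμ - ∫ g dν|` over the continuous
functions `g` that are bounded by one. -/
def dTV {E : Type*} [TopologicalSpace E] [MeasurableSpace E] (μ ν : Measure E) : ℝ :=
  sSup {t : ℝ | ∃ g : E → ℝ, Continuous g ∧ (∀ y, |g y| ≤ 1) ∧ t = |∫ y, g y ∂μ - ∫ y, g y ∂ν|}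

/-- The random Betti number `β_k` of the Vietoris–Rips complex of radius `r` on the random points
`X`. -/
def randomBetti {d n : ℕ} {Ω : Type*} (X : Fin n → Ω → EuclideanSpace ℝ (Fin d)) (r : ℝ) (k : ℕ)
    (ω : Ω) : ℕ :=
  betti (vietorisRips (fun i => X i ω) r) k

end RandomRips

end

/-! Put m = k + 1, the number of vertices of a k-face, and write ν = n r ^ d and L = n ^ (2m) r ^ (d
(2m - 1)). The quantity L is the one whose limit separates the three regimes.

The topological input is that a clique complex on at most 2m vertices carries a nontrivial class in
dimension m - 1 only if it is the boundary of the m-dimensional cross-polytope, and then the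
homology in that dimension has rank one (`cycle_eq_bdry_or_crossPolytope`,
`cliqueBetti_eq_crossPolytopeCount`). For m ≥ 2 both the Betti number and the number W of induced
cross-polytopes are additive over pieces without edges between them, so β_k - W comes only from
components with more than 2m vertices (`abs_bettiRemainder_le_sum`).

Such components are rare. A given point lies in a component with more than j vertices with
probability O(ν ^ j). The margin ε makes ν decay like a power of n, so a high enough power of ν
absorbs the crude polynomial bound on the contribution of a huge component. Hence E|β_k - W| = O(n ν
^ (2m)) = O(L ν). By the Efron–Stein inequality, with the i-th point isolated as the comparison, the
variance of β_k - W is O(L ν) as well.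

The count W is a sum of indicators over 2m-subsets, and the indicator of a set is independent of
those of all sets disjoint from it. Its mean is of exact order L: the upper bound holds because a
cross-polytope has diameter less than 4r, the lower bound because a planar configuration survives
small perturbations and the density is nontrivial (`exists_le_integral_crossIndicator`). The
Chen–Stein method bounds the distance of W to a Poisson variable of the same mean l by O(L ν) min(1,
1/l), and the variance of W differs from l by O(L ν). `SparseBounds` collects these estimates.

If L → 0, then E β_k → 0 and Markov's inequality applies. If L → α, then W is within O(α ν) of a
Poisson variable, and passing from W to β_k and correcting the mean costs errors of the same order.
If L → ∞, the factor 1/l leaves a Poisson error O(ν) → 0; a Poisson variable of large mean is nearly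
normal, and the remainder is negligible on the scale √l, so `tendsto_charFun_of_variance_sub`
carries the limit over to β_k. -/

noncomputable section

namespace RandomRips

set_option linter.unusedSectionVars false

/-! ### Signed removal and addition of a vertex, and the augmented boundary operator. -/

section Operators

variable {V : Type*} [LinearOrder V]

/-- The sign `(-1) ^ i`, with `i` the number of elements of `s` below `v`. -/
def sgn (v : V) (s : Finset V) : ℚ := (-1) ^ (s.filter (· < v)).card

lemma sgn_mul_self (v : V) (s : Finset V) : sgn v s * sgn v s = 1 := by
  rw [sgn, ← pow_add, ← two_mul, pow_mul]; simp

lemma sgn_ne_zero (v : V) (s : Finset V) : sgn v s ≠ 0 := by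
  intro h; simpa [h] using sgn_mul_self v s

lemma sgn_insert_self (v : V) (s : Finset V) : sgn v (insert v s) = sgn v s := by
  simp [sgn, Finset.filter_insert]

lemma sgn_erase_self (v : V) (s : Finset V) : sgn v (s.erase v) = sgn v s := by
  rw [sgn, sgn, Finset.filter_erase, Finset.erase_eq_of_notMem]; simp

lemma sgn_insert {v w : V} {s : Finset V} (hw : w ∉ s) :
    sgn v (insert w s) = (if w < v then -1 else 1) * sgn v s := by
  unfold sgn
  split_ifs with h
  · rw [Finset.filter_insert, if_pos h, Finset.card_insert_of_notMem (by simp [hw]), pow_succ]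
    ring
  · rw [Finset.filter_insert, if_neg h, one_mul]

lemma sgn_erase {v w : V} {s : Finset V} (hw : w ∈ s) :
    sgn v (s.erase w) = (if w < v then -1 else 1) * sgn v s := by
  have h := sgn_insert (v := v) (Finset.notMem_erase w s)
  rw [Finset.insert_erase hw] at h
  rw [h, ← mul_assoc]
  split_ifs <;> simp

/-- Removal of the vertex `v` from every face, with sign. -/
def ann (v : V) : (Finset V → ℚ) →ₗ[ℚ] (Finset V → ℚ) where
  toFun z s := if v ∈ s then 0 else sgn v s * z (insert v s)
  map_add' x y := by ext s; by_cases h : v ∈ s <;> simp [h, mul_add]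
  map_smul' c x := by ext s; by_cases h : v ∈ s <;> simp [h, mul_left_comm]

/-- Addition of the vertex `v` to every face, with sign: the cone operator with apex `v`. -/
def cre (v : V) : (Finset V → ℚ) →ₗ[ℚ] (Finset V → ℚ) where
  toFun z s := if v ∈ s then sgn v s * z (s.erase v) else 0
  map_add' x y := by ext s; by_cases h : v ∈ s <;> simp [h, mul_add]
  map_smul' c x := by ext s; by_cases h : v ∈ s <;> simp [h, mul_left_comm]

lemma ann_apply (v : V) (z : Finset V → ℚ) (s : Finset V) :
    ann v z s = if v ∈ s then 0 else sgn v s * z (insert v s) := rfl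

lemma cre_apply (v : V) (z : Finset V → ℚ) (s : Finset V) :
    cre v z s = if v ∈ s then sgn v s * z (s.erase v) else 0 := rfl

/-- Both orders delete the same two vertices, but only one of the two signs notices the other
vertex, namely that of the larger one. -/
lemma ann_ann (v w : V) (z : Finset V → ℚ) : ann v (ann w z) = - ann w (ann v z) := by
  ext s
  simp only [ann_apply, Pi.neg_apply, Finset.mem_insert]
  by_cases hvw : v = w
  · subst hvw; simp
  by_cases hv : v ∈ s
  · simp [hv]
  by_cases hw : w ∈ s
  · simp [hw]
  simp only [hv, hw, hvw, Ne.symm hvw, or_self, if_false, sgn_insert hv, sgn_insert hw,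
    Finset.insert_comm v w]
  rcases lt_or_gt_of_ne hvw with h | h
  · simp only [h, h.not_gt, if_true, if_false]; ring
  · simp only [h, h.not_gt, if_true, if_false]; ring

/-- The two terms are the restrictions of `z` to the faces without `v` and to the faces with `v`. -/
lemma ann_cre_self (v : V) (z : Finset V → ℚ) : ann v (cre v z) + cre v (ann v z) = z := by
  ext s
  simp only [ann_apply, cre_apply, Pi.add_apply, Finset.mem_insert_self, if_true,
    Finset.notMem_erase, if_false, sgn_insert_self, sgn_erase_self]
  by_cases hv : v ∈ s
  · simp [hv, ← mul_assoc, sgn_mul_self, Finset.insert_erase hv]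
  · simp [hv, ← mul_assoc, sgn_mul_self, Finset.erase_insert hv]

lemma ann_cre {v w : V} (hvw : v ≠ w) (z : Finset V → ℚ) :
    ann v (cre w z) = - cre w (ann v z) := by
  ext s
  simp only [ann_apply, cre_apply, Pi.neg_apply, Finset.mem_insert, Finset.mem_erase]
  by_cases hv : v ∈ s
  · simp [hv, hvw]
  by_cases hw : w ∈ s
  · simp only [hv, hw, and_false, or_true, if_true, if_false, sgn_insert hv, sgn_erase hw]
    rw [Finset.erase_insert_of_ne hvw]
    rcases lt_or_gt_of_ne hvw with h | h
    · simp only [h, h.not_gt, if_true, if_false]; ring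
    · simp only [h, h.not_gt, if_true, if_false]; ring
  · simp [hv, hw, Ne.symm hvw]

variable [Fintype V]

/-- The boundary operator of the full simplex with vertex set `V`, on chains that are functions on
finite sets. The empty face is included, so that the complex is augmented. -/
def bdry : (Finset V → ℚ) →ₗ[ℚ] (Finset V → ℚ) := ∑ v : V, ann v

lemma bdry_eq_sum (z : Finset V → ℚ) : bdry z = ∑ v : V, ann v z := by
  simp [bdry]

lemma bdry_apply (z : Finset V → ℚ) (s : Finset V) : bdry z s = ∑ v : V, ann v z s := by
  simp [bdry_eq_sum]

lemma bdry_ann (v : V) (z : Finset V → ℚ) : bdry (ann v z) = - ann v (bdry z) := by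
  rw [bdry_eq_sum, bdry_eq_sum, map_sum, ← Finset.sum_neg_distrib]
  exact Finset.sum_congr rfl fun w _ => ann_ann w v z

/-- Anticommutation of the removals makes the double boundary equal to its own negative. -/
lemma bdry_bdry (z : Finset V → ℚ) : bdry (bdry z) = 0 := by
  have h : bdry (bdry z) = - bdry (bdry z) := by
    conv_lhs => rw [bdry_eq_sum z, map_sum]
    simp_rw [bdry_ann]
    rw [Finset.sum_neg_distrib, ← bdry_eq_sum]
  exact self_eq_neg.1 h

/-- The cone with apex `v` is a contracting homotopy of the full simplex: in the sum over all
removals only the one at `v` fails to anticommute with it. -/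
lemma bdry_cre (v : V) (z : Finset V → ℚ) : bdry (cre v z) = z - cre v (bdry z) := by
  rw [bdry_eq_sum, bdry_eq_sum, map_sum, ← Finset.add_sum_erase _ _ (Finset.mem_univ v),
    ← Finset.add_sum_erase _ (fun w => cre v (ann w z)) (Finset.mem_univ v),
    Finset.sum_congr rfl fun w hw => ann_cre (Finset.ne_of_mem_erase hw) z,
    Finset.sum_neg_distrib]
  nth_rw 3 [← ann_cre_self v z]
  abel

end Operators

/-! ### Cycles in clique complexes with few vertices. -/

section CliqueChains

variable {V : Type*} [LinearOrder V] [Fintype V]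

/-- The chains supported on the cliques of size `m` contained in `W`. -/
def cliqueChains (G : SimpleGraph V) (W : Finset V) (m : ℕ) : Submodule ℚ (Finset V → ℚ) where
  carrier := {z | ∀ s, z s ≠ 0 → s ⊆ W ∧ s.card = m ∧ G.IsClique (s : Set V)}
  add_mem' {x y} hx hy s hs := by
    by_cases h : x s = 0
    · exact hy s fun h' => hs (by simp [h, h'])
    · exact hx s h
  zero_mem' s hs := absurd rfl hs
  smul_mem' c x hx s hs := hx s fun h => hs (by simp [h])

lemma cliqueChains_mono (G : SimpleGraph V) {W W' : Finset V} (h : W ⊆ W') (m : ℕ) :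
    cliqueChains G W m ≤ cliqueChains G W' m := fun _ hz s hs =>
  ⟨(hz s hs).1.trans h, (hz s hs).2⟩

open Classical in
/-- The vertices of `W` that are adjacent to `v`. -/
def linkSet (G : SimpleGraph V) (W : Finset V) (v : V) : Finset V := W.filter (G.Adj v)

lemma mem_linkSet {G : SimpleGraph V} {W : Finset V} {v u : V} :
    u ∈ linkSet G W v ↔ u ∈ W ∧ G.Adj v u := by simp [linkSet]

/-- The faces of `z` through `v` form a cone over the link: a set that is a clique together with `v`
consists of neighbours of `v`. -/
lemma ann_mem_cliqueChains {G : SimpleGraph V} {W : Finset V} {m : ℕ} {z : Finset V → ℚ}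
    (hz : z ∈ cliqueChains G W (m + 1)) (v : V) : ann v z ∈ cliqueChains G (linkSet G W v) m := by
  intro s hs
  rw [ann_apply] at hs
  by_cases hv : v ∈ s
  · simp [hv] at hs
  · rw [if_neg hv] at hs
    obtain ⟨h1, h2, h3⟩ := hz _ (right_ne_zero_of_mul hs)
    rw [Finset.card_insert_of_notMem hv] at h2
    refine ⟨fun u hu => mem_linkSet.2 ⟨h1 (Finset.mem_insert_of_mem hu), ?_⟩, by omega, ?_⟩
    · exact h3 (by simp) (by simp [hu]) (fun h => hv (h ▸ hu))
    · exact h3.subset (by simp)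

lemma bdry_mem_cliqueChains {G : SimpleGraph V} {W : Finset V} {m : ℕ} {z : Finset V → ℚ}
    (hz : z ∈ cliqueChains G W (m + 1)) : bdry z ∈ cliqueChains G W m := by
  rw [bdry_eq_sum]
  exact Submodule.sum_mem _ fun v _ =>
    cliqueChains_mono G (fun _ hu => (mem_linkSet.1 hu).1) m (ann_mem_cliqueChains hz v)

lemma cre_mem_cliqueChains {G : SimpleGraph V} {W : Finset V} {m : ℕ} {z : Finset V → ℚ} {v : V}
    (hv : v ∈ W) (hz : z ∈ cliqueChains G (linkSet G W v) m) :
    cre v z ∈ cliqueChains G W (m + 1) := by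
  intro s hs
  rw [cre_apply] at hs
  by_cases hvs : v ∈ s
  · rw [if_pos hvs] at hs
    obtain ⟨h1, h2, h3⟩ := hz _ (right_ne_zero_of_mul hs)
    rw [Finset.card_erase_of_mem hvs] at h2
    have hpos := Finset.card_pos.2 ⟨v, hvs⟩
    refine ⟨fun u hu => ?_, by omega, ?_⟩
    · by_cases huv : u = v
      · exact huv ▸ hv
      · exact (mem_linkSet.1 (h1 (Finset.mem_erase.2 ⟨huv, hu⟩))).1
    · rw [← Finset.insert_erase hvs, Finset.coe_insert, SimpleGraph.isClique_insert]
      exact ⟨h3, fun b hb _ => (mem_linkSet.1 (h1 hb)).2⟩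
  · simp [hvs] at hs

/-- `W` has `2 m` vertices and induces the one-skeleton of the cross-polytope of dimension `m`:
every vertex has exactly one non-neighbour. -/
def IsCrossPolytope (G : SimpleGraph V) (m : ℕ) (W : Finset V) : Prop :=
  W.card = 2 * m ∧ ∀ v ∈ W, ∃! u, u ∈ W ∧ u ≠ v ∧ ¬ G.Adj v u

/-- `W` splits into `v`, its neighbours, and its other non-neighbours. Counting the last class is
what detects cross-polytopes. -/
lemma card_linkSet_add {G : SimpleGraph V} {W : Finset V} {v : V} (hv : v ∈ W) :
    (linkSet G W v).card + ((W.erase v).filter fun u => u ∉ linkSet G W v).card + 1 = W.card := by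
  classical
  have h : linkSet G W v = (W.erase v).filter fun u => u ∈ linkSet G W v := by
    ext u
    simp only [Finset.mem_filter, Finset.mem_erase, mem_linkSet]
    exact ⟨fun h => ⟨⟨h.2.ne', h.1⟩, h⟩, fun h => h.2⟩
  rw [h]
  simp only [Finset.mem_filter]
  have h2 := Finset.card_filter_add_card_filter_not (s := W.erase v) (fun u => u ∈ linkSet G W v)
  have h3 : ((W.erase v).filter fun u => ¬ (u ∈ W.erase v ∧ u ∈ linkSet G W v)) =
      (W.erase v).filter fun u => u ∉ linkSet G W v := by
    ext u; simp only [Finset.mem_filter]; tauto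
  rw [h3, h2, Finset.card_erase_add_one hv]

/-- If the link cycle of `v` bounds in the link, then a cycle can be pushed off `v`. -/
lemma exists_pushOff {G : SimpleGraph V} {W : Finset V} {m : ℕ} {z : Finset V → ℚ} {v : V}
    (hv : v ∈ W) (hz : z ∈ cliqueChains G W (m + 1)) (hz0 : bdry z = 0)
    {w : Finset V → ℚ} (hw : w ∈ cliqueChains G (linkSet G W v) (m + 1))
    (hwz : bdry w = ann v z) :
    z + bdry (cre v w) ∈ cliqueChains G (W.erase v) (m + 1) ∧
      bdry (z + bdry (cre v w)) = 0 ∧ cre v w ∈ cliqueChains G W (m + 2) := by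
  have hc := cre_mem_cliqueChains hv hw
  refine ⟨?_, by rw [map_add, hz0, bdry_bdry, add_zero], hc⟩
  have h1 : z + bdry (cre v w) ∈ cliqueChains G W (m + 1) :=
    Submodule.add_mem _ hz (bdry_mem_cliqueChains hc)
  intro s hs
  obtain ⟨h2, h3⟩ := h1 s hs
  refine ⟨fun u hu => Finset.mem_erase.2 ⟨fun huv => ?_, h2 hu⟩, h3⟩
  subst huv
  apply hs
  have hwu : w s = 0 := by
    by_contra h
    exact (mem_linkSet.1 ((hw s h).1 hu)).2.ne rfl
  -- The new chain equals `w + ann u (cre u z)`, and both terms vanish on faces that contain `u`.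
  have := congrFun (ann_cre_self u z) s
  rw [bdry_cre, hwz]
  simp only [Pi.add_apply, Pi.sub_apply, hwu] at this ⊢
  rw [ann_apply, if_pos hu] at this
  linarith

/-- Induction on `m`, and within it on the number of vertices. Let `z` be a cycle that does not
bound. No link cycle `ann v z` bounds in the link of `v`, for otherwise `z` could be pushed off `v`,
and the resulting cycle would bound since too few vertices are left for a cross-polytope. If `v`
were joined to all of `W`, then `z` would be a cycle in a cone, hence its link cycle would bound. So
every vertex has a non-neighbour, the links are small enough for the outer induction, and they are
cross-polytopes of one dimension less; counting leaves exactly one non-neighbour for each vertex.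
The nonvanishing on all top cliques is carried through the induction because it later shows that the
space of cycles is one-dimensional. -/
theorem cycle_eq_bdry_or_crossPolytope (G : SimpleGraph V) (m : ℕ) :
    ∀ (W : Finset V), W.card ≤ 2 * m → ∀ z ∈ cliqueChains G W m, bdry z = 0 →
      (∃ w ∈ cliqueChains G W (m + 1), bdry w = z) ∨
      (IsCrossPolytope G m W ∧ ∀ s ⊆ W, s.card = m → G.IsClique (s : Set V) → z s ≠ 0) := by
  induction m with
  | zero =>
    intro W hW z hz _
    -- The empty set is the cross-polytope of dimension 0, and its cycle is the empty face.
    have hW0 : W = ∅ := Finset.card_eq_zero.1 (by omega)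
    subst hW0
    by_cases h : z ∅ = 0
    · refine Or.inl ⟨0, Submodule.zero_mem _, ?_⟩
      ext s
      by_contra hs
      have hs' : z s ≠ 0 := fun h' => hs (by simp [h'])
      have := (hz s hs').1
      rw [Finset.subset_empty] at this
      exact hs' (this ▸ h)
    · refine Or.inr ⟨⟨by simp, by simp⟩, fun s hs _ _ => ?_⟩
      rwa [Finset.subset_empty.1 hs]
  | succ m ih =>
    intro W
    induction hN : W.card using Nat.strong_induction_on generalizing W with
    | _ N ihN =>
    intro hW z hz hz0
    by_contra! hcon
    obtain ⟨hnb, hcon⟩ := hcon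
    -- the link cycle of every vertex is not a boundary in the link
    have hlink : ∀ v ∈ W, ¬ ∃ w ∈ cliqueChains G (linkSet G W v) (m + 1), bdry w = ann v z := by
      rintro v hv ⟨w, hw, hwz⟩
      obtain ⟨h1, h2, h3⟩ := exists_pushOff hv hz hz0 hw hwz
      have hcard : (W.erase v).card + 1 = W.card := Finset.card_erase_add_one hv
      rcases ihN (W.erase v).card (by omega) (W.erase v) rfl (by omega) _ h1 h2 with
        ⟨y, hy, hyz⟩ | ⟨hx, _⟩
      · refine hnb (y - cre v w) (Submodule.sub_mem _
          (cliqueChains_mono G (Finset.erase_subset _ _) _ hy) h3) ?_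
        rw [map_sub, hyz]; abel
      · have := hx.1; omega
    have hne : ∀ v ∈ W, ((W.erase v).filter fun u => u ∉ linkSet G W v).Nonempty := by
      intro v hv
      by_contra hem
      rw [Finset.not_nonempty_iff_eq_empty] at hem
      have hL : linkSet G W v = W.erase v := by
        ext u
        have := Finset.filter_eq_empty_iff.1 hem (x := u)
        simp only [not_not] at this
        refine ⟨fun h => Finset.mem_erase.2 ⟨(mem_linkSet.1 h).2.ne', (mem_linkSet.1 h).1⟩, this⟩
      apply hlink v hv
      -- This is minus the part of `z` away from `v`. It lives in the link because here the link is
      -- all of `W` except `v`.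
      refine ⟨cre v (ann v z) - z, ?_, ?_⟩
      · have h1 : cre v (ann v z) - z ∈ cliqueChains G W (m + 1) :=
          Submodule.sub_mem _ (cre_mem_cliqueChains hv (ann_mem_cliqueChains hz v)) hz
        intro s hs
        obtain ⟨h2, h3⟩ := h1 s hs
        refine ⟨?_, h3⟩
        rw [hL]
        refine fun u hu => Finset.mem_erase.2 ⟨fun huv => hs ?_, h2 hu⟩
        subst huv
        have := congrFun (ann_cre_self u z) s
        simp only [Pi.add_apply, Pi.sub_apply] at this ⊢
        rw [ann_apply, if_pos hu] at this
        linarith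
      · rw [map_sub, hz0, bdry_cre, bdry_ann, hz0, map_zero, neg_zero, map_zero]
        simp
    have hlink2 : ∀ v ∈ W, IsCrossPolytope G m (linkSet G W v) ∧
        ∀ s ⊆ linkSet G W v, s.card = m → G.IsClique (s : Set V) → ann v z s ≠ 0 := by
      intro v hv
      have hne := hne v hv
      have hc := card_linkSet_add (G := G) hv
      have hpos := Finset.card_pos.2 hne
      rcases ih (linkSet G W v) (by omega) _ (ann_mem_cliqueChains hz v)
        (by rw [bdry_ann, hz0, map_zero, neg_zero]) with h | h
      · exact absurd h (hlink v hv)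
      · exact h
    by_cases hWe : W = ∅
    · apply hnb 0 (Submodule.zero_mem _)
      rw [map_zero]
      ext s
      by_contra hs
      obtain ⟨h1, h2, _⟩ := hz s fun h => hs (by simp [h])
      rw [hWe, Finset.subset_empty] at h1
      simp [h1] at h2
    obtain ⟨v₀, hv₀⟩ := Finset.nonempty_iff_ne_empty.2 hWe
    -- Each link has exactly `2 * m` vertices and each vertex at least one non-neighbour, so the
    -- bound on `W.card` is attained and each vertex has only one.
    have hWc : W.card = 2 * (m + 1) ∧ ∀ v ∈ W,
        ((W.erase v).filter fun u => u ∉ linkSet G W v).card = 1 := by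
      have key : ∀ v ∈ W, (linkSet G W v).card = 2 * m := fun v hv => (hlink2 v hv).1.1
      have hv1 : ∀ v ∈ W, 2 * m + ((W.erase v).filter fun u => u ∉ linkSet G W v).card + 1
          = W.card := fun v hv => by rw [← card_linkSet_add hv, key v hv]
      have hp := fun v hv => Finset.card_pos.2 (hne v hv)
      have h0 := hv1 v₀ hv₀
      have hp0 := hp v₀ hv₀
      refine ⟨by omega, fun v hv => ?_⟩
      have := hv1 v hv
      omega
    obtain ⟨s, hsW, hsc, hsq, hs0⟩ := hcon ⟨hWc.1, fun v hv => by
      obtain ⟨u, hu⟩ := Finset.card_eq_one.1 (hWc.2 v hv)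
      have hiff : ∀ x, (x ∈ W ∧ x ≠ v ∧ ¬ G.Adj v x) ↔ x = u := fun x => by
        rw [← Finset.mem_singleton, ← hu, Finset.mem_filter, Finset.mem_erase, mem_linkSet]
        tauto
      exact ⟨u, (hiff u).2 rfl, fun y hy => (hiff y).1 hy⟩⟩
    -- Up to sign, the coefficient of `z` at `s` is that of the link cycle at `s` without `v`, which
    -- the induction makes nonzero.
    obtain ⟨v, hvs⟩ := Finset.card_pos.1 (by omega : 0 < s.card)
    refine (hlink2 v (hsW hvs)).2 (s.erase v) (fun u hu => ?_) ?_ ?_ ?_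
    · exact mem_linkSet.2 ⟨hsW (Finset.mem_of_mem_erase hu),
        hsq hvs (Finset.mem_of_mem_erase hu) (Finset.ne_of_mem_erase hu).symm⟩
    · rw [Finset.card_erase_of_mem hvs]; omega
    · exact hsq.subset (by simp)
    · rw [ann_apply, if_neg (Finset.notMem_erase v s), Finset.insert_erase hvs, hs0, mul_zero]

end CliqueChains

/-! ### Betti numbers and cross-polytope counts: the case of few vertices, additivity, crude bounds.
-/

section CliqueBetti

variable {V : Type*} [LinearOrder V] [Fintype V]

/-- The antipodal map is injective and sends a clique into its complement. -/
lemma IsCrossPolytope.card_clique_le {G : SimpleGraph V} {m : ℕ} {W s : Finset V}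
    (hW : IsCrossPolytope G m W) (hs : s ⊆ W) (hq : G.IsClique (s : Set V)) : s.card ≤ m := by
  choose! a ha hau using hW.2
  have hcard : s.card ≤ (W \ s).card := by
    refine Finset.card_le_card_of_injOn a (fun v hv => ?_) (fun v hv w hw h => ?_)
    · have h := ha v (hs hv)
      refine Finset.mem_coe.2 (Finset.mem_sdiff.2 ⟨h.1, fun hmem => h.2.2 ?_⟩)
      exact hq hv hmem h.2.1.symm
    · have h1 := ha v (hs hv)
      have h2 := ha w (hs hw)
      have h3 := hau (a v) h1.1
      have e1 := h3 v ⟨hs hv, h1.2.1.symm, fun h' => h1.2.2 h'.symm⟩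
      have e2 := h3 w ⟨hs hw, by rw [h]; exact h2.2.1.symm, fun h' => h2.2.2 (by
        rw [h] at h'; exact h'.symm)⟩
      exact e1.trans e2.symm
  have := Finset.card_sdiff_add_card_eq_card hs
  have := hW.1
  omega

/-- The cross-polytope carries a nonzero top-dimensional cycle. -/
lemma IsCrossPolytope.exists_cycle {G : SimpleGraph V} {m : ℕ} : ∀ {W : Finset V},
    IsCrossPolytope G m W → ∃ z ∈ cliqueChains G W m, bdry z = 0 ∧ z ≠ 0 := by
  induction m with
  | zero =>
    intro W hW
    refine ⟨Pi.single ∅ 1, fun s hs => ?_, ?_, ?_⟩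
    · have : s = ∅ := by
        by_contra h
        simp [h] at hs
      subst this
      simp
    · ext s
      rw [bdry_apply]
      refine Finset.sum_eq_zero fun v _ => ?_
      rw [ann_apply]
      split_ifs
      · rfl
      · simp
    · intro h
      simpa using congrFun h ∅
  | succ m ih =>
    intro W hW
    obtain ⟨v, hv⟩ : W.Nonempty := Finset.card_pos.1 (by rw [hW.1]; omega)
    obtain ⟨u, ⟨huW, huv, hadj⟩, huniq⟩ := hW.2 v hv
    have hadju : ¬ G.Adj u v := fun h => hadj h.symm
    have hL : ∀ x, x ∈ linkSet G W v ↔ x ∈ (W.erase v).erase u := by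
      intro x
      simp only [mem_linkSet, Finset.mem_erase]
      constructor
      · rintro ⟨h1, h2⟩
        exact ⟨fun h => hadj (h ▸ h2), h2.ne', h1⟩
      · rintro ⟨h1, h2, h3⟩
        refine ⟨h3, ?_⟩
        by_contra h
        exact h1 (huniq x ⟨h3, h2, h⟩)
    -- The antipodes `u` and `v` have the same link, so that the cross-polytope is the suspension of
    -- this link.
    have hLu : linkSet G W u = linkSet G W v := by
      ext x
      rw [hL, mem_linkSet, Finset.mem_erase, Finset.mem_erase]
      obtain ⟨y, _, hyu⟩ := hW.2 u huW
      have hvy := hyu v ⟨hv, huv.symm, hadju⟩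
      constructor
      · rintro ⟨h1, h2⟩
        exact ⟨h2.ne', fun h => hadju (h ▸ h2), h1⟩
      · rintro ⟨h1, h2, h3⟩
        refine ⟨h3, ?_⟩
        by_contra h
        exact h2 ((hyu x ⟨h3, h1, h⟩).trans hvy.symm)
    have hLc : IsCrossPolytope G m (linkSet G W v) := by
      have hLe : linkSet G W v = (W.erase v).erase u := by ext x; exact hL x
      constructor
      · rw [hLe, Finset.card_erase_of_mem (Finset.mem_erase.2 ⟨huv, huW⟩),
          Finset.card_erase_of_mem hv, hW.1]
        omega
      · intro x hx
        have hxv := (mem_linkSet.1 hx).2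
        have hxu := (mem_linkSet.1 (hLu ▸ hx)).2
        obtain ⟨y, ⟨hy1, hy2, hy3⟩, hyx⟩ := hW.2 x (mem_linkSet.1 hx).1
        refine ⟨y, ⟨(hL y).2 ?_, hy2, hy3⟩, fun t ht => hyx t ⟨(mem_linkSet.1 ht.1).1, ht.2⟩⟩
        refine Finset.mem_erase.2 ⟨?_, Finset.mem_erase.2 ⟨?_, hy1⟩⟩
        · rintro rfl; exact hy3 hxu.symm
        · rintro rfl; exact hy3 hxv.symm
    obtain ⟨z, hz, hz0, hzne⟩ := ih hLc
    -- The suspension of the cycle of the link: both cones have boundary `z`.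
    refine ⟨cre v z - cre u z, Submodule.sub_mem _ (cre_mem_cliqueChains hv hz)
      (cre_mem_cliqueChains huW (hLu ▸ hz)), ?_, ?_⟩
    · rw [map_sub, bdry_cre, bdry_cre, hz0, map_zero, map_zero, sub_self]
    · obtain ⟨s, hs⟩ := Function.ne_iff.1 hzne
      have hsL := (hz s hs).1
      have hvs : v ∉ s := fun h => by
        have := (hL v).1 (hsL h); simp at this
      have hus : u ∉ s := fun h => by
        have := (hL u).1 (hsL h); simp at this
      intro h
      have := congrFun h (insert v s)
      simp only [Pi.sub_apply, cre_apply, Finset.mem_insert_self, if_true, Pi.zero_apply,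
        Finset.mem_insert, huv, hus, or_self, if_false, Finset.erase_insert hvs, sub_zero] at this
      exact (mul_ne_zero (sgn_ne_zero _ _) hs) this

/-- Cycles supported on the `m`-cliques of `W`. -/
def cliqueCycles (G : SimpleGraph V) (W : Finset V) (m : ℕ) : Submodule ℚ (Finset V → ℚ) :=
  cliqueChains G W m ⊓ LinearMap.ker bdry

/-- Boundaries of chains supported on the `(m + 1)`-cliques of `W`. -/
def cliqueBoundaries (G : SimpleGraph V) (W : Finset V) (m : ℕ) : Submodule ℚ (Finset V → ℚ) :=
  (cliqueChains G W (m + 1)).map bdry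

lemma cliqueBoundaries_le (G : SimpleGraph V) (W : Finset V) (m : ℕ) :
    cliqueBoundaries G W m ≤ cliqueCycles G W m := by
  rintro _ ⟨w, hw, rfl⟩
  exact ⟨bdry_mem_cliqueChains hw, bdry_bdry w⟩

/-- The reduced Betti number, in dimension `m - 1`, of the clique complex of `G` restricted
to `W`. -/
def cliqueBetti (G : SimpleGraph V) (W : Finset V) (m : ℕ) : ℕ :=
  Module.finrank ℚ (cliqueCycles G W m) - Module.finrank ℚ (cliqueBoundaries G W m)

lemma cliqueBetti_add (G : SimpleGraph V) (W : Finset V) (m : ℕ) :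
    cliqueBetti G W m + Module.finrank ℚ (cliqueBoundaries G W m) =
      Module.finrank ℚ (cliqueCycles G W m) :=
  Nat.sub_add_cancel (Submodule.finrank_mono (cliqueBoundaries_le G W m))

open Classical in
/-- The number of subsets of `W` that induce a cross-polytope of dimension `m`. -/
def crossPolytopeCount (G : SimpleGraph V) (W : Finset V) (m : ℕ) : ℕ :=
  (W.powerset.filter (IsCrossPolytope G m)).card

/-- With so few vertices the only candidate for a cross-polytope is `W` itself. If it is one, there
are no cliques of size `m + 1`, hence no boundaries, and the cycles form a line. If it is not, every
cycle bounds. -/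
lemma cliqueBetti_eq_crossPolytopeCount (G : SimpleGraph V) {W : Finset V} {m : ℕ}
    (hW : W.card ≤ 2 * m) : cliqueBetti G W m = crossPolytopeCount G W m := by
  classical
  have hsub : ∀ S ⊆ W, IsCrossPolytope G m S → S = W := fun S hS hx =>
    Finset.eq_of_subset_of_card_le hS (by rw [hx.1]; exact hW)
  by_cases hx : IsCrossPolytope G m W
  · have h1 : crossPolytopeCount G W m = 1 := by
      rw [crossPolytopeCount, Finset.card_eq_one]
      refine ⟨W, ?_⟩
      ext S
      simp only [Finset.mem_filter, Finset.mem_powerset, Finset.mem_singleton]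
      exact ⟨fun h => hsub S h.1 h.2, by rintro rfl; exact ⟨subset_rfl, hx⟩⟩
    have hB : cliqueChains G W (m + 1) = ⊥ := by
      rw [eq_bot_iff]
      intro z hz
      ext s
      by_contra hs
      obtain ⟨h1, h2, h3⟩ := hz s hs
      have := hx.card_clique_le h1 h3
      omega
    obtain ⟨z, hz, hz0, hzne⟩ := hx.exists_cycle
    obtain ⟨s, hs⟩ := Function.ne_iff.1 hzne
    obtain ⟨hsW, hsc, hsq⟩ := hz s hs
    have hZ : cliqueCycles G W m = Submodule.span ℚ {z} := by
      apply le_antisymm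
      · rintro y ⟨hy, hy0⟩
        -- The multiple of `z` is chosen to cancel the coefficient at `s`, which contradicts the
        -- cross-polytope alternative. So the difference bounds and is therefore zero.
        have hmem : y - (y s / z s) • z ∈ cliqueChains G W m :=
          Submodule.sub_mem _ hy (Submodule.smul_mem _ _ hz)
        rcases cycle_eq_bdry_or_crossPolytope G m W hW _ hmem (by
          rw [map_sub, map_smul, hz0, LinearMap.mem_ker.1 hy0]; simp) with ⟨w, hw, hwz⟩ | ⟨_, h⟩
        · rw [hB, Submodule.mem_bot] at hw
          rw [hw, map_zero] at hwz
          exact Submodule.mem_span_singleton.2 ⟨_, (sub_eq_zero.1 hwz.symm).symm⟩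
        · refine absurd ?_ (h s hsW hsc hsq)
          have hs' : z s ≠ 0 := hs
          simp [div_mul_cancel₀ _ hs']
      · rw [Submodule.span_singleton_le_iff_mem]
        exact ⟨hz, hz0⟩
    rw [h1, cliqueBetti, hZ, cliqueBoundaries, hB, Submodule.map_bot, finrank_bot,
      finrank_span_singleton hzne]
  · have h0 : crossPolytopeCount G W m = 0 := by
      rw [crossPolytopeCount, Finset.card_eq_zero, Finset.filter_eq_empty_iff]
      intro S hS hxS
      exact hx (hsub S (Finset.mem_powerset.1 hS) hxS ▸ hxS)
    have hle : cliqueCycles G W m ≤ cliqueBoundaries G W m := by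
      rintro y ⟨hy, hy0⟩
      rcases cycle_eq_bdry_or_crossPolytope G m W hW y hy hy0 with ⟨w, hw, hwz⟩ | ⟨h, _⟩
      · exact ⟨w, hw, hwz⟩
      · exact absurd h hx
    rw [h0, cliqueBetti, Nat.sub_eq_zero_of_le (Submodule.finrank_mono hle)]

lemma clique_subset_or {G : SimpleGraph V} {C D s : Finset V}
    (hno : ∀ u ∈ C, ∀ v ∈ D, ¬ G.Adj u v) (hs : s ⊆ C ∪ D)
    (hq : G.IsClique (s : Set V)) : s ⊆ C ∨ s ⊆ D := by
  by_contra! h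
  obtain ⟨h1, h2⟩ := h
  obtain ⟨x, hx, hxC⟩ := Finset.not_subset.1 h1
  obtain ⟨y, hy, hyD⟩ := Finset.not_subset.1 h2
  have hxD := (Finset.mem_union.1 (hs hx)).resolve_left hxC
  have hyC := (Finset.mem_union.1 (hs hy)).resolve_right hyD
  exact hno y hyC x hxD (hq hy hx (fun h => hyD (h ▸ hxD)))

lemma cliqueChains_union {G : SimpleGraph V} {C D : Finset V}
    (hno : ∀ u ∈ C, ∀ v ∈ D, ¬ G.Adj u v) (m : ℕ) :
    cliqueChains G (C ∪ D) m = cliqueChains G C m ⊔ cliqueChains G D m := by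
  classical
  apply le_antisymm
  · intro z hz
    rw [Submodule.mem_sup]
    refine ⟨fun s => if s ⊆ C then z s else 0, ?_, fun s => if s ⊆ C then 0 else z s, ?_, ?_⟩
    · intro s hs
      by_cases h : s ⊆ C
      · exact ⟨h, (hz s (by simpa [h] using hs)).2⟩
      · simp [h] at hs
    · intro s hs
      by_cases h : s ⊆ C
      · simp [h] at hs
      · have := hz s (by simpa [h] using hs)
        exact ⟨(clique_subset_or hno this.1 this.2.2).resolve_left h, this.2⟩
    · ext s
      by_cases h : s ⊆ C <;> simp [h]
  · exact sup_le (cliqueChains_mono G Finset.subset_union_left m)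
      (cliqueChains_mono G Finset.subset_union_right m)

lemma cliqueChains_disjoint (G : SimpleGraph V) {C D : Finset V} (hCD : Disjoint C D) {m : ℕ}
    (hm : 1 ≤ m) : Disjoint (cliqueChains G C m) (cliqueChains G D m) := by
  rw [Submodule.disjoint_def]
  intro z hzC hzD
  ext s
  by_contra hs
  obtain ⟨h1, h2, _⟩ := hzC s hs
  obtain ⟨h3, _⟩ := hzD s hs
  obtain ⟨x, hx⟩ := Finset.card_pos.1 (by omega : 0 < s.card)
  exact Finset.disjoint_left.1 hCD (h1 hx) (h3 hx)

lemma finrank_sup_of_disjoint {A B : Submodule ℚ (Finset V → ℚ)} (h : Disjoint A B) :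
    Module.finrank ℚ (A ⊔ B : Submodule ℚ (Finset V → ℚ)) =
      Module.finrank ℚ A + Module.finrank ℚ B := by
  have := Submodule.finrank_sup_add_finrank_inf_eq A B
  rwa [h.eq_bot, finrank_bot, add_zero] at this

/-- A cycle on the union splits into chains on `C` and `D` whose boundaries cancel. For `2 ≤ m`
these boundaries have disjoint supports, so each vanishes. For `m = 1` both could be multiples of
the empty face, which is the usual failure of additivity of reduced homology in dimension 0. -/
lemma cliqueBetti_union {G : SimpleGraph V} {C D : Finset V}
    (hno : ∀ u ∈ C, ∀ v ∈ D, ¬ G.Adj u v) (hCD : Disjoint C D) {m : ℕ} (hm : 2 ≤ m) :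
    cliqueBetti G (C ∪ D) m = cliqueBetti G C m + cliqueBetti G D m := by
  have hZ : cliqueCycles G (C ∪ D) m = cliqueCycles G C m ⊔ cliqueCycles G D m := by
    apply le_antisymm
    · rintro z ⟨hz, hz0⟩
      rw [SetLike.mem_coe, cliqueChains_union hno, Submodule.mem_sup] at hz
      obtain ⟨x, hx, y, hy, rfl⟩ := hz
      obtain ⟨m, rfl⟩ : ∃ m', m = m' + 1 := ⟨m - 1, by omega⟩
      have hx0 : bdry x = 0 := by
        refine Submodule.disjoint_def.1 (cliqueChains_disjoint G hCD (m := m) (by omega)) _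
          (bdry_mem_cliqueChains hx) ?_
        have : bdry x = - bdry y := by
          rw [← add_eq_zero_iff_eq_neg, ← map_add]; exact hz0
        rw [this]
        exact Submodule.neg_mem _ (bdry_mem_cliqueChains hy)
      have hy0 : bdry y = 0 := by
        have : bdry (x + y) = 0 := hz0
        rwa [map_add, hx0, zero_add] at this
      exact Submodule.add_mem_sup ⟨hx, hx0⟩ ⟨hy, hy0⟩
    · refine sup_le ?_ ?_
      · exact inf_le_inf_right _ (cliqueChains_mono G Finset.subset_union_left m)
      · exact inf_le_inf_right _ (cliqueChains_mono G Finset.subset_union_right m)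
  have hB : cliqueBoundaries G (C ∪ D) m = cliqueBoundaries G C m ⊔ cliqueBoundaries G D m := by
    rw [cliqueBoundaries, cliqueChains_union hno, Submodule.map_sup]; rfl
  have hZd : Disjoint (cliqueCycles G C m) (cliqueCycles G D m) :=
    (cliqueChains_disjoint G hCD (by omega)).mono inf_le_left inf_le_left
  have hBd : Disjoint (cliqueBoundaries G C m) (cliqueBoundaries G D m) :=
    hZd.mono (cliqueBoundaries_le G C m) (cliqueBoundaries_le G D m)
  have h1 := cliqueBetti_add G (C ∪ D) m
  have h2 := cliqueBetti_add G C m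
  have h3 := cliqueBetti_add G D m
  rw [hZ, hB, finrank_sup_of_disjoint hZd, finrank_sup_of_disjoint hBd] at h1
  omega

lemma IsCrossPolytope.congr {G G' : SimpleGraph V} {m : ℕ} {W : Finset V}
    (h : ∀ u ∈ W, ∀ v ∈ W, G.Adj u v ↔ G'.Adj u v) :
    IsCrossPolytope G m W ↔ IsCrossPolytope G' m W := by
  refine and_congr_right fun _ => forall₂_congr fun v hv => existsUnique_congr fun u => ?_
  refine and_congr_right fun hu => ?_
  rw [h v hv u hu]

lemma crossPolytopeCount_congr {G G' : SimpleGraph V} {m : ℕ} {W : Finset V}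
    (h : ∀ u ∈ W, ∀ v ∈ W, G.Adj u v ↔ G'.Adj u v) :
    crossPolytopeCount G W m = crossPolytopeCount G' W m := by
  classical
  unfold crossPolytopeCount
  congr 1
  refine Finset.filter_congr fun S hS => ?_
  rw [Finset.mem_powerset] at hS
  exact IsCrossPolytope.congr fun u hu v hv => h u (hS hu) v (hS hv)

lemma cliqueChains_congr {G G' : SimpleGraph V} {m : ℕ} {W : Finset V}
    (h : ∀ u ∈ W, ∀ v ∈ W, G.Adj u v ↔ G'.Adj u v) :
    cliqueChains G W m = cliqueChains G' W m := by
  ext z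
  refine forall_congr' fun s => imp_congr_right fun _ => and_congr_right fun hs =>
    and_congr_right fun _ => ?_
  exact ⟨fun H u hu v hv huv => (h u (hs hu) v (hs hv)).1 (H hu hv huv),
    fun H u hu v hv huv => (h u (hs hu) v (hs hv)).2 (H hu hv huv)⟩

lemma cliqueBetti_congr {G G' : SimpleGraph V} {m : ℕ} {W : Finset V}
    (h : ∀ u ∈ W, ∀ v ∈ W, G.Adj u v ↔ G'.Adj u v) :
    cliqueBetti G W m = cliqueBetti G' W m := by
  have h1 : cliqueCycles G W m = cliqueCycles G' W m := by
    rw [cliqueCycles, cliqueCycles, cliqueChains_congr h]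
  have h2 : cliqueBoundaries G W m = cliqueBoundaries G' W m := by
    rw [cliqueBoundaries, cliqueBoundaries, cliqueChains_congr h]
  rw [cliqueBetti, cliqueBetti, h1, h2]

/-- A cross-polytope meeting both sides would have at most one vertex on each, since every vertex on
one side is a non-neighbour of every vertex on the other; but it has `2 * m ≥ 4` vertices. -/
lemma crossPolytopeCount_union {G : SimpleGraph V} {C D : Finset V}
    (hno : ∀ u ∈ C, ∀ v ∈ D, ¬ G.Adj u v) (hCD : Disjoint C D) {m : ℕ} (hm : 2 ≤ m) :
    crossPolytopeCount G (C ∪ D) m = crossPolytopeCount G C m + crossPolytopeCount G D m := by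
  classical
  unfold crossPolytopeCount
  rw [← Finset.card_union_of_disjoint]
  · congr 1
    ext S
    simp only [Finset.mem_union, Finset.mem_filter, Finset.mem_powerset]
    constructor
    · rintro ⟨hS, hx⟩
      rw [← or_and_right]
      refine ⟨?_, hx⟩
      by_contra! h
      obtain ⟨h1, h2⟩ := h
      obtain ⟨x, hx1, hxC⟩ := Finset.not_subset.1 h1
      obtain ⟨y, hy1, hyD⟩ := Finset.not_subset.1 h2
      have hxD := (Finset.mem_union.1 (hS hx1)).resolve_left hxC
      have hyC := (Finset.mem_union.1 (hS hy1)).resolve_right hyD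
      have hsub : S ⊆ {x, y} := by
        intro u hu
        rcases Finset.mem_union.1 (hS hu) with huC | huD
        · obtain ⟨w, _, hw⟩ := hx.2 x hx1
          have e1 := hw u ⟨hu, fun h => hxC (h ▸ huC), fun h => hno u huC x hxD h.symm⟩
          have e2 := hw y ⟨hy1, fun h => hxC (h ▸ hyC), fun h => hno y hyC x hxD h.symm⟩
          simp [e1, e2]
        · obtain ⟨w, _, hw⟩ := hx.2 y hy1
          have e1 := hw u ⟨hu, fun h => hyD (h ▸ huD), fun h => hno y hyC u huD h⟩
          have e2 := hw x ⟨hx1, fun h => hyD (h ▸ hxD), fun h => hno y hyC x hxD h⟩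
          simp [e1, e2]
      have := (Finset.card_le_card hsub).trans Finset.card_le_two
      have := hx.1
      omega
    · rintro (⟨h, hx⟩ | ⟨h, hx⟩)
      · exact ⟨h.trans Finset.subset_union_left, hx⟩
      · exact ⟨h.trans Finset.subset_union_right, hx⟩
  · rw [Finset.disjoint_left]
    intro S hS hS'
    simp only [Finset.mem_filter, Finset.mem_powerset] at hS hS'
    obtain ⟨x, hx⟩ := Finset.card_pos.1 (by rw [hS.2.1]; omega : 0 < S.card)
    exact Finset.disjoint_left.1 hCD (hS.1 hx) (hS'.1 hx)

lemma crossPolytopeCount_le (G : SimpleGraph V) (W : Finset V) (m : ℕ) :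
    crossPolytopeCount G W m ≤ W.card ^ (2 * m) := by
  classical
  refine le_trans ?_ (Nat.choose_le_pow W.card (2 * m))
  rw [← Finset.card_powersetCard]
  refine Finset.card_le_card fun S hS => ?_
  rw [Finset.mem_filter, Finset.mem_powerset] at hS
  exact Finset.mem_powersetCard.2 ⟨hS.1, hS.2.1⟩

lemma cliqueBetti_le (G : SimpleGraph V) (W : Finset V) (m : ℕ) :
    cliqueBetti G W m ≤ W.card ^ m := by
  classical
  refine le_trans ?_ (Nat.choose_le_pow W.card m)
  refine (Nat.sub_le _ _).trans ?_
  let e : cliqueCycles G W m →ₗ[ℚ] (W.powersetCard m → ℚ) :=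
    (LinearMap.funLeft ℚ ℚ (Subtype.val : W.powersetCard m → Finset V)).comp
      (Submodule.subtype _)
  have he : Function.Injective e := by
    rw [← LinearMap.ker_eq_bot, LinearMap.ker_eq_bot']
    rintro ⟨z, hz, hz0⟩ h
    ext s
    by_contra hs
    have h1 := hz s hs
    exact hs (congrFun h ⟨s, Finset.mem_powersetCard.2 ⟨h1.1, h1.2.1⟩⟩)
  have := LinearMap.finrank_le_finrank_of_injective he
  rwa [Module.finrank_fintype_fun_eq_card, Fintype.card_coe, Finset.card_powersetCard] at this

end CliqueBetti

/-! ### Comparison of simplicial homology with the chains on finite sets. -/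

section Comparison

variable {V : Type*} [LinearOrder V] [Fintype V]

/-- Extension of simplicial chains by zero to functions on all finite sets of vertices. -/
def extendChain (Δ : AbstractSimplicialComplex V) (k : ℕ) : Chain Δ k →ₗ[ℚ] (Finset V → ℚ) :=
  Finsupp.lcoeFun.comp (Finsupp.lmapDomain ℚ ℚ Subtype.val)

lemma extendChain_single (Δ : AbstractSimplicialComplex V) {k : ℕ} (s : Face Δ k) (c : ℚ) :
    extendChain Δ k (Finsupp.single s c) = Pi.single s.1 c := by
  ext t
  simp [extendChain, Finsupp.mapDomain_single, Finsupp.single_apply, Pi.single_apply, eq_comm]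

lemma extendChain_injective (Δ : AbstractSimplicialComplex V) (k : ℕ) :
    Function.Injective (extendChain Δ k) :=
  DFunLike.coe_injective.comp (Finsupp.mapDomain_injective Subtype.val_injective)

lemma ann_single (v : V) (t : Finset V) (c : ℚ) :
    ann v (Pi.single t c) = if v ∈ t then Pi.single (t.erase v) (c * sgn v t) else 0 := by
  ext s
  rw [ann_apply]
  by_cases hvs : v ∈ s
  · rw [if_pos hvs]
    split_ifs
    · rw [Pi.single_apply, if_neg]
      rintro rfl
      simp at hvs
    · rfl
  · rw [if_neg hvs]
    by_cases hvt : v ∈ t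
    · rw [if_pos hvt, Pi.single_apply, Pi.single_apply]
      by_cases h : s = t.erase v
      · subst h
        rw [Finset.insert_erase hvt, if_pos rfl, if_pos rfl, sgn_erase_self, mul_comm]
      · rw [if_neg h, if_neg, mul_zero]
        rintro rfl
        exact h (Finset.erase_insert hvs).symm
    · rw [if_neg hvt, Pi.single_apply, if_neg, mul_zero, Pi.zero_apply]
      rintro rfl
      simp at hvt

lemma extendChain_boundary (Δ : AbstractSimplicialComplex V) (k : ℕ) (z : Chain Δ (k + 1)) :
    extendChain Δ k (boundary Δ k z) = bdry (extendChain Δ (k + 1) z) := by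
  suffices h : (extendChain Δ k).comp (boundary Δ k) = bdry.comp (extendChain Δ (k + 1)) from
    LinearMap.congr_fun h z
  refine Finsupp.lhom_ext fun s c => ?_
  rw [LinearMap.comp_apply, LinearMap.comp_apply, boundary, Finsupp.linearCombination_single,
    map_smul, map_sum, extendChain_single, bdry_eq_sum]
  simp_rw [extendChain_single, ann_single]
  rw [← Finset.sum_filter, Finset.filter_mem_eq_inter, Finset.univ_inter,
    ← Finset.sum_coe_sort s.1, Finset.smul_sum]
  refine Finset.sum_congr rfl fun v _ => ?_
  rw [← Pi.single_smul, smul_eq_mul]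
  rfl

lemma range_extendChain (G : SimpleGraph V) (k : ℕ) :
    LinearMap.range (extendChain (cliqueComplex G) k) = cliqueChains G Finset.univ (k + 1) := by
  apply le_antisymm
  · rintro _ ⟨z, rfl⟩
    induction z using Finsupp.induction_linear with
    | zero => rw [map_zero]; exact Submodule.zero_mem _
    | add x y hx hy => rw [map_add]; exact Submodule.add_mem _ hx hy
    | single s c =>
      rw [extendChain_single]
      intro t ht
      have : t = s.1 := by
        by_contra h
        rw [Pi.single_apply, if_neg h] at ht
        exact ht rfl
      subst this
      exact ⟨Finset.subset_univ _, s.2.2, s.2.1.2⟩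
  · intro z hz
    have hz' : z = ∑ s : Finset V, Pi.single s (z s) := (Finset.univ_sum_single z).symm
    rw [hz']
    refine Submodule.sum_mem _ fun s _ => ?_
    by_cases h : z s = 0
    · rw [h, Pi.single_zero]; exact Submodule.zero_mem _
    · obtain ⟨_, h2, h3⟩ := hz s h
      exact ⟨Finsupp.single ⟨s, ⟨Finset.card_pos.1 (by omega), h3⟩, h2⟩ (z s),
        extendChain_single _ _ _⟩

/-- For `1 ≤ k` the boundary maps involved do not reach the empty face, so reduced and unreduced
homology agree. The index shifts because chains here are graded by dimension and clique chains by
number of vertices. -/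
theorem betti_cliqueComplex (G : SimpleGraph V) {k : ℕ} (hk : 1 ≤ k) :
    betti (cliqueComplex G) k = cliqueBetti G Finset.univ (k + 1) := by
  obtain ⟨k, rfl⟩ : ∃ j, k = j + 1 := ⟨k - 1, by omega⟩
  set Δ := cliqueComplex G
  have hinj := extendChain_injective Δ (k + 1)
  have hle : LinearMap.range (boundary Δ (k + 1)) ≤ cycles Δ (k + 1) := by
    rintro _ ⟨z, rfl⟩
    apply extendChain_injective Δ k
    rw [extendChain_boundary, extendChain_boundary, bdry_bdry, map_zero]
  have hZ : (cycles Δ (k + 1)).map (extendChain Δ (k + 1)) =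
      cliqueCycles G Finset.univ (k + 2) := by
    ext z
    constructor
    · rintro ⟨y, hy, rfl⟩
      refine ⟨?_, ?_⟩
      · rw [SetLike.mem_coe, ← range_extendChain]; exact ⟨y, rfl⟩
      · have hy' : boundary Δ k y = 0 := hy
        rw [SetLike.mem_coe, LinearMap.mem_ker, ← extendChain_boundary, hy', map_zero]
    · rintro ⟨hz, hz0⟩
      rw [SetLike.mem_coe, ← range_extendChain] at hz
      obtain ⟨y, rfl⟩ := hz
      refine ⟨y, ?_, rfl⟩
      change boundary Δ k y = 0
      apply extendChain_injective Δ k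
      rw [extendChain_boundary, map_zero]
      exact hz0
  have hB : (LinearMap.range (boundary Δ (k + 1))).map (extendChain Δ (k + 1)) =
      cliqueBoundaries G Finset.univ (k + 2) := by
    rw [cliqueBoundaries, ← range_extendChain, ← LinearMap.range_comp, ← LinearMap.range_comp]
    congr 1
    exact LinearMap.ext fun z => extendChain_boundary Δ (k + 1) z
  have e1 := (Submodule.equivMapOfInjective _ hinj (cycles Δ (k + 1))).finrank_eq
  have e2 := (Submodule.equivMapOfInjective _ hinj
    (LinearMap.range (boundary Δ (k + 1)))).finrank_eq
  have e3 := (Submodule.submoduleOfEquivOfLe hle).finrank_eq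
  have e4 := Submodule.finrank_quotient_add_finrank
    ((LinearMap.range (boundary Δ (k + 1))).submoduleOf (cycles Δ (k + 1)))
  rw [hZ] at e1
  rw [hB] at e2
  rw [e3, e2, e1] at e4
  exact Nat.eq_sub_of_add_eq e4

end Comparison

/-! ### The difference of Betti number and cross-polytope count is carried by large components. -/

section Remainder

variable {V : Type*} [LinearOrder V] [Fintype V]

/-- The difference between the Betti number and the number of cross-polytopes. -/
def bettiRemainder (G : SimpleGraph V) (W : Finset V) (m : ℕ) : ℝ :=
  (cliqueBetti G W m : ℝ) - crossPolytopeCount G W m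

/-- The bound `c ^ (2 m)` for the contribution of a component with `c` vertices, which vanishes for
`c ≤ 2 m`. -/
def componentWeight (m c : ℕ) : ℝ := if 2 * m < c then (c : ℝ) ^ (2 * m) else 0

lemma componentWeight_mono (m : ℕ) : Monotone (componentWeight m) := by
  intro a b h
  unfold componentWeight
  split_ifs with h1 h2
  · gcongr
  · omega
  · positivity
  · rfl

/-- Up to `2 * m` vertices the two numbers agree. Beyond that both lie between 0 and the weight. -/
lemma abs_bettiRemainder_le (G : SimpleGraph V) (W : Finset V) (m : ℕ) :
    |bettiRemainder G W m| ≤ componentWeight m W.card := by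
  unfold componentWeight bettiRemainder
  split_ifs with h
  · have h1 : (crossPolytopeCount G W m : ℝ) ≤ (W.card : ℝ) ^ (2 * m) := by
      exact_mod_cast crossPolytopeCount_le G W m
    have h2 : (cliqueBetti G W m : ℝ) ≤ (W.card : ℝ) ^ (2 * m) := by
      have : W.card ^ m ≤ W.card ^ (2 * m) := Nat.pow_le_pow_right (by omega) (by omega)
      exact_mod_cast (cliqueBetti_le G W m).trans this
    rw [abs_le]
    constructor
    · linarith [Nat.cast_nonneg (α := ℝ) (cliqueBetti G W m)]
    · linarith [Nat.cast_nonneg (α := ℝ) (crossPolytopeCount G W m)]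
  · rw [cliqueBetti_eq_crossPolytopeCount G (by omega), sub_self, abs_zero]

lemma bettiRemainder_union {G : SimpleGraph V} {C D : Finset V}
    (hno : ∀ u ∈ C, ∀ v ∈ D, ¬ G.Adj u v) (hCD : Disjoint C D) {m : ℕ} (hm : 2 ≤ m) :
    bettiRemainder G (C ∪ D) m = bettiRemainder G C m + bettiRemainder G D m := by
  rw [bettiRemainder, cliqueBetti_union hno hCD hm, crossPolytopeCount_union hno hCD hm,
    bettiRemainder, bettiRemainder]
  push_cast
  ring

lemma bettiRemainder_congr {G G' : SimpleGraph V} {m : ℕ} {W : Finset V}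
    (h : ∀ u ∈ W, ∀ v ∈ W, G.Adj u v ↔ G'.Adj u v) :
    bettiRemainder G W m = bettiRemainder G' W m := by
  rw [bettiRemainder, bettiRemainder, cliqueBetti_congr h, crossPolytopeCount_congr h]

/-- The graph `G` with all edges at vertices of `T` deleted. -/
def isolate (G : SimpleGraph V) (T : Finset V) : SimpleGraph V where
  Adj u v := G.Adj u v ∧ u ∉ T ∧ v ∉ T
  symm := ⟨fun _ _ h => ⟨h.1.symm, h.2.2, h.2.1⟩⟩
  loopless := ⟨fun _ h => h.1.ne rfl⟩

lemma isolate_le (G : SimpleGraph V) (T : Finset V) : isolate G T ≤ G := fun _ _ h => h.1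

open Classical in
/-- The vertices that can be reached from `v`. -/
def componentOf (G : SimpleGraph V) (v : V) : Finset V := Finset.univ.filter (G.Reachable v)

lemma mem_componentOf {G : SimpleGraph V} {u v : V} : u ∈ componentOf G v ↔ G.Reachable v u := by
  simp [componentOf]

lemma componentOf_mono {G G' : SimpleGraph V} (h : G ≤ G') (v : V) :
    componentOf G v ⊆ componentOf G' v := fun _ hu =>
  mem_componentOf.2 ((mem_componentOf.1 hu).mono h)

lemma bettiRemainder_eq_componentOf_add (G : SimpleGraph V) (i : V) {m : ℕ} (hm : 2 ≤ m) :
    bettiRemainder G Finset.univ m = bettiRemainder G (componentOf G i) m +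
      bettiRemainder G (componentOf G i)ᶜ m := by
  rw [← bettiRemainder_union _ disjoint_compl_right hm, Finset.union_compl]
  intro u hu v hv h
  rw [Finset.mem_compl, mem_componentOf] at hv
  exact hv ((mem_componentOf.1 hu).trans h.reachable)

/-- Isolating `i` changes edges only inside the component of `i`, so the complement contributes
equally to both graphs and cancels. Isolating rather than deleting keeps the vertex set fixed; for
geometric graphs it also gives a quantity independent of the `i`-th point, as the Efron–Stein
inequality requires. -/
lemma abs_bettiRemainder_sub_isolate_le (G : SimpleGraph V) (i : V) {m : ℕ} (hm : 2 ≤ m) :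
    |bettiRemainder G Finset.univ m - bettiRemainder (isolate G {i}) Finset.univ m| ≤
      2 * componentWeight m (componentOf G i).card := by
  have h1 := bettiRemainder_eq_componentOf_add G i hm
  have h2 : bettiRemainder (isolate G {i}) Finset.univ m =
      bettiRemainder (isolate G {i}) (componentOf G i) m +
        bettiRemainder G (componentOf G i)ᶜ m := by
    rw [bettiRemainder_congr (G := G) (G' := isolate G {i}) (W := (componentOf G i)ᶜ),
      ← bettiRemainder_union _ disjoint_compl_right hm, Finset.union_compl]
    · intro u hu v hv h
      rw [Finset.mem_compl, mem_componentOf] at hv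
      exact hv ((mem_componentOf.1 hu).trans h.1.reachable)
    · have hi : ∀ u ∈ (componentOf G i)ᶜ, u ∉ ({i} : Finset V) := by
        intro u hu h
        rw [Finset.mem_singleton] at h
        subst h
        rw [Finset.mem_compl, mem_componentOf] at hu
        exact hu (SimpleGraph.Reachable.refl _)
      exact fun u hu v hv => ⟨fun h => ⟨h, hi u hu, hi v hv⟩, fun h => h.1⟩
  rw [h1, h2, add_sub_add_right_eq_sub]
  refine (abs_sub _ _).trans ?_
  rw [two_mul]
  exact add_le_add (abs_bettiRemainder_le _ _ _) (abs_bettiRemainder_le _ _ _)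

/-- The vertices are isolated one at a time. Components only shrink in the process and the weight is
monotone, so the components of `G` itself may be used in the bound. -/
lemma abs_bettiRemainder_sub_isolate_finset_le (G : SimpleGraph V) (T : Finset V) {m : ℕ}
    (hm : 2 ≤ m) :
    |bettiRemainder G Finset.univ m - bettiRemainder (isolate G T) Finset.univ m| ≤
      ∑ i ∈ T, 2 * componentWeight m (componentOf G i).card := by
  induction T using Finset.induction_on with
  | empty =>
    have : isolate G ∅ = G := by ext u v; simp [isolate]
    simp [this]
  | insert i T hi ih =>
    have : isolate G (insert i T) = isolate (isolate G T) {i} := by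
      ext u v; simp only [isolate, Finset.mem_insert, Finset.mem_singleton]; tauto
    rw [Finset.sum_insert hi, this]
    have h1 := abs_bettiRemainder_sub_isolate_le (isolate G T) i hm
    have h2 := componentWeight_mono m (Finset.card_le_card (componentOf_mono (isolate_le G T) i))
    have h3 := abs_sub_le (bettiRemainder G Finset.univ m)
      (bettiRemainder (isolate G T) Finset.univ m)
      (bettiRemainder (isolate (isolate G T) {i}) Finset.univ m)
    linarith

lemma bettiRemainder_eq_zero_of_edgeless {G : SimpleGraph V} (h : ∀ u v, ¬ G.Adj u v)
    (W : Finset V) {m : ℕ} (hm : 2 ≤ m) : bettiRemainder G W m = 0 := by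
  induction W using Finset.induction_on with
  | empty =>
    have := abs_bettiRemainder_le G ∅ m
    simpa [componentWeight] using this
  | insert i W hi ih =>
    rw [Finset.insert_eq, bettiRemainder_union (fun u _ v _ => h u v) (by simpa using hi) hm, ih,
      add_zero]
    have := abs_bettiRemainder_le G {i} m
    rw [componentWeight, if_neg (by simp; omega)] at this
    exact abs_eq_zero.1 (le_antisymm this (abs_nonneg _))

/-- The Betti number differs from the number of cross-polytopes only by contributions of components
with more than `2 m` vertices. -/
theorem abs_bettiRemainder_le_sum (G : SimpleGraph V) {m : ℕ} (hm : 2 ≤ m) :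
    |bettiRemainder G Finset.univ m| ≤
      ∑ i : V, 2 * componentWeight m (componentOf G i).card := by
  have h := abs_bettiRemainder_sub_isolate_finset_le G Finset.univ hm
  rwa [bettiRemainder_eq_zero_of_edgeless (G := isolate G Finset.univ)
    (fun u v h => h.2.1 (Finset.mem_univ u)) _ hm, sub_zero] at h

end Remainder

/-! ### The Stein equation of the Poisson distribution. -/

section SteinEquation

/-- The solution of the Stein equation `l * f (n + 1) - n * f n = g n - e` for the weights `p` of
the Poisson distribution with mean `l`. -/
def steinSolution (p : ℕ → ℝ) (l : ℝ) (g : ℕ → ℝ) (e : ℝ) : ℕ → ℝ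
  | 0 => 0
  | n + 1 => (∑ j ∈ Finset.range (n + 1), p j * (g j - e)) / (l * p n)

variable {p : ℕ → ℝ} {l : ℝ}

lemma steinSolution_eq (hl : 0 < l) (hp : ∀ n, 0 < p n)
    (hrec : ∀ n : ℕ, (n + 1 : ℝ) * p (n + 1) = l * p n) (g : ℕ → ℝ) (e : ℝ) (n : ℕ) :
    l * steinSolution p l g e (n + 1) - n * steinSolution p l g e n = g n - e := by
  have hpn := (hp n).ne'
  cases n with
  | zero => simp [steinSolution]; field_simp
  | succ n =>
    have hpn' := (hp n).ne'
    simp only [steinSolution]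
    rw [Finset.sum_range_succ _ (n + 1), ← hrec n]
    push_cast
    have : (n + 1 : ℝ) ≠ 0 := by positivity
    field_simp
    ring

/-- Up to a positive factor the difference is linear in the values of `g`. The ratios `p (j + 1) / p
j = l / (j + 1)` decrease, so by `hF` and `hT` the coefficients of all values other than `g (n + 1)`
are nonpositive. The extreme case is therefore the indicator of `n + 1`, and `hF` evaluates its
bound to `(1 - p 0) / l`. -/
lemma steinSolution_diff_le (hl : 0 < l) (hp : ∀ n, 0 < p n)
    (hrec : ∀ n : ℕ, (n + 1 : ℝ) * p (n + 1) = l * p n) (hsum : HasSum p 1) {g : ℕ → ℝ}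
    (hg0 : ∀ n, 0 ≤ g n) (hg1 : ∀ n, g n ≤ 1) {e : ℝ} (he : HasSum (fun n => p n * g n) e)
    (n : ℕ) :
    steinSolution p l g e (n + 2) - steinSolution p l g e (n + 1) ≤ (1 - p 0) / l := by
  set F : ℕ → ℝ := fun n => ∑ j ∈ Finset.range (n + 1), p j with hFdef
  set A : ℕ → ℝ := fun n => ∑ j ∈ Finset.range (n + 1), p j * g j with hAdef
  have hS : ∀ n, ∑ j ∈ Finset.range (n + 1), p j * (g j - e) = A n - F n * e := fun n => by
    simp only [hFdef, hAdef, mul_sub, Finset.sum_sub_distrib, Finset.sum_mul]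
  have hA : 0 ≤ A n := Finset.sum_nonneg fun j _ => mul_nonneg (hp j).le (hg0 j)
  have hB : A (n + 1) ≤ e := by
    exact sum_le_hasSum _ (fun j _ => mul_nonneg (hp j).le (hg0 j)) he
  have hT0 : F (n + 1) ≤ 1 := sum_le_hasSum _ (fun j _ => (hp j).le) hsum
  have hF0 : 0 ≤ F n := Finset.sum_nonneg fun j _ => (hp j).le
  have hF : F n * p (n + 1) ≤ p n * (F (n + 1) - p 0) := by
    have h1 : F (n + 1) - p 0 = ∑ j ∈ Finset.range (n + 1), p (j + 1) := by
      simp only [hFdef, Finset.sum_range_succ' p (n + 1), add_sub_cancel_right]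
    rw [h1, Finset.mul_sum, Finset.sum_mul]
    refine Finset.sum_le_sum fun j hj => ?_
    have hjn : (j : ℝ) ≤ n := by
      have := Finset.mem_range.1 hj
      exact_mod_cast Nat.lt_succ_iff.1 this
    have e1 : p (n + 1) = l * p n / (n + 1) := by
      rw [eq_div_iff (by positivity), mul_comm]; exact hrec n
    have e2 : p (j + 1) = l * p j / (j + 1) := by
      rw [eq_div_iff (by positivity), mul_comm]; exact hrec j
    rw [e1, e2]
    have hq : 0 ≤ p n * (l * p j) := (mul_pos (hp n) (mul_pos hl (hp j))).le
    calc p j * (l * p n / (n + 1)) = p n * (l * p j) / (n + 1) := by ring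
      _ ≤ p n * (l * p j) / (j + 1) := by gcongr
      _ = p n * (l * p j / (j + 1)) := by ring
  have htail : ∀ n, HasSum (fun j => p (j + (n + 1))) (1 - F n) := fun n =>
    (hasSum_nat_add_iff' (n + 1)).2 hsum
  have hT : p n * (1 - F (n + 1)) ≤ p (n + 1) * (1 - F n) := by
    refine hasSum_le (fun j => ?_) ((htail (n + 1)).mul_left (p n))
      ((htail n).mul_left (p (n + 1)))
    have e1 : p (n + 1) = l * p n / (n + 1) := by
      rw [eq_div_iff (by positivity), mul_comm]; exact hrec n
    have e2 : p (j + (n + 1) + 1) = l * p (j + (n + 1)) / ((j + (n + 1) : ℕ) + 1) := by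
      rw [eq_div_iff (by positivity), mul_comm]; exact hrec _
    have e3 : j + (n + 1 + 1) = j + (n + 1) + 1 := by ring
    rw [e3, e1, e2]
    have hq : 0 ≤ p n * (l * p (j + (n + 1))) := (mul_pos (hp n) (mul_pos hl (hp _))).le
    calc p n * (l * p (j + (n + 1)) / ((j + (n + 1) : ℕ) + 1))
        = p n * (l * p (j + (n + 1))) / ((j + (n + 1) : ℕ) + 1) := by ring
      _ ≤ p n * (l * p (j + (n + 1))) / (n + 1) := by
          gcongr
          have : (0 : ℝ) ≤ j := Nat.cast_nonneg j
          linarith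
      _ = l * p n / (n + 1) * p (j + (n + 1)) := by ring
  have hp0 := hp n
  have hp1 := hp (n + 1)
  have hpz := hp 0
  have hAs : A (n + 1) = A n + p (n + 1) * g (n + 1) := Finset.sum_range_succ _ _
  have hFs : F (n + 1) = F n + p (n + 1) := Finset.sum_range_succ _ _
  simp only [steinSolution]
  rw [hS, hS, div_sub_div _ _ (by positivity) (by positivity), div_le_div_iff₀ (by positivity) hl]
  have key : (A (n + 1) - F (n + 1) * e) * p n - (A n - F n * e) * p (n + 1)
      ≤ (1 - p 0) * (p n * p (n + 1)) := by
    have t1 : A n * (p n * (1 - F (n + 1)) - p (n + 1) * (1 - F n)) ≤ 0 :=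
      mul_nonpos_of_nonneg_of_nonpos hA (by linarith)
    have t2 : (e - A (n + 1)) * (F n * p (n + 1) - p n * F (n + 1)) ≤ 0 := by
      refine mul_nonpos_of_nonneg_of_nonpos (by linarith) ?_
      have : p n * (F (n + 1) - p 0) = p n * F (n + 1) - p n * p 0 := by ring
      nlinarith [mul_pos hp0 hpz]
    have t3 : g (n + 1) * (p (n + 1) * (p n * (1 - F (n + 1)) + F n * p (n + 1))) ≤
        p (n + 1) * (p n * (1 - F (n + 1)) + p n * (F (n + 1) - p 0)) := by
      have hpos : 0 ≤ p n * (1 - F (n + 1)) + F n * p (n + 1) :=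
        add_nonneg (mul_nonneg hp0.le (by linarith)) (mul_nonneg hF0 hp1.le)
      calc _ ≤ 1 * (p (n + 1) * (p n * (1 - F (n + 1)) + F n * p (n + 1))) :=
            mul_le_mul_of_nonneg_right (hg1 _) (mul_nonneg hp1.le hpos)
        _ ≤ _ := by rw [one_mul]; exact mul_le_mul_of_nonneg_left (by linarith) hp1.le
    have e1 : (A (n + 1) - F (n + 1) * e) * p n - (A n - F n * e) * p (n + 1) =
        A n * (p n * (1 - F (n + 1)) - p (n + 1) * (1 - F n)) +
        (e - A (n + 1)) * (F n * p (n + 1) - p n * F (n + 1)) +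
        g (n + 1) * (p (n + 1) * (p n * (1 - F (n + 1)) + F n * p (n + 1))) := by
      rw [hAs]; ring
    rw [e1]
    linarith
  calc _ = ((A (n + 1) - F (n + 1) * e) * p n - (A n - F n * e) * p (n + 1)) * (l * l) := by ring
    _ ≤ (1 - p 0) * (p n * p (n + 1)) * (l * l) := by gcongr
    _ = _ := by ring

/-- The solution is linear in `g` and does not see constants, so the one-sided bound for `(1 + g) /
2` and `(1 - g) / 2` bounds half of its increment from both sides; this is the factor 2. The value
at 0 is immaterial, as the equation multiplies it by 0 and the increments start at 1. Both terms of
the minimum come from `1 - exp (-r) ≤ min r 1`. -/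
theorem exists_stein_solution {r : ℝ≥0} (hr : 0 < r) {g : ℕ → ℝ} (hg : ∀ n, |g n| ≤ 1) :
    ∃ f : ℕ → ℝ, (∀ n : ℕ, (r : ℝ) * f (n + 1) - n * f n = g n - ∫ n, g n ∂(poissonMeasure r)) ∧
      ∀ n, |f (n + 2) - f (n + 1)| ≤ 2 * min 1 (1 / (r : ℝ)) := by
  have hr' : (0 : ℝ) < r := hr
  set p : ℕ → ℝ := fun n => Real.exp (-r) * r ^ n / (n.factorial : ℝ) with hpdef
  have hp : ∀ n, 0 < p n := fun n => by simp only [hpdef]; positivity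
  have hrec : ∀ n : ℕ, (n + 1 : ℝ) * p (n + 1) = r * p n := fun n => by
    simp only [hpdef, Nat.factorial_succ]
    push_cast
    field_simp
    ring
  have hsum : HasSum p 1 := hasSum_one_poissonMeasure r
  set e := ∫ n, g n ∂(poissonMeasure r) with hedef
  have he : HasSum (fun n => p n * g n) e := by
    refine hasSum_integral_poissonMeasure ?_
    refine Integrable.of_bound .of_discrete 1 (Eventually.of_forall fun n => ?_)
    exact hg n
  have hbound : (1 - p 0) / (r : ℝ) ≤ min 1 (1 / (r : ℝ)) := by
    have h0 : p 0 = Real.exp (-r) := by simp [hpdef]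
    have h1 := Real.add_one_le_exp (-(r : ℝ))
    refine le_min ?_ ?_
    · rw [div_le_one hr', h0]; linarith
    · gcongr
      linarith [hp 0]
  -- the test functions `(1 + g) / 2` and `(1 - g) / 2` take values in `[0, 1]`
  have hs1 : HasSum (fun n => p n * ((1 + g n) / 2)) ((1 + e) / 2) := by
    convert! ((hsum.add he).div_const 2) using 1
    ext n; ring
  have hs2 : HasSum (fun n => p n * ((1 - g n) / 2)) ((1 - e) / 2) := by
    convert! ((hsum.sub he).div_const 2) using 1
    ext n; ring
  have u1 := steinSolution_diff_le hr' hp hrec hsum (g := fun n => (1 + g n) / 2)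
    (fun n => by linarith [(abs_le.1 (hg n)).1]) (fun n => by linarith [(abs_le.1 (hg n)).2]) hs1
  have u2 := steinSolution_diff_le hr' hp hrec hsum (g := fun n => (1 - g n) / 2)
    (fun n => by linarith [(abs_le.1 (hg n)).2]) (fun n => by linarith [(abs_le.1 (hg n)).1]) hs2
  have c1 : ∀ n, steinSolution p r (fun n => (1 + g n) / 2) ((1 + e) / 2) (n + 1) =
      steinSolution p r g e (n + 1) / 2 := fun n => by
    simp only [steinSolution]
    rw [show ∑ j ∈ Finset.range (n + 1), p j * ((1 + g j) / 2 - (1 + e) / 2) =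
      (∑ j ∈ Finset.range (n + 1), p j * (g j - e)) / 2 by
        rw [Finset.sum_div]; exact Finset.sum_congr rfl fun j _ => by ring]
    ring
  have c2 : ∀ n, steinSolution p r (fun n => (1 - g n) / 2) ((1 - e) / 2) (n + 1) =
      - (steinSolution p r g e (n + 1) / 2) := fun n => by
    simp only [steinSolution]
    rw [show ∑ j ∈ Finset.range (n + 1), p j * ((1 - g j) / 2 - (1 - e) / 2) =
      - ((∑ j ∈ Finset.range (n + 1), p j * (g j - e)) / 2) by
        rw [Finset.sum_div, ← Finset.sum_neg_distrib]
        exact Finset.sum_congr rfl fun j _ => by ring]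
    ring
  refine ⟨steinSolution p r g e, steinSolution_eq hr' hp hrec g e, fun n => ?_⟩
  have v1 := u1 n
  have v2 := u2 n
  rw [c1 n, c1 (n + 1)] at v1
  rw [c2 n, c2 (n + 1)] at v2
  rw [abs_le]
  constructor <;> linarith

/-- The Poisson distribution is Lipschitz in its mean, in total variation. -/
lemma abs_integral_poisson_sub_le (a b : ℝ≥0) {g : ℕ → ℝ} (hg : ∀ n, |g n| ≤ 1) :
    |∫ n, g n ∂(poissonMeasure a) - ∫ n, g n ∂(poissonMeasure b)| ≤ 2 * |(a : ℝ) - b| := by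
  wlog hab : a ≤ b generalizing a b
  · rw [abs_sub_comm, abs_sub_comm (a : ℝ)]
    exact this b a (le_of_not_ge hab)
  have hab' : (a : ℝ) ≤ b := hab
  have hs : ∀ r : ℝ≥0, HasSum (fun n : ℕ => Real.exp (-r) * r ^ n / (n.factorial : ℝ) * g n)
      (∫ n, g n ∂(poissonMeasure r)) := fun r =>
    hasSum_integral_poissonMeasure
      (Integrable.of_bound .of_discrete 1 (Eventually.of_forall fun n => hg n))
  -- For `a ≤ b` the weights of mean `a`, scaled by `t`, lie below those of mean `b`. The difference
  -- is a positive measure of mass `1 - t ≤ b - a`.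
  set t := Real.exp ((a : ℝ) - b) with ht
  have ht1 : t ≤ 1 := Real.exp_le_one_iff.2 (by linarith)
  have ht2 : (a : ℝ) - b + 1 ≤ t := Real.add_one_le_exp _
  have hdiff := (hs b).sub ((hs a).mul_left t)
  have hone := (hasSum_one_poissonMeasure b).sub ((hasSum_one_poissonMeasure a).mul_left t)
  have hw : ∀ n : ℕ, 0 ≤ Real.exp (-b) * b ^ n / (n.factorial : ℝ) -
      t * (Real.exp (-a) * a ^ n / (n.factorial : ℝ)) := fun n => by
    have : t * Real.exp (-a) = Real.exp (-b) := by
      rw [ht, ← Real.exp_add]; congr 1; ring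
    have h2 : t * (Real.exp (-a) * a ^ n / (n.factorial : ℝ)) =
        Real.exp (-b) * a ^ n / (n.factorial : ℝ) := by rw [← this]; ring
    rw [h2, sub_nonneg]
    gcongr
  have hub : ∫ n, g n ∂(poissonMeasure b) - t * ∫ n, g n ∂(poissonMeasure a) ≤ 1 - t * 1 := by
    refine hasSum_le (fun n => ?_) hdiff hone
    nlinarith [hw n, (abs_le.1 (hg n)).2]
  have hlb : -(1 - t * 1) ≤ ∫ n, g n ∂(poissonMeasure b) - t * ∫ n, g n ∂(poissonMeasure a) := by
    refine hasSum_le (fun n => ?_) hone.neg hdiff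
    nlinarith [hw n, (abs_le.1 (hg n)).1]
  have ha : |∫ n, g n ∂(poissonMeasure a)| ≤ 1 := by
    have := norm_integral_le_of_norm_le_const (μ := poissonMeasure a) (f := g) (C := 1)
      (Eventually.of_forall hg)
    simpa using this
  obtain ⟨h1, h2⟩ := abs_le.1 ha
  rw [abs_of_nonpos (by linarith : (a : ℝ) - b ≤ 0), abs_le]
  constructor <;> nlinarith

end SteinEquation

/-! ### Sums of locally dependent indicators: Poisson approximation and variance. -/

section ChenStein

variable {Ω : Type*} [MeasurableSpace Ω] {P : Measure Ω} [IsProbabilityMeasure P]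
  {ι : Type*} [DecidableEq ι]

lemma integrable_comp_of_le {U : Ω → ℕ} (hU : Measurable U) {N : ℕ} (hN : ∀ ω, U ω ≤ N)
    (f : ℕ → ℝ) : Integrable (fun ω => f (U ω)) P := by
  refine Integrable.of_bound ((measurable_from_nat (f := f)).comp hU).aestronglyMeasurable
    (∑ n ∈ Finset.range (N + 1), |f n|) (Eventually.of_forall fun ω => ?_)
  rw [Real.norm_eq_abs]
  exact Finset.single_le_sum (f := fun n => |f n|) (fun n _ => abs_nonneg _)
    (Finset.mem_range.2 (Nat.lt_succ_of_le (hN ω)))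

lemma abs_sub_le_of_step {f : ℕ → ℝ} {K : ℝ} (hf : ∀ n, |f (n + 2) - f (n + 1)| ≤ K) (b c : ℕ) :
    |f (b + c + 1) - f (b + 1)| ≤ K * c := by
  induction c with
  | zero => simp
  | succ c ih =>
    have h := hf (b + c)
    have h2 := abs_sub_le (f (b + (c + 1) + 1)) (f (b + c + 1)) (f (b + 1))
    have e : b + (c + 1) + 1 = b + c + 2 := by ring
    rw [e] at h2 ⊢
    push_cast
    linarith

/-- The error term of the Chen–Stein bound for a family of indicators `ξ i`, `i ∈ s`, with
dependency neighbourhoods given by `nb`. -/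
def dependencyError (P : Measure Ω) (s : Finset ι) (ξ : ι → Ω → ℕ) (nb : ι → ι → Prop)
    [DecidableRel nb] : ℝ :=
  ∑ i ∈ s, (∑ j ∈ s.filter (nb i), (∫ ω, (ξ i ω : ℝ) ∂P) * ∫ ω, (ξ j ω : ℝ) ∂P) +
  ∑ i ∈ s, (∑ j ∈ (s.filter (nb i)).erase i, ∫ ω, (ξ i ω : ℝ) * ξ j ω ∂P)

variable {s : Finset ι} {ξ : ι → Ω → ℕ} {nb : ι → ι → Prop} [DecidableRel nb]

lemma integrable_indicator (hmeas : ∀ i, Measurable (ξ i)) (h01 : ∀ i ω, ξ i ω ≤ 1) (i : ι) :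
    Integrable (fun ω => (ξ i ω : ℝ)) P :=
  integrable_comp_of_le (hmeas i) (h01 i) (fun n => (n : ℝ))

lemma integrable_indicator_mul (hmeas : ∀ i, Measurable (ξ i)) (h01 : ∀ i ω, ξ i ω ≤ 1)
    {U : Ω → ℕ} (hU : Measurable U) {N : ℕ} (hN : ∀ ω, U ω ≤ N) (f : ℕ → ℝ) (i : ι) :
    Integrable (fun ω => (ξ i ω : ℝ) * f (U ω)) P := by
  refine (integrable_comp_of_le hU hN f).bdd_mul (c := 1)
    (integrable_indicator hmeas h01 i).aestronglyMeasurable (Eventually.of_forall fun ω => ?_)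
  rw [Real.norm_eq_abs, abs_of_nonneg (Nat.cast_nonneg _)]
  exact_mod_cast h01 i ω

lemma measurable_sum_indicator (hmeas : ∀ i, Measurable (ξ i)) (t : Finset ι) :
    Measurable fun ω => ∑ j ∈ t, ξ j ω := Finset.measurable_sum t fun j _ => hmeas j

lemma sum_indicator_le (h01 : ∀ i ω, ξ i ω ≤ 1) (t : Finset ι) (ω : Ω) :
    ∑ j ∈ t, ξ j ω ≤ t.card := by
  simpa using Finset.sum_le_card_nsmul t (fun j => ξ j ω) 1 fun j _ => h01 j ω

/-- The Chen–Stein bound for Poisson approximation under local dependence. -/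
theorem abs_integral_sub_poisson_le (hmeas : ∀ i, Measurable (ξ i)) (h01 : ∀ i ω, ξ i ω ≤ 1)
    (hrefl : ∀ i ∈ s, nb i i)
    (hindep : ∀ i ∈ s, IndepFun (ξ i) (fun ω => ∑ j ∈ s.filter (fun j => ¬ nb i j), ξ j ω) P)
    {r : ℝ≥0} (hr : 0 < r) (hmean : (r : ℝ) = ∑ i ∈ s, ∫ ω, (ξ i ω : ℝ) ∂P)
    {g : ℕ → ℝ} (hg : ∀ n, |g n| ≤ 1) :
    |∫ ω, g (∑ i ∈ s, ξ i ω) ∂P - ∫ n, g n ∂(poissonMeasure r)| ≤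
      2 * min 1 (1 / (r : ℝ)) * dependencyError P s ξ nb := by
  obtain ⟨f, hf, hfd⟩ := exists_stein_solution hr hg
  set K := 2 * min 1 (1 / (r : ℝ))
  set W : Ω → ℕ := fun ω => ∑ i ∈ s, ξ i ω with hW
  have hWm : Measurable W := measurable_sum_indicator hmeas s
  have hWle : ∀ ω, W ω ≤ s.card := sum_indicator_le h01 s
  have hstep : ∀ i ∈ s, |(∫ ω, (ξ i ω : ℝ) ∂P) * (∫ ω, f (W ω + 1) ∂P) -
      ∫ ω, (ξ i ω : ℝ) * f (W ω) ∂P| ≤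
      K * (∑ j ∈ s.filter (nb i), (∫ ω, (ξ i ω : ℝ) ∂P) * ∫ ω, (ξ j ω : ℝ) ∂P) +
      K * (∑ j ∈ (s.filter (nb i)).erase i, ∫ ω, (ξ i ω : ℝ) * ξ j ω ∂P) := by
    intro i hi
    set U : Ω → ℕ := fun ω => ∑ j ∈ s.filter (fun j => ¬ nb i j), ξ j ω with hUdef
    have hUm : Measurable U := measurable_sum_indicator hmeas _
    have hUle : ∀ ω, U ω ≤ _ := sum_indicator_le h01 (s.filter fun j => ¬ nb i j)
    have hsplit : ∀ ω, W ω = U ω + ∑ j ∈ s.filter (nb i), ξ j ω := fun ω => by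
      simp only [hW, hUdef]
      rw [add_comm, Finset.sum_filter_add_sum_filter_not]
    have hmem : i ∈ s.filter (nb i) := Finset.mem_filter.2 ⟨hi, hrefl i hi⟩
    have hp0 : 0 ≤ ∫ ω, (ξ i ω : ℝ) ∂P := integral_nonneg fun ω => Nat.cast_nonneg _
    have hind : ∫ ω, (ξ i ω : ℝ) * f (U ω + 1) ∂P =
        (∫ ω, (ξ i ω : ℝ) ∂P) * ∫ ω, f (U ω + 1) ∂P := by
      have h := (hindep i hi).comp (_mγ := Real.measurableSpace) (_mγ' := Real.measurableSpace)
        (φ := fun n : ℕ => (n : ℝ)) (ψ := fun n => f (n + 1))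
        measurable_from_nat measurable_from_nat
      exact h.integral_fun_mul_eq_mul_integral
        (integrable_indicator hmeas h01 i).aestronglyMeasurable
        (integrable_comp_of_le hUm hUle fun n => f (n + 1)).aestronglyMeasurable
    -- `f (U + 1)` is inserted between the two terms. Since `U` sums only indicators outside the
    -- neighbourhood of `i`, independence makes the inserted terms cancel.
    have e1 : (∫ ω, (ξ i ω : ℝ) ∂P) * (∫ ω, f (W ω + 1) ∂P) - ∫ ω, (ξ i ω : ℝ) * f (W ω) ∂P =
        (∫ ω, (ξ i ω : ℝ) ∂P) * (∫ ω, (f (W ω + 1) - f (U ω + 1)) ∂P) +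
        ∫ ω, ((ξ i ω : ℝ) * f (U ω + 1) - (ξ i ω : ℝ) * f (W ω)) ∂P := by
      rw [integral_sub (integrable_comp_of_le hWm hWle fun n => f (n + 1))
        (integrable_comp_of_le hUm hUle fun n => f (n + 1)),
        integral_sub (integrable_indicator_mul hmeas h01 hUm hUle (fun n => f (n + 1)) i)
        (integrable_indicator_mul hmeas h01 hWm hWle f i), hind]
      ring
    rw [e1]
    refine (abs_add_le _ _).trans (add_le_add ?_ ?_)
    · rw [abs_mul, abs_of_nonneg hp0, ← Finset.mul_sum, ← mul_assoc, mul_comm K, mul_assoc,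
        ← integral_finsetSum _ fun j _ => integrable_indicator hmeas h01 j, ← integral_const_mul]
      refine mul_le_mul_of_nonneg_left ?_ hp0
      refine (abs_integral_le_integral_abs).trans (integral_mono ?_ ?_ fun ω => ?_)
      · exact ((integrable_comp_of_le hWm hWle fun n => f (n + 1)).sub
          (integrable_comp_of_le hUm hUle fun n => f (n + 1))).abs
      · exact (integrable_finsetSum _ fun j _ => integrable_indicator hmeas h01 j).const_mul K
      · have := abs_sub_le_of_step hfd (U ω) (∑ j ∈ s.filter (nb i), ξ j ω)
        rw [← hsplit] at this
        push_cast at this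
        exact this
    · have hint2 : ∀ j, Integrable (fun ω => (ξ i ω : ℝ) * ξ j ω) P := fun j =>
        integrable_indicator_mul hmeas h01 (hmeas j) (h01 j) (fun n => (n : ℝ)) i
      rw [← integral_finsetSum _ fun j _ => hint2 j, ← integral_const_mul]
      refine (abs_integral_le_integral_abs).trans (integral_mono ?_ ?_ fun ω => ?_)
      · exact ((integrable_indicator_mul hmeas h01 hUm hUle (fun n => f (n + 1)) i).sub
          (integrable_indicator_mul hmeas h01 hWm hWle f i)).abs
      · exact (integrable_finsetSum _ fun j _ => hint2 j).const_mul K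
      · dsimp only
        rw [← Finset.mul_sum]
        rcases Nat.le_one_iff_eq_zero_or_eq_one.1 (h01 i ω) with h | h
        · simp [h]
        · have hW' : W ω = U ω + (∑ j ∈ (s.filter (nb i)).erase i, ξ j ω) + 1 := by
            rw [hsplit, ← Finset.add_sum_erase _ _ hmem, h]; ring
          have := abs_sub_le_of_step hfd (U ω) (∑ j ∈ (s.filter (nb i)).erase i, ξ j ω)
          rw [← hW', abs_sub_comm] at this
          push_cast at this
          simpa [h] using this
  -- The Stein equation at `W`, with the mean and `W` both written as sums over `i`.
  have hmain : ∫ ω, g (W ω) ∂P - ∫ n, g n ∂(poissonMeasure r) =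
      ∑ i ∈ s, ((∫ ω, (ξ i ω : ℝ) ∂P) * (∫ ω, f (W ω + 1) ∂P) -
      ∫ ω, (ξ i ω : ℝ) * f (W ω) ∂P) := by
    rw [Finset.sum_sub_distrib, ← Finset.sum_mul, ← hmean, ← integral_const_mul,
      ← integral_finsetSum _ fun i _ => integrable_indicator_mul hmeas h01 hWm hWle f i,
      ← integral_sub ((integrable_comp_of_le hWm hWle fun n => f (n + 1)).const_mul _)
      (integrable_finsetSum _ fun i _ => integrable_indicator_mul hmeas h01 hWm hWle f i)]
    have : ∀ ω, (r : ℝ) * f (W ω + 1) - ∑ i ∈ s, (ξ i ω : ℝ) * f (W ω) =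
        g (W ω) - ∫ n, g n ∂(poissonMeasure r) := fun ω => by
      rw [← hf, ← Finset.sum_mul]
      simp [hW]
    simp_rw [this]
    rw [integral_sub (integrable_comp_of_le hWm hWle g) (integrable_const _)]
    simp
  rw [hmain, dependencyError, mul_add, Finset.mul_sum, Finset.mul_sum, ← Finset.sum_add_distrib]
  exact (Finset.abs_sum_le_sum_abs _ _).trans (Finset.sum_le_sum hstep)

/-- Under local dependence the variance of a sum of indicators is close to its mean. -/
theorem abs_variance_sub_mean_le (hmeas : ∀ i, Measurable (ξ i)) (h01 : ∀ i ω, ξ i ω ≤ 1)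
    (hrefl : ∀ i ∈ s, nb i i)
    (hindep : ∀ i ∈ s, IndepFun (ξ i) (fun ω => ∑ j ∈ s.filter (fun j => ¬ nb i j), ξ j ω) P) :
    |variance (fun ω => ((∑ i ∈ s, ξ i ω : ℕ) : ℝ)) P - ∑ i ∈ s, ∫ ω, (ξ i ω : ℝ) ∂P| ≤
      dependencyError P s ξ nb := by
  set W : Ω → ℕ := fun ω => ∑ i ∈ s, ξ i ω with hW
  have hWm : Measurable W := measurable_sum_indicator hmeas s
  have hWle : ∀ ω, W ω ≤ s.card := sum_indicator_le h01 s
  set p : ι → ℝ := fun i => ∫ ω, (ξ i ω : ℝ) ∂P with hp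
  have hint2 : ∀ i j, Integrable (fun ω => (ξ i ω : ℝ) * ξ j ω) P := fun i j =>
    integrable_indicator_mul hmeas h01 (hmeas j) (h01 j) (fun n => (n : ℝ)) i
  have hEW : ∫ ω, (W ω : ℝ) ∂P = ∑ i ∈ s, p i := by
    simp only [hW, Nat.cast_sum]
    exact integral_finsetSum _ fun j _ => integrable_indicator hmeas h01 j
  have hstep : ∀ i ∈ s, ∫ ω, (ξ i ω : ℝ) * W ω ∂P = p i * (∑ j ∈ s, p j) + p i +
      ∑ j ∈ (s.filter (nb i)).erase i, (∫ ω, (ξ i ω : ℝ) * ξ j ω ∂P) -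
      ∑ j ∈ s.filter (nb i), p i * p j := by
    intro i hi
    have hmem : i ∈ s.filter (nb i) := Finset.mem_filter.2 ⟨hi, hrefl i hi⟩
    have hind : ∫ ω, (ξ i ω : ℝ) * (∑ j ∈ s.filter (fun j => ¬ nb i j), ξ j ω : ℕ) ∂P =
        p i * ∑ j ∈ s.filter (fun j => ¬ nb i j), p j := by
      have h := (hindep i hi).comp (_mγ := Real.measurableSpace) (_mγ' := Real.measurableSpace)
        (φ := fun n : ℕ => (n : ℝ)) (ψ := fun n : ℕ => (n : ℝ))
        measurable_from_nat measurable_from_nat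
      have := h.integral_fun_mul_eq_mul_integral
        (integrable_indicator hmeas h01 i).aestronglyMeasurable
        (integrable_comp_of_le (measurable_sum_indicator hmeas _) (sum_indicator_le h01 _)
          fun n => (n : ℝ)).aestronglyMeasurable
      simp only [Function.comp_apply] at this
      rw [this]
      congr 1
      simp only [Nat.cast_sum]
      exact integral_finsetSum _ fun j _ => integrable_indicator hmeas h01 j
    have hsq : ∫ ω, (ξ i ω : ℝ) * ξ i ω ∂P = p i := by
      refine integral_congr_ae (Eventually.of_forall fun ω => ?_)
      rcases Nat.le_one_iff_eq_zero_or_eq_one.1 (h01 i ω) with h | h <;> simp [h]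
    have hsplit : ∀ ω, (ξ i ω : ℝ) * W ω = (∑ j ∈ s.filter (nb i), (ξ i ω : ℝ) * ξ j ω) +
        (ξ i ω : ℝ) * (∑ j ∈ s.filter (fun j => ¬ nb i j), ξ j ω : ℕ) := fun ω => by
      simp only [hW]
      rw [← Finset.sum_filter_add_sum_filter_not s (nb i), ← Finset.mul_sum]
      push_cast
      ring
    simp_rw [hsplit]
    rw [integral_add (integrable_finsetSum _ fun j _ => hint2 i j)
      (integrable_indicator_mul hmeas h01 (measurable_sum_indicator hmeas _)
        (sum_indicator_le h01 _) (fun n => (n : ℝ)) i), hind,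
      integral_finsetSum _ fun j _ => hint2 i j, ← Finset.add_sum_erase _ _ hmem, hsq,
      ← Finset.sum_filter_add_sum_filter_not s (nb i) p, ← Finset.mul_sum]
    ring
  have hL2 : MemLp (fun ω => (W ω : ℝ)) 2 P := by
    refine MemLp.of_bound (measurable_from_nat.comp hWm).aestronglyMeasurable s.card
      (Eventually.of_forall fun ω => ?_)
    rw [Real.norm_eq_abs, abs_of_nonneg (Nat.cast_nonneg _)]
    exact_mod_cast hWle ω
  have hEW2 : ∫ ω, (W ω : ℝ) ^ 2 ∂P = ∑ i ∈ s, ∫ ω, (ξ i ω : ℝ) * W ω ∂P := by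
    rw [← integral_finsetSum _ fun i _ =>
      integrable_indicator_mul hmeas h01 hWm hWle (fun n => (n : ℝ)) i]
    refine integral_congr_ae (Eventually.of_forall fun ω => ?_)
    dsimp only
    rw [← Finset.sum_mul, sq]
    simp [hW]
  -- Covariances outside the neighbourhoods vanish and the diagonal gives the mean. What is left is
  -- the difference of two nonnegative sums whose total is the dependency error.
  have hvar : variance (fun ω => (W ω : ℝ)) P - ∑ i ∈ s, p i =
      ∑ i ∈ s, (∑ j ∈ (s.filter (nb i)).erase i, (∫ ω, (ξ i ω : ℝ) * ξ j ω ∂P)) -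
      ∑ i ∈ s, ∑ j ∈ s.filter (nb i), p i * p j := by
    rw [variance_eq_sub hL2]
    simp only [Pi.pow_apply]
    rw [hEW2, hEW, Finset.sum_congr rfl hstep, Finset.sum_sub_distrib, Finset.sum_add_distrib,
      Finset.sum_add_distrib, ← Finset.sum_mul]
    ring
  have h1 : 0 ≤ ∑ i ∈ s, (∑ j ∈ (s.filter (nb i)).erase i, (∫ ω, (ξ i ω : ℝ) * ξ j ω ∂P)) :=
    Finset.sum_nonneg fun i _ => Finset.sum_nonneg fun j _ => integral_nonneg fun ω => by
      dsimp only; positivity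
  have h2 : 0 ≤ ∑ i ∈ s, ∑ j ∈ s.filter (nb i), p i * p j :=
    Finset.sum_nonneg fun i _ => Finset.sum_nonneg fun j _ =>
      mul_nonneg (integral_nonneg fun ω => Nat.cast_nonneg _)
        (integral_nonneg fun ω => Nat.cast_nonneg _)
  rw [hvar, dependencyError, abs_le]
  constructor <;> linarith

end ChenStein

/-! ### The Efron–Stein inequality on product spaces. -/

section EfronStein

variable {E : Type*} [MeasurableSpace E] {μ : Measure E} [IsProbabilityMeasure μ]

lemma integrable_of_abs_le {α : Type*} [MeasurableSpace α] {ν : Measure α} [IsFiniteMeasure ν]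
    {F : α → ℝ} (hF : Measurable F) {B : ℝ} (hB : ∀ x, |F x| ≤ B) : Integrable F ν :=
  Integrable.of_bound hF.aestronglyMeasurable B (Eventually.of_forall hB)

lemma sq_integral_le {α : Type*} [MeasurableSpace α] {ν : Measure α} [IsProbabilityMeasure ν]
    {F : α → ℝ} (hF : Measurable F) {B : ℝ} (hB : ∀ x, |F x| ≤ B) :
    (∫ x, F x ∂ν) ^ 2 ≤ ∫ x, F x ^ 2 ∂ν := by
  have h := variance_nonneg F ν
  rw [variance_eq_sub (MemLp.of_bound hF.aestronglyMeasurable B (Eventually.of_forall hB))] at h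
  simpa using h

/-- Among all constants, the mean minimizes the mean squared deviation. -/
lemma integral_sq_sub_le {α : Type*} [MeasurableSpace α] {ν : Measure α} [IsProbabilityMeasure ν]
    {F : α → ℝ} (hF : Measurable F) {B : ℝ} (hB : ∀ x, |F x| ≤ B) (c : ℝ) :
    (∫ x, F x ^ 2 ∂ν) - (∫ x, F x ∂ν) ^ 2 ≤ ∫ x, (F x - c) ^ 2 ∂ν := by
  have hi : Integrable F ν := integrable_of_abs_le hF hB
  have hi2 : Integrable (fun x => F x ^ 2) ν :=
    integrable_of_abs_le (B := B ^ 2) (hF.pow_const 2) fun x => by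
      rw [abs_pow]; exact pow_le_pow_left₀ (abs_nonneg _) (hB x) 2
  have : ∫ x, (F x - c) ^ 2 ∂ν = (∫ x, F x ^ 2 ∂ν) - 2 * c * (∫ x, F x ∂ν) + c ^ 2 := by
    have e : ∀ x, (F x - c) ^ 2 = F x ^ 2 - 2 * c * F x + c ^ 2 := fun x => by ring
    simp_rw [e]
    rw [integral_add (f := fun x => F x ^ 2 - 2 * c * F x) (hi2.sub (hi.const_mul _))
      (integrable_const _), integral_sub hi2 (hi.const_mul _), integral_const_mul]
    simp
  rw [this]
  nlinarith [sq_nonneg ((∫ x, F x ∂ν) - c)]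

lemma piFinSuccAbove_symm_apply_zero {n : ℕ} (q : E × (Fin n → E)) :
    (MeasurableEquiv.piFinSuccAbove (fun _ : Fin (n + 1) => E) 0).symm q =
      (Fin.cons q.1 q.2 : Fin (n + 1) → E) :=
  Fin.insertNth_zero' _ _

lemma integral_pi_succ {n : ℕ} {F : (Fin (n + 1) → E) → ℝ} (hF : Measurable F) {B : ℝ}
    (hB : ∀ x, |F x| ≤ B) :
    ∫ x, F x ∂(Measure.pi fun _ => μ) =
      ∫ y, ∫ x, F (Fin.cons x y) ∂μ ∂(Measure.pi fun _ : Fin n => μ) := by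
  have hmp := (measurePreserving_piFinSuccAbove (fun _ : Fin (n + 1) => μ) 0).symm
  rw [← hmp.integral_comp' (g := F)]
  rw [integral_prod_symm]
  · simp_rw [piFinSuccAbove_symm_apply_zero]
  · exact integrable_of_abs_le (hF.comp (MeasurableEquiv.measurable _)) fun x => hB _

lemma measurable_cons {n : ℕ} :
    Measurable fun q : E × (Fin n → E) => (Fin.cons q.1 q.2 : Fin (n + 1) → E) := by
  simp_rw [← piFinSuccAbove_symm_apply_zero]
  exact MeasurableEquiv.measurable _

/-- The Efron–Stein inequality for bounded functions of independent variables: here `F' i` does not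
depend on the `i`-th variable. -/
theorem variance_pi_le_sum : ∀ (n : ℕ) {F : (Fin n → E) → ℝ} {F' : Fin n → (Fin n → E) → ℝ} {B : ℝ},
    Measurable F → (∀ x, |F x| ≤ B) → (∀ i, Measurable (F' i)) → (∀ i x, |F' i x| ≤ B) →
    (∀ i x y, (∀ j, j ≠ i → x j = y j) → F' i x = F' i y) →
    (∫ x, F x ^ 2 ∂(Measure.pi fun _ => μ)) - (∫ x, F x ∂(Measure.pi fun _ => μ)) ^ 2 ≤
      ∑ i, ∫ x, (F x - F' i x) ^ 2 ∂(Measure.pi fun _ => μ) := by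
  intro n
  induction n with
  | zero =>
    intro F F' B _ _ _ _ _
    have h : ∀ x, F x = F Fin.elim0 := fun x => congrArg F (Subsingleton.elim _ _)
    simp_rw [h]
    simp
  | succ n ih =>
    intro F F' B hF hB hF' hB' hdep
    have hB0 : 0 ≤ B := by
      obtain ⟨x⟩ : Nonempty E := nonempty_of_isProbabilityMeasure μ
      exact (abs_nonneg _).trans (hB fun _ => x)
    have hsq : ∀ {α : Type _} {G : α → ℝ}, (∀ x, |G x| ≤ B) → ∀ x, |G x ^ 2| ≤ B ^ 2 :=
      fun hG x => by rw [abs_pow]; exact pow_le_pow_left₀ (abs_nonneg _) (hG x) 2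
    have hsec : ∀ {G : (Fin (n + 1) → E) → ℝ}, Measurable G → ∀ y : Fin n → E,
        Measurable fun x => G (Fin.cons x y) := fun hG y =>
      hG.comp (measurable_cons.comp (measurable_id.prodMk measurable_const))
    have hintm : ∀ {G : (Fin (n + 1) → E) → ℝ}, Measurable G →
        Measurable fun y : Fin n → E => ∫ x, G (Fin.cons x y) ∂μ := fun {G} hG =>
      ((hG.comp measurable_cons).stronglyMeasurable.integral_prod_left').measurable
    have hintb : ∀ {G : (Fin (n + 1) → E) → ℝ} {b : ℝ}, (∀ x, |G x| ≤ b) →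
        ∀ y : Fin n → E, |∫ x, G (Fin.cons x y) ∂μ| ≤ b := fun {G} b hG y => by
      have := norm_integral_le_of_norm_le_const (μ := μ) (f := fun x => G (Fin.cons x y)) (C := b)
        (Eventually.of_forall fun x => hG _)
      simpa using this
    have hdiffm : ∀ i, Measurable fun x => (F x - F' i x) ^ 2 := fun i =>
      (hF.sub (hF' i)).pow_const 2
    have hdiffb1 : ∀ i x, |F x - F' i x| ≤ 2 * B := fun i x =>
      (abs_sub _ _).trans (by linarith [hB x, hB' i x])
    have hdiffb : ∀ i x, |(F x - F' i x) ^ 2| ≤ (2 * B) ^ 2 := fun i x => by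
      rw [abs_pow]; exact pow_le_pow_left₀ (abs_nonneg _) (hdiffb1 i x) 2
    -- The variance splits into that of `H`, the average over the first variable, and the mean
    -- conditional variance in the first variable. Induction handles the former.
    set H : (Fin n → E) → ℝ := fun y => ∫ x, F (Fin.cons x y) ∂μ with hH
    set H' : Fin n → (Fin n → E) → ℝ := fun i y => ∫ x, F' i.succ (Fin.cons x y) ∂μ with hH'
    have ihH := ih (F := H) (F' := H') (B := B) (hintm hF) (hintb hB)
      (fun i => hintm (hF' _)) (fun i => hintb (hB' _)) (fun i x y hxy => by
        simp only [hH']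
        refine integral_congr_ae (Eventually.of_forall fun t => hdep _ _ _ fun j hj => ?_)
        induction j using Fin.cases with
        | zero => rfl
        | succ j => simpa using hxy j fun h => hj (by rw [h]))
    -- Jensen's inequality: averaging over the first variable does not increase mean squares.
    have hH2 : ∀ i, ∫ y, (H y - H' i y) ^ 2 ∂(Measure.pi fun _ => μ) ≤
        ∫ x, (F x - F' i.succ x) ^ 2 ∂(Measure.pi fun _ => μ) := by
      intro i
      rw [integral_pi_succ (hdiffm _) (hdiffb _)]
      refine integral_mono ?_ ?_ fun y => ?_
      · refine integrable_of_abs_le (B := (2 * B) ^ 2)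
          (((hintm hF).sub (hintm (hF' _))).pow_const 2) fun y => ?_
        rw [abs_pow]
        refine pow_le_pow_left₀ (abs_nonneg _) ?_ 2
        exact (abs_sub _ _).trans (by
          linarith [hintb hB y, hintb (hB' i.succ) y])
      · exact integrable_of_abs_le (hintm (hdiffm _)) (hintb (hdiffb _))
      · dsimp only [hH, hH']
        rw [← integral_sub (integrable_of_abs_le (hsec hF y) fun x => hB _)
          (integrable_of_abs_le (hsec (hF' _) y) fun x => hB' _ _)]
        exact sq_integral_le ((hsec hF y).sub (hsec (hF' _) y)) fun x => hdiffb1 _ _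
    -- With the other variables fixed, `F' 0` is a constant, so the conditional variance is at most
    -- the mean squared deviation from it.
    have h0 : (∫ x, F x ^ 2 ∂(Measure.pi fun _ => μ)) - ∫ y, H y ^ 2 ∂(Measure.pi fun _ => μ) ≤
        ∫ x, (F x - F' 0 x) ^ 2 ∂(Measure.pi fun _ => μ) := by
      have hi1 := integrable_of_abs_le (ν := Measure.pi fun _ : Fin n => μ)
        (hintm (hF.pow_const 2)) (hintb (hsq hB))
      have hi2 := integrable_of_abs_le (ν := Measure.pi fun _ : Fin n => μ)
        ((hintm hF).pow_const 2) (hsq (hintb hB))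
      rw [integral_pi_succ (hF.pow_const 2) (hsq hB), integral_pi_succ (hdiffm _) (hdiffb _),
        ← integral_sub hi1 hi2]
      refine integral_mono (hi1.sub hi2)
        (integrable_of_abs_le (hintm (hdiffm _)) (hintb (hdiffb _))) fun y => ?_
      dsimp only [hH]
      obtain ⟨x₀⟩ : Nonempty E := nonempty_of_isProbabilityMeasure μ
      have hc : ∀ x, F' 0 (Fin.cons x y) = F' 0 (Fin.cons x₀ y) := fun x =>
        hdep _ _ _ fun j hj => by
          obtain ⟨j, rfl⟩ := Fin.exists_succ_eq.2 hj
          rfl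
      simp_rw [hc]
      exact integral_sq_sub_le (hsec hF y) (fun x => hB _) _
    have h1 : ∫ x, F x ∂(Measure.pi fun _ => μ) = ∫ y, H y ∂(Measure.pi fun _ => μ) :=
      integral_pi_succ hF hB
    rw [Fin.sum_univ_succ, h1]
    have := Finset.sum_le_sum fun i (_ : i ∈ Finset.univ) => hH2 i
    linarith

end EfronStein

/-! ### Independent points: events around one point, measurability, independence. -/

section ProductSpace

/-- The probability that all points `x j`, `j ∈ S`, are in given position to `x i`. -/
lemma pi_forall_mem_eq_lintegral {E : Type*} [MeasurableSpace E] {μ : Measure E}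
    [IsProbabilityMeasure μ] {n : ℕ} {i : Fin n} {S : Finset (Fin n)} (hi : i ∉ S)
    {R : Fin n → Set (E × E)} (hR : ∀ j, MeasurableSet (R j)) :
    (Measure.pi fun _ : Fin n => μ) {x | ∀ j ∈ S, (x i, x j) ∈ R j} =
      ∫⁻ a, ∏ j ∈ S, μ {b | (a, b) ∈ R j} ∂μ := by
  obtain ⟨n, rfl⟩ : ∃ n', n = n' + 1 := ⟨n - 1, by have := i.2; omega⟩
  have hA : MeasurableSet {x : Fin (n + 1) → E | ∀ j ∈ S, (x i, x j) ∈ R j} := by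
    have : {x : Fin (n + 1) → E | ∀ j ∈ S, (x i, x j) ∈ R j} =
        ⋂ j ∈ S, (fun x : Fin (n + 1) → E => (x i, x j)) ⁻¹' R j := by ext x; simp
    rw [this]
    exact Finset.measurableSet_biInter S fun j _ =>
      ((measurable_pi_apply i).prodMk (measurable_pi_apply j)) (hR j)
  have hmp := (measurePreserving_piFinSuccAbove (fun _ : Fin (n + 1) => μ) i).symm
  rw [← hmp.measure_preimage hA.nullMeasurableSet,
    Measure.prod_apply (hmp.measurable hA)]
  refine lintegral_congr fun a => ?_
  have hset : Prod.mk a ⁻¹' ((MeasurableEquiv.piFinSuccAbove (fun _ : Fin (n + 1) => E) i).symm ⁻¹'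
      {x | ∀ j ∈ S, (x i, x j) ∈ R j}) =
      Set.univ.pi fun t : Fin n => {b | i.succAbove t ∈ S → (a, b) ∈ R (i.succAbove t)} := by
    ext y
    simp only [Set.mem_preimage, Set.mem_ofPred_eq, Set.mem_pi, Set.mem_univ, true_imp_iff]
    have e : (MeasurableEquiv.piFinSuccAbove (fun _ : Fin (n + 1) => E) i).symm (a, y) =
        i.insertNth a y := rfl
    rw [e]
    constructor
    · intro h t ht
      simpa using h _ ht
    · intro h j hj
      obtain ⟨t, rfl⟩ := Fin.exists_succAbove_eq (x := j) (y := i) (fun h => hi (h ▸ hj))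
      simpa using h t hj
  -- Indices outside `S` are unconstrained and contribute the factor 1, so the product may run over
  -- all indices.
  set φ : Fin (n + 1) → ℝ≥0∞ := fun j => μ {b | j ∈ S → (a, b) ∈ R j} with hφ
  have hφ1 : ∀ j ∉ S, φ j = 1 := fun j hj => by simp [hφ, hj]
  rw [hset, Measure.pi_pi]
  calc ∏ t, φ (i.succAbove t) = ∏ j, φ j := by rw [Fin.prod_univ_succAbove _ i, hφ1 i hi, one_mul]
    _ = ∏ j ∈ S, φ j := (Finset.prod_subset (Finset.subset_univ S) fun j _ hj => hφ1 j hj).symm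
    _ = ∏ j ∈ S, μ {b | (a, b) ∈ R j} := Finset.prod_congr rfl fun j hj => by simp [hφ, hj]

variable {d : ℕ} {μ : Measure (EuclideanSpace ℝ (Fin d))} [IsProbabilityMeasure μ] {n : ℕ}

lemma measure_forall_dist_le {ρ q : ℝ} (hq0 : 0 ≤ q)
    (hq : ∀ a, μ (Metric.closedBall a ρ) ≤ ENNReal.ofReal q) {i : Fin n} {S : Finset (Fin n)}
    (hi : i ∉ S) :
    (Measure.pi fun _ : Fin n => μ).real {x | ∀ j ∈ S, dist (x j) (x i) ≤ ρ} ≤ q ^ S.card := by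
  refine ENNReal.toReal_le_of_le_ofReal (pow_nonneg hq0 _) ?_
  have h := pi_forall_mem_eq_lintegral (μ := μ) hi
    (R := fun _ => {p : EuclideanSpace ℝ (Fin d) × EuclideanSpace ℝ (Fin d) | dist p.2 p.1 ≤ ρ})
    fun _ => measurableSet_le (measurable_snd.dist measurable_fst) measurable_const
  refine h.le.trans ?_
  calc _ ≤ ∫⁻ _, ENNReal.ofReal (q ^ S.card) ∂μ := lintegral_mono fun a => by
        rw [ENNReal.ofReal_pow hq0, ← Finset.prod_const]
        exact Finset.prod_le_prod' fun j _ => hq a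
    _ = _ := by simp

/-- There are finitely many graphs, and each one is cut out by finitely many comparisons of
distances. Hence every function of the graph is measurable, however it is defined. -/
lemma measurable_comp_geometricGraph {β : Type*} [MeasurableSpace β] (r : ℝ)
    (ψ : SimpleGraph (Fin n) → β) :
    Measurable fun x : Fin n → EuclideanSpace ℝ (Fin d) => ψ (geometricGraph x r) := by
  let _ : MeasurableSpace (SimpleGraph (Fin n)) := ⊤
  have h : Measurable fun x : Fin n → EuclideanSpace ℝ (Fin d) => geometricGraph x r := by
    refine measurable_to_countable' fun G => ?_
    have : (fun x : Fin n → EuclideanSpace ℝ (Fin d) => geometricGraph x r) ⁻¹' {G} =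
        ⋂ i, ⋂ j, {x | (i ≠ j ∧ dist (x i) (x j) < 2 * r) ↔ G.Adj i j} := by
      ext x
      simp only [Set.mem_preimage, Set.mem_singleton_iff, Set.mem_iInter]
      exact ⟨fun h i j => by subst h; exact Iff.rfl, fun h => SimpleGraph.ext (by
        ext i j; exact h i j)⟩
    rw [this]
    refine MeasurableSet.iInter fun i => MeasurableSet.iInter fun j => ?_
    have hlt : MeasurableSet {x : Fin n → EuclideanSpace ℝ (Fin d) | dist (x i) (x j) < 2 * r} :=
      measurableSet_lt ((measurable_pi_apply i).dist (measurable_pi_apply j)) measurable_const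
    exact ((MeasurableSet.const _).inter hlt).iff (MeasurableSet.const _)
  exact (measurable_from_top (f := ψ)).comp h

/-- Functions of disjoint groups of coordinates are independent. -/
lemma indepFun_of_disjoint {E β γ : Type*} [MeasurableSpace E] [MeasurableSpace β]
    [MeasurableSpace γ] {ν : Measure E} [IsProbabilityMeasure ν]
    {S T : Finset (Fin n)} (hST : Disjoint S T) {F : (Fin n → E) → β} {G : (Fin n → E) → γ}
    (hF : Measurable F) (hG : Measurable G)
    (hFS : ∀ x y, (∀ i ∈ S, x i = y i) → F x = F y)
    (hGT : ∀ x y, (∀ i ∈ T, x i = y i) → G x = G y) :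
    IndepFun F G (Measure.pi fun _ : Fin n => ν) := by
  obtain ⟨x₀⟩ : Nonempty E := nonempty_of_isProbabilityMeasure ν
  have hind := (iIndepFun_pi (μ := fun _ : Fin n => ν) (X := fun _ => id)
    fun _ => aemeasurable_id).indepFun_finset S T hST fun i => measurable_pi_apply i
  -- Freezing the coordinates outside `U` at `x₀` factors `F` and `G` through their own groups of
  -- coordinates.
  let ext : (U : Finset (Fin n)) → (U → E) → Fin n → E := fun U y i =>
    if h : i ∈ U then y ⟨i, h⟩ else x₀
  have hext : ∀ U, Measurable (ext U) := fun U => measurable_pi_iff.2 fun i => by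
    by_cases h : i ∈ U
    · simp only [ext, h, dite_true]; exact measurable_pi_apply _
    · simp only [ext, h, dite_false]; exact measurable_const
  have h := hind.comp (hF.comp (hext S)) (hG.comp (hext T))
  convert h using 1
  · ext x
    exact hFS _ _ fun i hi => by simp [ext, hi]
  · ext x
    exact hGT _ _ fun i hi => by simp [ext, hi]

end ProductSpace

/-! ### Tail bounds for component sizes. -/

section LocalBounds

variable {d : ℕ} {n : ℕ}

lemma geometricGraph_adj {x : Fin n → EuclideanSpace ℝ (Fin d)} {r : ℝ} {i j : Fin n} :
    (geometricGraph x r).Adj i j ↔ i ≠ j ∧ dist (x i) (x j) < 2 * r := Iff.rfl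

/-- A component with at least `l` vertices contains `l` vertices near a given one. -/
lemma exists_subset_componentOf (x : Fin n → EuclideanSpace ℝ (Fin d)) {r : ℝ} (i : Fin n)
    {l : ℕ} (hl : l + 1 ≤ (componentOf (geometricGraph x r) i).card) :
    ∃ S ⊆ componentOf (geometricGraph x r) i, i ∈ S ∧ S.card = l + 1 ∧
      ∀ t ∈ S, dist (x t) (x i) ≤ 2 * r * l := by
  induction l with
  | zero =>
    refine ⟨{i}, ?_, by simp, by simp, by simp⟩
    rw [Finset.singleton_subset_iff, mem_componentOf]
  | succ l ih =>
    obtain ⟨S, hS, hiS, hc, hd⟩ := ih (by omega)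
    obtain ⟨u, hu, huS⟩ := Finset.exists_mem_notMem_of_card_lt_card
      (by omega : S.card < (componentOf (geometricGraph x r) i).card)
    obtain ⟨p⟩ := mem_componentOf.1 hu
    -- A walk from `i` to a vertex outside `S` leaves `S` along some edge. The far end of that edge
    -- joins `S` and is at most `2 * r` further from `x i`.
    obtain ⟨e, _, he1, he2⟩ := p.exists_boundary_dart (S : Set (Fin n)) hiS huS
    refine ⟨insert e.snd S, ?_, by simp [hiS], ?_, ?_⟩
    · refine Finset.insert_subset ?_ hS
      exact mem_componentOf.2 ((mem_componentOf.1 (hS he1)).trans e.adj.reachable)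
    · rw [Finset.card_insert_of_notMem he2, hc]
    · have hadj := (geometricGraph_adj.1 e.adj).2
      have hr : 0 < 2 * r := dist_nonneg.trans_lt hadj
      intro t ht
      push_cast
      rcases Finset.mem_insert.1 ht with rfl | ht
      · have h1 := dist_triangle (x e.snd) (x e.fst) (x i)
        have h2 := hd _ he1
        rw [dist_comm] at hadj
        linarith
      · have := hd t ht
        linarith

variable {μ : Measure (EuclideanSpace ℝ (Fin d))} [IsProbabilityMeasure μ]

/-- `μ` gives mass at most `A ρ ^ d` to every ball of radius `ρ`. -/
def HasBallBound (μ : Measure (EuclideanSpace ℝ (Fin d))) (A : ℝ) : Prop :=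
  0 ≤ A ∧ ∀ a ρ, 0 ≤ ρ → μ (Metric.closedBall a ρ) ≤ ENNReal.ofReal (A * ρ ^ d)

/-- The constant in the bound for the probability that a component has more than `j` vertices. -/
def tailConst (A : ℝ) (d j : ℕ) : ℝ := (A * (2 * j) ^ d) ^ j

lemma tailConst_nonneg {A : ℝ} (hA : 0 ≤ A) (d j : ℕ) : 0 ≤ tailConst A d j := by
  unfold tailConst; positivity

/-- Such a component has `j` further points within `2 * r * j` of the `i`-th one. The union bound
runs over at most `n ^ j` choices of these points. -/
lemma measure_componentOf_card_le {A : ℝ} (hA : HasBallBound μ A) {r : ℝ} (hr : 0 ≤ r)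
    (i : Fin n) (j : ℕ) :
    (Measure.pi fun _ : Fin n => μ).real
      {x | j + 1 ≤ (componentOf (geometricGraph x r) i).card} ≤
      tailConst A d j * (n * r ^ d) ^ j := by
  have hsub : {x : Fin n → EuclideanSpace ℝ (Fin d) |
      j + 1 ≤ (componentOf (geometricGraph x r) i).card} ⊆
      ⋃ S ∈ (Finset.univ.erase i).powersetCard j, {x | ∀ t ∈ S, dist (x t) (x i) ≤ 2 * r * j} := by
    intro x hx
    obtain ⟨S, _, hiS, hc, hd⟩ := exists_subset_componentOf x i hx
    refine Set.mem_biUnion (x := S.erase i) ?_ fun t ht => hd t (Finset.mem_of_mem_erase ht)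
    rw [Finset.mem_coe, Finset.mem_powersetCard]
    refine ⟨Finset.erase_subset_erase _ (Finset.subset_univ _), ?_⟩
    rw [Finset.card_erase_of_mem hiS, hc, Nat.add_sub_cancel]
  have hq0 : 0 ≤ A * (2 * r * j) ^ d := mul_nonneg hA.1 (by positivity)
  calc _ ≤ _ := measureReal_mono hsub (measure_ne_top _ _)
    _ ≤ ∑ S ∈ (Finset.univ.erase i).powersetCard j, (Measure.pi fun _ : Fin n => μ).real
        {x | ∀ t ∈ S, dist (x t) (x i) ≤ 2 * r * j} := measureReal_biUnion_finset_le _ _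
    _ ≤ ∑ S ∈ (Finset.univ.erase i).powersetCard j, (A * (2 * r * j) ^ d) ^ j := by
        refine Finset.sum_le_sum fun S hS => ?_
        obtain ⟨h1, h2⟩ := Finset.mem_powersetCard.1 hS
        have := measure_forall_dist_le (μ := μ) hq0 (fun a => hA.2 a _ (by positivity))
          (i := i) (S := S) (fun h => by simpa using h1 h)
        rwa [h2] at this
    _ ≤ (n : ℝ) ^ j * (A * (2 * r * j) ^ d) ^ j := by
        rw [Finset.sum_const, nsmul_eq_mul, Finset.card_powersetCard]
        refine mul_le_mul_of_nonneg_right ?_ (by positivity)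
        have h1 : (Finset.univ.erase i).card ≤ n := by
          simp
        exact_mod_cast (Nat.choose_le_pow _ j).trans (Nat.pow_le_pow_left h1 j)
    _ = tailConst A d j * (n * r ^ d) ^ j := by
        rw [tailConst, ← mul_pow, ← mul_pow]
        congr 1
        rw [mul_pow, mul_pow, mul_pow]
        ring

/-- Components with at most `J` vertices are sorted by size, and larger ones get the trivial bound
by `n`. That last term loses a power of `n`, which a large `J` compensates later. -/
lemma integral_componentWeight_pow_le {A : ℝ} (hA : HasBallBound μ A) {r : ℝ} (hr : 0 ≤ r)
    (i : Fin n) (m : ℕ) {p J : ℕ} (hp : p ≠ 0) :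
    ∫ x, componentWeight m (componentOf (geometricGraph x r) i).card ^ p
        ∂(Measure.pi fun _ : Fin n => μ) ≤
      ∑ j ∈ Finset.Ico (2 * m) J,
        ((j + 1 : ℝ) ^ (2 * m)) ^ p * (tailConst A d j * (n * r ^ d) ^ j) +
      ((n : ℝ) ^ (2 * m)) ^ p * (tailConst A d J * (n * r ^ d) ^ J) := by
  classical
  set ν := Measure.pi fun _ : Fin n => μ
  let C : (Fin n → EuclideanSpace ℝ (Fin d)) → ℕ := fun x =>
    (componentOf (geometricGraph x r) i).card
  have hCm : Measurable C := measurable_comp_geometricGraph r fun G => (componentOf G i).card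
  have hCn : ∀ x, C x ≤ n := fun x => by
    simpa using Finset.card_le_univ (componentOf (geometricGraph x r) i)
  have hms : ∀ j, MeasurableSet {x | j + 1 ≤ C x} := fun j => measurableSet_le measurable_const hCm
  have hind : ∀ j (c : ℝ), Integrable (fun x => c * Set.indicator {x | j + 1 ≤ C x} (fun _ => (1 : ℝ)) x) ν :=
    fun j c => ((integrable_const (1 : ℝ)).indicator (hms j)).const_mul c
  have hval : ∀ j (c : ℝ), ∫ x, c * Set.indicator {x | j + 1 ≤ C x} (fun _ => (1 : ℝ)) x ∂ν =
      c * ν.real {x | j + 1 ≤ C x} := fun j c => by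
    rw [integral_const_mul]
    congr 1
    exact integral_indicator_one (hms j)
  have hpt : ∀ x, componentWeight m (C x) ^ p ≤
      ∑ j ∈ Finset.Ico (2 * m) J,
        ((j + 1 : ℝ) ^ (2 * m)) ^ p * Set.indicator {x | j + 1 ≤ C x} (fun _ => (1 : ℝ)) x +
      ((n : ℝ) ^ (2 * m)) ^ p * Set.indicator {x | J + 1 ≤ C x} (fun _ => (1 : ℝ)) x := by
    intro x
    have hnn : ∀ j (c : ℝ), 0 ≤ c → 0 ≤ c * Set.indicator {x | j + 1 ≤ C x} (fun _ => (1 : ℝ)) x :=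
      fun j c hc => mul_nonneg hc (Set.indicator_nonneg (fun _ _ => zero_le_one) _)
    have hsnn : 0 ≤ ∑ j ∈ Finset.Ico (2 * m) J,
        ((j + 1 : ℝ) ^ (2 * m)) ^ p * Set.indicator {x | j + 1 ≤ C x} (fun _ => (1 : ℝ)) x :=
      Finset.sum_nonneg fun j _ => hnn j _ (by positivity)
    unfold componentWeight
    split_ifs with h
    · by_cases hJ : J + 1 ≤ C x
      · refine le_add_of_nonneg_of_le hsnn ?_
        rw [Set.indicator_of_mem (by exact hJ), mul_one]
        gcongr
        exact hCn x
      · refine le_add_of_le_of_nonneg ?_ (hnn J _ (by positivity))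
        refine le_trans ?_ (Finset.single_le_sum (fun j _ => hnn j _ (by positivity))
          (Finset.mem_Ico.2 ⟨(by omega : 2 * m ≤ C x - 1), (by omega : C x - 1 < J)⟩))
        rw [Set.indicator_of_mem (by change C x - 1 + 1 ≤ C x; omega), mul_one]
        have : ((C x - 1 : ℕ) : ℝ) + 1 = C x := by
          have : C x - 1 + 1 = C x := by omega
          exact_mod_cast this
        rw [this]
    · rw [zero_pow hp]
      exact add_nonneg hsnn (hnn J _ (by positivity))
  have hint : Integrable (fun x => componentWeight m (C x) ^ p) ν :=
    integrable_comp_of_le hCm hCn fun c => componentWeight m c ^ p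
  refine (integral_mono hint ((integrable_finsetSum _ fun j _ => hind j _).add (hind J _))
    hpt).trans ?_
  rw [integral_add' (integrable_finsetSum _ fun j _ => hind j _) (hind J _),
    integral_finsetSum _ fun j _ => hind j _, hval]
  simp_rw [hval]
  refine add_le_add (Finset.sum_le_sum fun j _ => ?_) ?_
  · exact mul_le_mul_of_nonneg_left (measure_componentOf_card_le hA hr i j) (by positivity)
  · exact mul_le_mul_of_nonneg_left (measure_componentOf_card_le hA hr i J) (by positivity)

end LocalBounds

/-! ### Upper bounds for the probability of cross-polytopes. -/

section CrossPolytopeProbability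

variable {d n : ℕ}

open Classical in
/-- The indicator of the event that the points with index in `S` form a cross-polytope. -/
def crossIndicator (r : ℝ) (m : ℕ) (S : Finset (Fin n)) (x : Fin n → EuclideanSpace ℝ (Fin d)) :
    ℕ := if IsCrossPolytope (geometricGraph x r) m S then 1 else 0

lemma crossIndicator_le (r : ℝ) (m : ℕ) (S : Finset (Fin n))
    (x : Fin n → EuclideanSpace ℝ (Fin d)) : crossIndicator r m S x ≤ 1 := by
  unfold crossIndicator; split_ifs <;> simp

lemma measurable_crossIndicator (r : ℝ) (m : ℕ) (S : Finset (Fin n)) :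
    Measurable (crossIndicator (d := d) r m S) := by
  classical
  exact measurable_comp_geometricGraph r fun G => if IsCrossPolytope G m S then 1 else 0

lemma crossIndicator_congr (r : ℝ) (m : ℕ) (S : Finset (Fin n))
    {x y : Fin n → EuclideanSpace ℝ (Fin d)} (h : ∀ i ∈ S, x i = y i) :
    crossIndicator r m S x = crossIndicator r m S y := by
  unfold crossIndicator
  rw [IsCrossPolytope.congr (G := geometricGraph x r) (G' := geometricGraph y r)]
  intro u hu v hv
  rw [geometricGraph_adj, geometricGraph_adj, h u hu, h v hv]

lemma crossPolytopeCount_eq_sum (r : ℝ) (m : ℕ) (x : Fin n → EuclideanSpace ℝ (Fin d)) :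
    crossPolytopeCount (geometricGraph x r) Finset.univ m =
      ∑ S ∈ Finset.univ.powersetCard (2 * m), crossIndicator r m S x := by
  classical
  unfold crossPolytopeCount crossIndicator
  rw [Finset.card_filter, ← Finset.sum_subset]
  · intro S _; simp
  · intro S _ hS
    rw [if_neg]
    exact fun h => hS (Finset.mem_powersetCard.2 ⟨Finset.subset_univ _, h.1⟩)

/-- Apart from `i` and the antipodes of `i` and `j`, at least one of the `2 * m ≥ 4` vertices
remains. It is adjacent to `i`, and adjacent or equal to `j`. -/
lemma IsCrossPolytope.dist_le {r : ℝ} {m : ℕ} (hm : 2 ≤ m) {S : Finset (Fin n)}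
    {x : Fin n → EuclideanSpace ℝ (Fin d)} (h : IsCrossPolytope (geometricGraph x r) m S)
    {i j : Fin n} (hi : i ∈ S) (hj : j ∈ S) : dist (x j) (x i) ≤ 4 * r := by
  classical
  obtain ⟨u, hu, huu⟩ := h.2 i hi
  obtain ⟨v, hv, hvu⟩ := h.2 j hj
  have hex : ∃ w ∈ S, w ∉ ({i, u, v} : Finset (Fin n)) := by
    apply Finset.exists_mem_notMem_of_card_lt_card
    have h3 : ({i, u, v} : Finset (Fin n)).card ≤ 3 := Finset.card_le_three
    have := h.1
    omega
  obtain ⟨w, hw, hw'⟩ := hex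
  simp only [Finset.mem_insert, Finset.mem_singleton, not_or] at hw'
  have h1 : dist (x i) (x w) < 2 * r := by
    by_contra hc
    exact hw'.2.1 (huu w ⟨hw, hw'.1, fun h => hc h.2⟩)
  have hr : 0 < 2 * r := dist_nonneg.trans_lt h1
  have h2 : dist (x j) (x w) < 2 * r := by
    by_cases hjw : w = j
    · rw [hjw, dist_self]; exact hr
    · by_contra hc
      exact hw'.2.2 (hvu w ⟨hw, hjw, fun h => hc h.2⟩)
  have := dist_triangle_right (x j) (x i) (x w)
  linarith

variable {μ : Measure (EuclideanSpace ℝ (Fin d))} [IsProbabilityMeasure μ]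

/-- Both cross-polytopes contain `i`, so every other point of `S ∪ T` lies in the ball of radius `4
* r` around the `i`-th point. -/
lemma integral_crossIndicator_mul_le {A : ℝ} (hA : HasBallBound μ A) {r : ℝ} (hr : 0 ≤ r) {m : ℕ}
    (hm : 2 ≤ m) {S T : Finset (Fin n)} {i : Fin n} (hiS : i ∈ S) (hiT : i ∈ T) :
    ∫ x, (crossIndicator r m S x : ℝ) * crossIndicator r m T x ∂(Measure.pi fun _ : Fin n => μ) ≤
      (A * (4 * r) ^ d) ^ ((S ∪ T).erase i).card := by
  classical
  set ν := Measure.pi fun _ : Fin n => μ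
  refine le_trans ?_ (measure_forall_dist_le (μ := μ) (mul_nonneg hA.1 (by positivity))
    (fun a => hA.2 a _ (by positivity)) (Finset.notMem_erase i (S ∪ T)))
  have hms : MeasurableSet {x : Fin n → EuclideanSpace ℝ (Fin d) |
      ∀ j ∈ (S ∪ T).erase i, dist (x j) (x i) ≤ 4 * r} := by
    have : {x : Fin n → EuclideanSpace ℝ (Fin d) |
        ∀ j ∈ (S ∪ T).erase i, dist (x j) (x i) ≤ 4 * r} =
        ⋂ j ∈ (S ∪ T).erase i, {x | dist (x j) (x i) ≤ 4 * r} := by ext x; simp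
    rw [this]
    exact Finset.measurableSet_biInter _ fun j _ =>
      measurableSet_le ((measurable_pi_apply j).dist (measurable_pi_apply i)) measurable_const
  rw [← integral_indicator_one hms]
  refine integral_mono_of_nonneg (Eventually.of_forall fun x => by positivity)
    ((integrable_const (1 : ℝ)).indicator hms) (Eventually.of_forall fun x => ?_)
  dsimp only
  by_cases hx : x ∈ {x : Fin n → EuclideanSpace ℝ (Fin d) |
      ∀ j ∈ (S ∪ T).erase i, dist (x j) (x i) ≤ 4 * r}
  · rw [Set.indicator_of_mem hx, Pi.one_apply]
    exact_mod_cast Nat.mul_le_mul (crossIndicator_le r m S x) (crossIndicator_le r m T x)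
  · rw [Set.indicator_of_notMem hx]
    by_contra hc
    apply hx
    have hne : crossIndicator r m S x ≠ 0 ∧ crossIndicator r m T x ≠ 0 := by
      constructor <;> intro h0 <;> simp [h0] at hc
    have hS : IsCrossPolytope (geometricGraph x r) m S := by
      by_contra h; exact hne.1 (if_neg h)
    have hT : IsCrossPolytope (geometricGraph x r) m T := by
      by_contra h; exact hne.2 (if_neg h)
    intro j hj
    rcases Finset.mem_union.1 (Finset.mem_of_mem_erase hj) with hj | hj
    · exact hS.dist_le hm hiS hj
    · exact hT.dist_le hm hiT hj

lemma integral_crossIndicator_le {A : ℝ} (hA : HasBallBound μ A) {r : ℝ} (hr : 0 ≤ r) {m : ℕ}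
    (hm : 2 ≤ m) {S : Finset (Fin n)} (hS : S.card = 2 * m) :
    ∫ x, (crossIndicator r m S x : ℝ) ∂(Measure.pi fun _ : Fin n => μ) ≤
      (A * (4 * r) ^ d) ^ (2 * m - 1) := by
  obtain ⟨i, hi⟩ : S.Nonempty := Finset.card_pos.1 (by omega)
  have h := integral_crossIndicator_mul_le (μ := μ) hA hr hm hi hi
  rw [Finset.union_self, Finset.card_erase_of_mem hi, hS] at h
  refine le_trans (le_of_eq ?_) h
  refine integral_congr_ae (Eventually.of_forall fun x => ?_)
  rcases Nat.le_one_iff_eq_zero_or_eq_one.1 (crossIndicator_le r m S x) with h | h <;> simp [h]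

/-- Summation over sets `T` according to the number of elements outside of `S`. -/
lemma sum_card_sdiff_le {S : Finset (Fin n)} {𝒯 : Finset (Finset (Fin n))} {φ : ℕ → ℝ}
    (hφ : ∀ v, 0 ≤ φ v) {V : Finset ℕ} (hV : ∀ T ∈ 𝒯, (T \ S).card ∈ V) :
    ∑ T ∈ 𝒯, φ (T \ S).card ≤ 2 ^ S.card * ∑ v ∈ V, (n : ℝ) ^ v * φ v := by
  classical
  -- The pair of `T ∩ S` and `T \ S` determines `T`. There are at most `2 ^ S.card` choices for the
  -- first and `n ^ v` for the second when it has size `v`.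
  have h1 : ∑ T ∈ 𝒯, φ (T \ S).card =
      ∑ q ∈ 𝒯.image (fun T => (T ∩ S, T \ S)), φ q.2.card := by
    rw [Finset.sum_image]
    intro T _ T' _ h
    simp only [Prod.mk.injEq] at h
    rw [← Finset.sdiff_union_inter T S, h.1, h.2, Finset.sdiff_union_inter]
  have h2 : 𝒯.image (fun T => (T ∩ S, T \ S)) ⊆
      S.powerset ×ˢ V.biUnion fun v => Finset.univ.powersetCard v := by
    intro q hq
    obtain ⟨T, hT, rfl⟩ := Finset.mem_image.1 hq
    simp only [Finset.mem_product, Finset.mem_powerset, Finset.mem_biUnion,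
      Finset.mem_powersetCard]
    exact ⟨Finset.inter_subset_right, _, hV T hT, Finset.subset_univ _, rfl⟩
  rw [h1]
  refine (Finset.sum_le_sum_of_subset_of_nonneg h2 fun q _ _ => hφ _).trans ?_
  rw [Finset.sum_product]
  simp only [Finset.sum_const, Finset.card_powerset, nsmul_eq_mul, Nat.cast_pow, Nat.cast_ofNat]
  refine mul_le_mul_of_nonneg_left ?_ (by positivity)
  rw [Finset.sum_biUnion fun a _ b _ hab => Finset.pairwise_disjoint_powersetCard _ hab]
  refine Finset.sum_le_sum fun v _ => ?_
  rw [Finset.sum_congr rfl fun B hB => by rw [(Finset.mem_powersetCard.1 hB).2],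
    Finset.sum_const, nsmul_eq_mul, Finset.card_powersetCard]
  refine mul_le_mul_of_nonneg_right ?_ (hφ v)
  have := Nat.choose_le_pow n v
  rw [Finset.card_univ, Fintype.card_fin]
  exact_mod_cast this

end CrossPolytopeProbability

/-! ### Dependence between overlapping cross-polytopes. -/

section CrossPolytopeDependency

variable {d n : ℕ} {μ : Measure (EuclideanSpace ℝ (Fin d))} [IsProbabilityMeasure μ]

/-- Two index sets overlap if they are not disjoint. -/
abbrev Overlap (S T : Finset (Fin n)) : Prop := ¬ Disjoint S T

lemma overlap_self {m : ℕ} (hm : 1 ≤ m) (S : Finset (Fin n))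
    (hS : S ∈ Finset.univ.powersetCard (2 * m)) : Overlap S S := by
  intro h
  rw [disjoint_self, Finset.bot_eq_empty] at h
  have := (Finset.mem_powersetCard.1 hS).2
  rw [h, Finset.card_empty] at this
  omega

lemma indepFun_crossIndicator (r : ℝ) (m : ℕ) (S : Finset (Fin n))
    (𝒯 : Finset (Finset (Fin n))) :
    IndepFun (crossIndicator r m S)
      (fun x => ∑ T ∈ 𝒯.filter (fun T => ¬ Overlap S T), crossIndicator r m T x)
      (Measure.pi fun _ : Fin n => μ) := by
  refine indepFun_of_disjoint (S := S) (T := Sᶜ) disjoint_compl_right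
    (measurable_crossIndicator r m S)
    (Finset.measurable_sum _ fun T _ => measurable_crossIndicator r m T)
    (fun x y h => crossIndicator_congr r m S h) fun x y h => ?_
  refine Finset.sum_congr rfl fun T hT => crossIndicator_congr r m T fun i hi => h i ?_
  have hd := not_not.1 (Finset.mem_filter.1 hT).2
  exact Finset.mem_compl.2 fun hiS => Finset.disjoint_left.1 hd hiS hi

/-- Let q denote the ball bound `A * (4 * r) ^ d`. The products of means contribute at most order n
(n q) ^ (4m - 2). A distinct overlapping pair with v new points, 1 ≤ v < 2m, contributes order n (n
q) ^ (2m - 1 + v). As n q ≤ 1, all exponents may be lowered to 2m, the value at v = 1. -/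
lemma dependencyError_crossIndicator_le {A : ℝ} (hA : HasBallBound μ A) {r : ℝ} (hr : 0 ≤ r)
    {m : ℕ} (hm : 2 ≤ m) (hn : 1 ≤ n) (hnq : n * (A * (4 * r) ^ d) ≤ 1) :
    dependencyError (Measure.pi fun _ : Fin n => μ) (Finset.univ.powersetCard (2 * m))
      (crossIndicator r m) Overlap ≤
      2 ^ (2 * m) * (4 * m) * (n * (n * (A * (4 * r) ^ d)) ^ (2 * m)) := by
  classical
  set q := A * (4 * r) ^ d with hq
  have hq0 : 0 ≤ q := mul_nonneg hA.1 (by positivity)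
  have hn1 : (1 : ℝ) ≤ n := by exact_mod_cast hn
  have hcard : (((Finset.univ : Finset (Fin n)).powersetCard (2 * m)).card : ℝ) ≤
      (n : ℝ) ^ (2 * m) := by
    rw [Finset.card_powersetCard, Finset.card_univ, Fintype.card_fin]
    exact_mod_cast Nat.choose_le_pow n (2 * m)
  have hle : ∀ {S T : Finset (Fin n)}, T.card = 2 * m → Overlap S T → (T \ S).card < 2 * m := by
    intro S T hT hov
    obtain ⟨i, hiS, hiT⟩ := Finset.not_disjoint_iff.1 hov
    rw [← hT]
    exact Finset.card_lt_card (Finset.ssubset_iff_subset_ne.2 ⟨Finset.sdiff_subset, fun h => by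
      rw [← h] at hiT; exact (Finset.mem_sdiff.1 hiT).2 hiS⟩)
  have hpow : ∀ c : ℝ, 0 ≤ c → ∑ S ∈ (Finset.univ : Finset (Fin n)).powersetCard (2 * m), c ≤
      (n : ℝ) ^ (2 * m) * c := fun c hc => by
    rw [Finset.sum_const, nsmul_eq_mul]
    exact mul_le_mul_of_nonneg_right hcard hc
  have hb1 : ∑ S ∈ (Finset.univ : Finset (Fin n)).powersetCard (2 * m),
      (∑ T ∈ (Finset.univ.powersetCard (2 * m)).filter (Overlap S),
        (∫ x, (crossIndicator r m S x : ℝ) ∂(Measure.pi fun _ : Fin n => μ)) *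
        ∫ x, (crossIndicator r m T x : ℝ) ∂(Measure.pi fun _ : Fin n => μ)) ≤
      2 ^ (2 * m) * (2 * m) * (n * (n * q) ^ (2 * m)) := by
    have h1 : ∀ S ∈ (Finset.univ : Finset (Fin n)).powersetCard (2 * m),
        (∑ T ∈ (Finset.univ.powersetCard (2 * m)).filter (Overlap S),
        (∫ x, (crossIndicator r m S x : ℝ) ∂(Measure.pi fun _ : Fin n => μ)) *
        ∫ x, (crossIndicator r m T x : ℝ) ∂(Measure.pi fun _ : Fin n => μ)) ≤
        2 ^ (2 * m) * ((2 * m) * ((n : ℝ) ^ (2 * m - 1) *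
          (q ^ (2 * m - 1) * q ^ (2 * m - 1)))) := by
      intro S hS
      have hSc := (Finset.mem_powersetCard.1 hS).2
      refine (Finset.sum_le_sum fun T hT => mul_le_mul
        (integral_crossIndicator_le (μ := μ) hA hr hm hSc)
        (integral_crossIndicator_le (μ := μ) hA hr hm
          (Finset.mem_powersetCard.1 (Finset.mem_filter.1 hT).1).2)
        (integral_nonneg fun x => Nat.cast_nonneg _) (pow_nonneg hq0 _)).trans ?_
      refine (sum_card_sdiff_le (S := S) (φ := fun _ => q ^ (2 * m - 1) * q ^ (2 * m - 1))
        (fun _ => by positivity) (V := Finset.range (2 * m)) fun T hT => ?_).trans ?_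
      · obtain ⟨hT1, hT2⟩ := Finset.mem_filter.1 hT
        exact Finset.mem_range.2 (hle (Finset.mem_powersetCard.1 hT1).2 hT2)
      · rw [hSc]
        refine mul_le_mul_of_nonneg_left ?_ (by positivity)
        refine (Finset.sum_le_card_nsmul _ _ ((n : ℝ) ^ (2 * m - 1) *
          (q ^ (2 * m - 1) * q ^ (2 * m - 1))) fun v hv => ?_).trans (le_of_eq ?_)
        · have : v ≤ 2 * m - 1 := by have := Finset.mem_range.1 hv; omega
          refine mul_le_mul_of_nonneg_right ?_ (by positivity)
          exact pow_le_pow_right₀ hn1 this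
        · rw [Finset.card_range, nsmul_eq_mul]; push_cast; ring
    refine (Finset.sum_le_sum h1).trans ((hpow _ (by positivity)).trans ?_)
    have e : (n : ℝ) ^ (2 * m) * (2 ^ (2 * m) * ((2 * m) * ((n : ℝ) ^ (2 * m - 1) *
          (q ^ (2 * m - 1) * q ^ (2 * m - 1))))) =
        2 ^ (2 * m) * (2 * m) * (n * ((n * q) ^ (2 * m - 1) * (n * q) ^ (2 * m - 1))) := by
      have : (n : ℝ) ^ (2 * m) = n * (n : ℝ) ^ (2 * m - 1) := by
        rw [← pow_succ']; congr 1; omega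
      rw [this, mul_pow]; ring
    rw [e, ← pow_add]
    refine mul_le_mul_of_nonneg_left (mul_le_mul_of_nonneg_left ?_ (by positivity)) (by positivity)
    exact pow_le_pow_of_le_one (by positivity) hnq (by omega)
  have hb2 : ∑ S ∈ (Finset.univ : Finset (Fin n)).powersetCard (2 * m),
      (∑ T ∈ ((Finset.univ.powersetCard (2 * m)).filter (Overlap S)).erase S,
        ∫ x, (crossIndicator r m S x : ℝ) * crossIndicator r m T x
          ∂(Measure.pi fun _ : Fin n => μ)) ≤
      2 ^ (2 * m) * (2 * m) * (n * (n * q) ^ (2 * m)) := by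
    have h1 : ∀ S ∈ (Finset.univ : Finset (Fin n)).powersetCard (2 * m),
        (∑ T ∈ ((Finset.univ.powersetCard (2 * m)).filter (Overlap S)).erase S,
        ∫ x, (crossIndicator r m S x : ℝ) * crossIndicator r m T x
          ∂(Measure.pi fun _ : Fin n => μ)) ≤
        2 ^ (2 * m) * ((2 * m) * (q ^ (2 * m - 1) * (n * q))) := by
      intro S hS
      have hSc := (Finset.mem_powersetCard.1 hS).2
      have h2 : ∀ T ∈ ((Finset.univ.powersetCard (2 * m)).filter (Overlap S)).erase S,
          ∫ x, (crossIndicator r m S x : ℝ) * crossIndicator r m T x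
          ∂(Measure.pi fun _ : Fin n => μ) ≤ q ^ (2 * m - 1 + (T \ S).card) := by
        intro T hT
        have hT2 := (Finset.mem_filter.1 (Finset.mem_of_mem_erase hT)).2
        obtain ⟨i, hiS, hiT⟩ := Finset.not_disjoint_iff.1 hT2
        have := integral_crossIndicator_mul_le (μ := μ) hA hr hm hiS hiT
        rw [Finset.card_erase_of_mem (Finset.mem_union_left _ hiS), Finset.union_comm,
          ← Finset.card_sdiff_add_card, hSc] at this
        rwa [show 2 * m - 1 + (T \ S).card = (T \ S).card + 2 * m - 1 by omega]
      refine (Finset.sum_le_sum h2).trans ?_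
      refine (sum_card_sdiff_le (S := S) (φ := fun v => q ^ (2 * m - 1 + v))
        (fun _ => by positivity) (V := Finset.Ico 1 (2 * m)) fun T hT => ?_).trans ?_
      · obtain ⟨hne, hT'⟩ := Finset.mem_erase.1 hT
        obtain ⟨hT1, hT2⟩ := Finset.mem_filter.1 hT'
        have hTc := (Finset.mem_powersetCard.1 hT1).2
        refine Finset.mem_Ico.2 ⟨?_, hle hTc hT2⟩
        rw [Nat.one_le_iff_ne_zero, Finset.card_ne_zero, Finset.sdiff_nonempty]
        exact fun h => hne (Finset.eq_of_subset_of_card_le h (by omega))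
      · rw [hSc]
        refine mul_le_mul_of_nonneg_left ?_ (by positivity)
        refine (Finset.sum_le_card_nsmul _ _ (q ^ (2 * m - 1) * (n * q)) fun v hv => ?_).trans ?_
        · have hv1 : 1 ≤ v := (Finset.mem_Ico.1 hv).1
          calc (n : ℝ) ^ v * q ^ (2 * m - 1 + v) = q ^ (2 * m - 1) * (n * q) ^ v := by
                rw [pow_add, mul_pow]; ring
            _ ≤ q ^ (2 * m - 1) * (n * q) ^ 1 := mul_le_mul_of_nonneg_left
                (pow_le_pow_of_le_one (by positivity) hnq hv1) (by positivity)
            _ = _ := by rw [pow_one]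
        · rw [Nat.card_Ico, nsmul_eq_mul]
          refine mul_le_mul_of_nonneg_right ?_ (by positivity)
          have : 2 * m - 1 ≤ 2 * m := Nat.sub_le _ _
          exact_mod_cast this
    refine (Finset.sum_le_sum h1).trans ((hpow _ (by positivity)).trans (le_of_eq ?_))
    have e1 : (n : ℝ) ^ (2 * m) = n * (n : ℝ) ^ (2 * m - 1) := by
      rw [← pow_succ']; congr 1; omega
    have e2 : (n * q) ^ (2 * m) = (n * q) * (n * q) ^ (2 * m - 1) := by
      rw [← pow_succ']; congr 1; omega
    rw [e1, e2, mul_pow]; ring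
  unfold dependencyError
  linarith

end CrossPolytopeDependency

/-! ### A stable cross-polytope configuration. -/

section Configuration

variable {d : ℕ}

/-- The directions of the vectors (1, i) in a coordinate plane: distinct slopes make them different,
and a positive first coordinate excludes antipodes. Two dimensions are needed for this. -/
lemma exists_unit_vectors (hd : 2 ≤ d) (m : ℕ) : ∃ v : Fin m → EuclideanSpace ℝ (Fin d),
    (∀ i, ‖v i‖ = 1) ∧ ∀ i j, i ≠ j → v i ≠ v j ∧ v i ≠ - v j := by
  let i0 : Fin d := ⟨0, by omega⟩
  let i1 : Fin d := ⟨1, by omega⟩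
  have h01 : i0 ≠ i1 := by simp [i0, i1]
  let w : Fin m → EuclideanSpace ℝ (Fin d) := fun i =>
    EuclideanSpace.single i0 1 + EuclideanSpace.single i1 (i : ℝ)
  have w0 : ∀ i, w i i0 = 1 := fun i => by simp [w, h01]
  have w1 : ∀ i, w i i1 = (i : ℝ) := fun i => by simp [w, h01.symm]
  have hw : ∀ i, 0 < ‖w i‖ := fun i => norm_pos_iff.2 fun h => by
    have := w0 i
    rw [h] at this
    simp at this
  refine ⟨fun i => ‖w i‖⁻¹ • w i, fun i => ?_, fun i j hij => ⟨fun h => ?_, fun h => ?_⟩⟩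
  · rw [norm_smul, norm_inv, norm_norm, inv_mul_cancel₀ (hw i).ne']
  · have h0 := congrArg (fun u => u i0) h
    have h1 := congrArg (fun u => u i1) h
    simp only [PiLp.smul_apply, w0, w1, smul_eq_mul, mul_one] at h0 h1
    rw [h0] at h1
    have := mul_left_cancel₀ (inv_pos.2 (hw j)).ne' h1
    exact hij (Fin.ext (by exact_mod_cast this))
  · have h0 := congrArg (fun u => u i0) h
    simp only [PiLp.smul_apply, PiLp.neg_apply, w0, smul_eq_mul, mul_one] at h0
    have h1 := inv_pos.2 (hw i)
    have h2 := inv_pos.2 (hw j)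
    linarith

/-- A cross-polytope configuration in the plane, with some room for perturbation. -/
lemma exists_crossPolytope_configuration (hd : 2 ≤ d) (m : ℕ) :
    ∃ (y : Fin m × Bool → EuclideanSpace ℝ (Fin d)) (η : ℝ), 0 < η ∧
      ∀ a b, a ≠ b → (a.1 = b.1 → 2 + 2 * η ≤ dist (y a) (y b)) ∧
        (a.1 ≠ b.1 → dist (y a) (y b) + 2 * η < 2) := by
  obtain ⟨v, hv1, hv⟩ := exists_unit_vectors hd m
  let u : Fin m × Bool → EuclideanSpace ℝ (Fin d) := fun a => if a.2 then v a.1 else - v a.1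
  have hu : ∀ a, ‖u a‖ = 1 := fun a => by
    by_cases h : a.2 <;> simp [u, h, hv1]
  have hopp : ∀ a b : Fin m × Bool, a ≠ b → a.1 = b.1 → dist (u a) (u b) = 2 := by
    rintro ⟨i, b⟩ ⟨j, c⟩ hne hij
    simp only at hij
    subst hij
    have hbc : b ≠ c := fun h => hne (by rw [h])
    have h2 : ‖v i + v i‖ = 2 := by rw [← two_smul ℝ, norm_smul, hv1]; norm_num
    cases b <;> cases c <;> simp_all [u, dist_eq_norm]
    rw [← neg_add', norm_neg, h2]
  have hlt : ∀ a b : Fin m × Bool, a.1 ≠ b.1 → dist (u a) (u b) < 2 := by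
    intro a b hab
    have hne : u a ≠ - u b := by
      obtain ⟨h1, h2⟩ := hv _ _ hab
      by_cases ha : a.2 <;> by_cases hb : b.2 <;> simp only [u, ha, hb, if_true]
      · simpa using h2
      · simpa using h1
      · simpa using h1
      · intro h; exact h2 (by simpa using congrArg Neg.neg h)
    -- Strict convexity: distinct unit vectors that are not antipodal are at distance less than 2.
    have hray : ¬ SameRay ℝ (u a) (- u b) := by
      rw [sameRay_iff_of_norm_eq (by rw [norm_neg, hu, hu])]
      exact hne
    have := norm_add_lt_of_not_sameRay hray
    rw [norm_neg, hu, hu, ← sub_eq_add_neg, ← dist_eq_norm] at this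
    linarith
  -- Antipodes are at distance exactly 2, the threshold. Slight dilation pushes them beyond it while
  -- the finitely many other distances stay below.
  have hρ : ∀ᶠ ρ : ℝ in 𝓝[>] 1, ∀ a b : Fin m × Bool, a.1 ≠ b.1 → ρ * dist (u a) (u b) < 2 := by
    rw [eventually_all]
    intro a
    rw [eventually_all]
    intro b
    by_cases hab : a.1 = b.1
    · exact Eventually.of_forall fun _ h => absurd hab h
    · have hc : Tendsto (fun ρ : ℝ => ρ * dist (u a) (u b)) (𝓝[>] 1) (𝓝 (1 * dist (u a) (u b))) :=
        (tendsto_id.mul_const _).mono_left nhdsWithin_le_nhds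
      rw [one_mul] at hc
      filter_upwards [hc.eventually_lt_const (hlt a b hab)] with ρ h _ using h
  obtain ⟨ρ, hρ2, hρ1⟩ := (hρ.and self_mem_nhdsWithin).exists
  have hρ1 : 1 < ρ := hρ1
  have hη : ∀ᶠ η : ℝ in 𝓝[>] 0, (2 + 2 * η ≤ 2 * ρ) ∧
      ∀ a b : Fin m × Bool, a.1 ≠ b.1 → ρ * dist (u a) (u b) + 2 * η < 2 := by
    have hc : ∀ c : ℝ, Tendsto (fun η : ℝ => c + 2 * η) (𝓝[>] 0) (𝓝 (c + 2 * 0)) := fun c =>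
      ((tendsto_id.const_mul 2).const_add c).mono_left nhdsWithin_le_nhds
    simp only [mul_zero, add_zero] at hc
    refine Eventually.and ?_ ?_
    · filter_upwards [(hc 2).eventually_lt_const (by linarith : (2 : ℝ) < 2 * ρ)] with η h using h.le
    rw [eventually_all]
    intro a
    rw [eventually_all]
    intro b
    by_cases hab : a.1 = b.1
    · exact Eventually.of_forall fun _ h => absurd hab h
    · filter_upwards [(hc _).eventually_lt_const (hρ2 a b hab)] with η h _ using h
  obtain ⟨η, ⟨hη1, hη2⟩, hη0⟩ := (hη.and self_mem_nhdsWithin).exists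
  have hdist : ∀ a b, dist (ρ • u a) (ρ • u b) = ρ * dist (u a) (u b) := fun a b => by
    rw [dist_smul₀, Real.norm_eq_abs, abs_of_pos (by linarith)]
  refine ⟨fun a => ρ • u a, η, hη0, fun a b hab => ⟨fun h => ?_, fun h => ?_⟩⟩
  · rw [hdist, hopp a b hab h]; linarith
  · rw [hdist]; exact hη2 a b h

/-- Moving every point by at most `r * η` changes distances by at most `2 * r * η`, so no distance
crosses the threshold `2 * r`. -/
lemma isCrossPolytope_of_dist_le {m n : ℕ} {y : Fin m × Bool → EuclideanSpace ℝ (Fin d)} {η : ℝ}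
    (hy : ∀ a b, a ≠ b → (a.1 = b.1 → 2 + 2 * η ≤ dist (y a) (y b)) ∧
        (a.1 ≠ b.1 → dist (y a) (y b) + 2 * η < 2))
    {S : Finset (Fin n)} (e : S ≃ Fin m × Bool) {r : ℝ} (hr : 0 < r)
    {x : Fin n → EuclideanSpace ℝ (Fin d)} {c : EuclideanSpace ℝ (Fin d)}
    (hx : ∀ s : S, dist (x s) (c + r • y (e s)) ≤ r * η) :
    IsCrossPolytope (geometricGraph x r) m S := by
  have hdist : ∀ s t : S, dist (c + r • y (e s)) (c + r • y (e t)) = r * dist (y (e s)) (y (e t)) :=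
    fun s t => by rw [dist_add_left, dist_smul₀, Real.norm_eq_abs, abs_of_pos hr]
  have hadj : ∀ s t : S, s ≠ t → ((geometricGraph x r).Adj s t ↔ (e s).1 ≠ (e t).1) := by
    intro s t hst
    have hne : e s ≠ e t := e.injective.ne hst
    rw [geometricGraph_adj]
    constructor
    · rintro ⟨_, h⟩ heq
      have h1 := (hy _ _ hne).1 heq
      have h2 := dist_triangle4 (c + r • y (e s)) (x s) (x t) (c + r • y (e t))
      have h3 := hx s
      rw [dist_comm] at h3
      have h4 := hx t
      rw [hdist] at h2
      have : r * (2 + 2 * η) ≤ r * dist (y (e s)) (y (e t)) := by gcongr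
      linarith
    · intro h
      refine ⟨fun h' => hst (Subtype.ext h'), ?_⟩
      have h1 := (hy _ _ hne).2 h
      have h2 := dist_triangle4 (x s) (c + r • y (e s)) (c + r • y (e t)) (x t)
      have h3 := hx s
      have h4 := hx t
      rw [dist_comm] at h4
      rw [hdist] at h2
      have : r * (dist (y (e s)) (y (e t)) + 2 * η) < r * 2 := by gcongr
      linarith
  refine ⟨?_, fun v hv => ?_⟩
  · have := Fintype.card_congr e
    simp only [Fintype.card_coe, Fintype.card_prod, Fintype.card_fin, Fintype.card_bool] at this
    omega
  · let s : S := ⟨v, hv⟩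
    let t : S := e.symm ((e s).1, !(e s).2)
    have het : e t = ((e s).1, !(e s).2) := e.apply_symm_apply _
    have hts : t ≠ s := fun h => by
      rw [h] at het
      have := congrArg Prod.snd het
      simp at this
    refine ⟨t, ⟨t.2, fun h => hts (Subtype.ext h), fun h => ?_⟩, ?_⟩
    · have := (hadj s t hts.symm).1 h
      rw [het] at this
      exact this rfl
    · rintro u ⟨huS, huv, hna⟩
      let w : S := ⟨u, huS⟩
      have hws : w ≠ s := fun h => huv (congrArg Subtype.val h)
      have h1 : (e s).1 = (e w).1 := by
        by_contra h
        exact hna ((hadj s w hws.symm).2 h)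
      have h2 : (e s).2 ≠ (e w).2 := fun h => hws (e.injective (Prod.ext h1 h)).symm
      have : e w = e t := by
        rw [het]
        refine Prod.ext h1.symm ?_
        revert h2
        cases (e s).2 <;> cases (e w).2 <;> simp
      exact congrArg Subtype.val (e.injective this)

end Configuration

/-! ### The measure with density f and the lower bound for the probability of a cross-polytope. -/

section Density

variable {d : ℕ} {f : EuclideanSpace ℝ (Fin d) → ℝ}

/-- The measure with density `f`. -/
def densityMeasure (f : EuclideanSpace ℝ (Fin d) → ℝ) : Measure (EuclideanSpace ℝ (Fin d)) :=
  volume.withDensity fun x => ENNReal.ofReal (f x)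

lemma integrable_of_integral_eq_one (hf_int : ∫ x, f x = 1) : Integrable f := by
  by_contra h
  rw [integral_undef h] at hf_int
  exact zero_ne_one hf_int

lemma isProbabilityMeasure_densityMeasure (hf0 : ∀ x, 0 ≤ f x) (hf_int : ∫ x, f x = 1) :
    IsProbabilityMeasure (densityMeasure f) := by
  constructor
  rw [densityMeasure, withDensity_apply _ MeasurableSet.univ, Measure.restrict_univ,
    ← ofReal_integral_eq_lintegral_ofReal (integrable_of_integral_eq_one hf_int)
      (Eventually.of_forall hf0), hf_int, ENNReal.ofReal_one]

lemma densityMeasure_real_apply (hf0 : ∀ x, 0 ≤ f x) (hf_int : ∫ x, f x = 1)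
    {s : Set (EuclideanSpace ℝ (Fin d))} (hs : MeasurableSet s) :
    (densityMeasure f).real s = ∫ x in s, f x := by
  rw [measureReal_def, densityMeasure, withDensity_apply _ hs,
    ← ofReal_integral_eq_lintegral_ofReal (integrable_of_integral_eq_one hf_int).integrableOn
      (Eventually.of_forall hf0), ENNReal.toReal_ofReal (integral_nonneg hf0)]

/-- The volume of the unit ball. -/
def unitBallVolume (d : ℕ) : ℝ :=
  (volume : Measure (EuclideanSpace ℝ (Fin d))).real (Metric.ball 0 1)

lemma unitBallVolume_pos (d : ℕ) : 0 < unitBallVolume d :=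
  ENNReal.toReal_pos (Metric.measure_ball_pos volume _ one_pos).ne' measure_ball_lt_top.ne

lemma volume_real_closedBall (a : EuclideanSpace ℝ (Fin d)) {ρ : ℝ} (hρ : 0 ≤ ρ) :
    (volume : Measure (EuclideanSpace ℝ (Fin d))).real (Metric.closedBall a ρ) =
      ρ ^ d * unitBallVolume d := by
  rw [Measure.addHaar_real_closedBall volume a hρ, finrank_euclideanSpace_fin]
  rfl

lemma densityMeasure_real_closedBall_le (hf0 : ∀ x, 0 ≤ f x) (hf_int : ∫ x, f x = 1) {M : ℝ}
    (hM : ∀ x, f x ≤ M) (a : EuclideanSpace ℝ (Fin d)) {ρ : ℝ} (hρ : 0 ≤ ρ) :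
    (densityMeasure f).real (Metric.closedBall a ρ) ≤ M * (ρ ^ d * unitBallVolume d) := by
  rw [densityMeasure_real_apply hf0 hf_int measurableSet_closedBall]
  calc ∫ x in Metric.closedBall a ρ, f x ≤ ∫ _ in Metric.closedBall a ρ, M :=
        integral_mono (integrable_of_integral_eq_one hf_int).integrableOn
          (integrableOn_const measure_closedBall_lt_top.ne) hM
    _ = _ := by
        rw [setIntegral_const, volume_real_closedBall a hρ, smul_eq_mul, mul_comm]

lemma hasBallBound_densityMeasure (hf0 : ∀ x, 0 ≤ f x) (hf_int : ∫ x, f x = 1) {M : ℝ}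
    (hM : ∀ x, f x ≤ M) : HasBallBound (densityMeasure f) (M * unitBallVolume d) := by
  have := isProbabilityMeasure_densityMeasure hf0 hf_int
  have hM0 : 0 ≤ M := (hf0 0).trans (hM 0)
  refine ⟨mul_nonneg hM0 (unitBallVolume_pos d).le, fun a ρ hρ => ?_⟩
  rw [← ofReal_measureReal (measure_ne_top _ _)]
  refine ENNReal.ofReal_le_ofReal ?_
  refine (densityMeasure_real_closedBall_le hf0 hf_int hM a hρ).trans (le_of_eq (by ring))

lemma measurable_measure_closedBall_add {μ : Measure (EuclideanSpace ℝ (Fin d))} [SFinite μ]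
    (t : EuclideanSpace ℝ (Fin d)) (ρ : ℝ) :
    Measurable fun a => μ (Metric.closedBall (a + t) ρ) := by
  have hs : MeasurableSet {p : EuclideanSpace ℝ (Fin d) × EuclideanSpace ℝ (Fin d) |
      dist p.2 (p.1 + t) ≤ ρ} :=
    measurableSet_le (measurable_snd.dist (measurable_fst.add_const _)) measurable_const
  exact measurable_measure_prodMk_left hs

/-- The averages of `f` over balls with moving centres converge to `f`, and so do the integrals of
their products. -/
lemma tendsto_integral_prod_ball (hf0 : ∀ x, 0 ≤ f x)
    (hf_int : ∫ x, f x = 1) {M : ℝ} (hM : ∀ x, f x ≤ M) {β : Type*} (B : Finset β)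
    (t : β → EuclideanSpace ℝ (Fin d)) {η : ℝ} (hη : 0 < η) :
    Tendsto (fun r : ℝ => ∫ a, ∏ b ∈ B, ((densityMeasure f).real
        (Metric.closedBall (a + r • t b) (r * η)) / ((r * η) ^ d * unitBallVolume d))
        ∂(densityMeasure f)) (𝓝[>] 0) (𝓝 (∫ a, f a ^ B.card ∂(densityMeasure f))) := by
  have hprob := isProbabilityMeasure_densityMeasure hf0 hf_int
  have hω := unitBallVolume_pos d
  have hM0 : 0 ≤ M := (hf0 0).trans (hM 0)
  have hpos : ∀ᶠ r : ℝ in 𝓝[>] 0, 0 < r := self_mem_nhdsWithin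
  refine tendsto_integral_filter_of_dominated_convergence (fun _ => M ^ B.card) ?_ ?_
    (integrable_const _) ?_
  · refine Eventually.of_forall fun r => Measurable.aestronglyMeasurable ?_
    refine Finset.measurable_prod B fun b _ => Measurable.div_const ?_ _
    exact (measurable_measure_closedBall_add _ _).ennreal_toReal
  · filter_upwards [hpos] with r hr
    refine Eventually.of_forall fun a => ?_
    rw [Real.norm_eq_abs, Finset.abs_prod, ← Finset.prod_const]
    refine Finset.prod_le_prod (fun _ _ => abs_nonneg _) fun b _ => ?_
    rw [abs_of_nonneg (by positivity), div_le_iff₀ (by positivity)]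
    exact densityMeasure_real_closedBall_le hf0 hf_int hM _ (by positivity)
  · have hae : ∀ b ∈ B, ∀ᵐ a ∂(densityMeasure f), Tendsto (fun r : ℝ => (densityMeasure f).real
        (Metric.closedBall (a + r • t b) (r * η)) / ((r * η) ^ d * unitBallVolume d))
        (𝓝[>] 0) (𝓝 (f a)) := by
      intro b _
      have hac : densityMeasure f ≪ volume := withDensity_absolutelyContinuous _ _
      refine hac.ae_le ?_
      have hL := IsUnifLocDoublingMeasure.ae_tendsto_average
        (μ := (volume : Measure (EuclideanSpace ℝ (Fin d))))
        (integrable_of_integral_eq_one hf_int).locallyIntegrable (‖t b‖ / η)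
      filter_upwards [hL] with a ha
      have hδ : Tendsto (fun r : ℝ => r * η) (𝓝[>] 0) (𝓝[>] 0) := by
        refine tendsto_nhdsWithin_iff.2 ⟨?_, ?_⟩
        · have : Tendsto (fun r : ℝ => r * η) (𝓝 0) (𝓝 (0 * η)) := tendsto_id.mul_const η
          rw [zero_mul] at this
          exact this.mono_left nhdsWithin_le_nhds
        · filter_upwards [hpos] with r hr using mul_pos hr hη
      -- Lebesgue differentiation along balls that are not centred at `a`: the distance of `a` to
      -- the centre is `‖t b‖ / η` times the radius, a fixed ratio.
      have h := ha (fun r : ℝ => a + r • t b) (fun r => r * η) hδ (by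
        filter_upwards [hpos] with r hr
        rw [Metric.mem_closedBall, dist_self_add_right, norm_smul, Real.norm_eq_abs,
          abs_of_pos hr]
        refine le_of_eq ?_
        field_simp)
      refine h.congr' ?_
      filter_upwards [hpos] with r hr
      rw [densityMeasure_real_apply hf0 hf_int measurableSet_closedBall, setAverage_eq,
        volume_real_closedBall _ (by positivity), smul_eq_mul, inv_mul_eq_div]
    have hall := (Finset.eventually_all B).2 hae
    filter_upwards [hall] with a ha
    rw [← Finset.prod_const]
    exact tendsto_finsetProd B ha

/-- A density is positive almost everywhere for the measure that it defines. -/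
lemma integral_pow_densityMeasure_pos (hf_meas : Measurable f) (hf0 : ∀ x, 0 ≤ f x)
    (hf_int : ∫ x, f x = 1) {M : ℝ} (hM : ∀ x, f x ≤ M) (N : ℕ) :
    0 < ∫ a, f a ^ N ∂(densityMeasure f) := by
  have hprob := isProbabilityMeasure_densityMeasure hf0 hf_int
  rw [integral_pos_iff_support_of_nonneg (fun x => pow_nonneg (hf0 x) N)
    (integrable_of_abs_le (B := M ^ N) (hf_meas.pow_const N) fun x => by
      rw [abs_of_nonneg (pow_nonneg (hf0 x) N)]; exact pow_le_pow_left₀ (hf0 x) (hM x) N)]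
  have hz : densityMeasure f {x | f x = 0} = 0 := by
    have hms : MeasurableSet {x | f x = 0} := hf_meas (measurableSet_singleton 0)
    rw [densityMeasure, withDensity_apply _ hms, setLIntegral_congr_fun (g := fun _ => 0) hms
      (fun x hx => by
        have : f x = 0 := hx
        simp [this])]
    simp
  rw [pos_iff_ne_zero]
  intro h
  have hsub : (Set.univ : Set (EuclideanSpace ℝ (Fin d))) ⊆
      {x | f x = 0} ∪ Function.support fun x => f x ^ N := by
    intro x _
    by_cases hx : f x = 0
    · exact Or.inl hx
    · exact Or.inr (pow_ne_zero N hx)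
  have := (measure_mono (μ := densityMeasure f) hsub).trans (measure_union_le _ _)
  rw [hz, h, add_zero, measure_univ] at this
  exact absurd this (by simp)

/-- The probability that given points form a cross-polytope is of order at least
`r ^ (d (2 m - 1))`. -/
theorem exists_le_integral_crossIndicator (hd : 2 ≤ d) {m : ℕ} (hm : 1 ≤ m)
    (hf_meas : Measurable f) (hf0 : ∀ x, 0 ≤ f x) (hf_int : ∫ x, f x = 1) {M : ℝ}
    (hM : ∀ x, f x ≤ M) :
    ∃ c : ℝ, 0 < c ∧ ∀ᶠ r : ℝ in 𝓝[>] 0, ∀ (n : ℕ) (S : Finset (Fin n)), S.card = 2 * m →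
      c * r ^ (d * (2 * m - 1)) ≤
        ∫ x, (crossIndicator r m S x : ℝ) ∂(Measure.pi fun _ : Fin n => densityMeasure f) := by
  classical
  have hprob := isProbabilityMeasure_densityMeasure hf0 hf_int
  have hω := unitBallVolume_pos d
  obtain ⟨y, η, hη, hy⟩ := exists_crossPolytope_configuration hd m
  let a₀ : Fin m × Bool := (⟨0, hm⟩, true)
  let B : Finset (Fin m × Bool) := Finset.univ.erase a₀
  have hBc : B.card = 2 * m - 1 := by
    simp only [B, Finset.card_erase_of_mem (Finset.mem_univ _), Finset.card_univ,
      Fintype.card_prod, Fintype.card_fin, Fintype.card_bool]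
    omega
  set I := ∫ a, f a ^ B.card ∂(densityMeasure f) with hI
  have hI0 : 0 < I := integral_pow_densityMeasure_pos hf_meas hf0 hf_int hM _
  have hlim := tendsto_integral_prod_ball hf0 hf_int hM B (fun b => y b - y a₀) hη
  -- After rescaling by the volumes of the balls the probability tends to `I`, so half of `I` is a
  -- lower bound for all small radii, and it depends neither on `n` nor on `S`.
  refine ⟨I / 2 * (η ^ d * unitBallVolume d) ^ (2 * m - 1), by positivity, ?_⟩
  filter_upwards [hlim.eventually_const_lt (by linarith : I / 2 < I), self_mem_nhdsWithin]
    with r hr1 hr0 n S hS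
  have hr0 : 0 < r := hr0
  have hcard : Fintype.card S = Fintype.card (Fin m × Bool) := by
    simp only [Fintype.card_coe, Fintype.card_prod, Fintype.card_fin, Fintype.card_bool]
    omega
  obtain ⟨e⟩ := Fintype.card_eq.1 hcard
  let i₀ : Fin n := (e.symm a₀ : S)
  have hi₀ : i₀ ∈ S := (e.symm a₀).2
  -- the displacement of a vertex relative to the vertex `i₀`
  let τ : Fin n → EuclideanSpace ℝ (Fin d) := fun j =>
    if h : j ∈ S then y (e ⟨j, h⟩) - y a₀ else 0
  let R : Fin n → Set (EuclideanSpace ℝ (Fin d) × EuclideanSpace ℝ (Fin d)) := fun j =>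
    {p | dist p.2 (p.1 + r • τ j) ≤ r * η}
  have hR : ∀ j, MeasurableSet (R j) := fun j =>
    measurableSet_le (measurable_snd.dist (measurable_fst.add_const _)) measurable_const
  set ν := Measure.pi fun _ : Fin n => densityMeasure f
  set Q : Set (Fin n → EuclideanSpace ℝ (Fin d)) := {x | ∀ j ∈ S.erase i₀, (x i₀, x j) ∈ R j}
  have hQm : MeasurableSet Q := by
    have : Q = ⋂ j ∈ S.erase i₀,
        (fun x : Fin n → EuclideanSpace ℝ (Fin d) => (x i₀, x j)) ⁻¹' R j := by ext x; simp [Q]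
    rw [this]
    exact Finset.measurableSet_biInter _ fun j _ =>
      ((measurable_pi_apply i₀).prodMk (measurable_pi_apply j)) (hR j)
  have hQ : ∀ x ∈ Q, IsCrossPolytope (geometricGraph x r) m S := by
    intro x hx
    -- The centre is chosen so that the point `i₀` sits exactly at its vertex `a₀`; only the other
    -- points need to be near theirs.
    refine isCrossPolytope_of_dist_le hy e hr0 (c := x i₀ - r • y a₀) fun s => ?_
    by_cases hs : (s : Fin n) = i₀
    · have hes : e s = a₀ := by
        have : s = e.symm a₀ := Subtype.ext hs
        rw [this, e.apply_symm_apply]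
      rw [hs, hes, sub_add_cancel, dist_self]
      positivity
    · have h := hx s (Finset.mem_erase.2 ⟨hs, s.2⟩)
      have hτ : τ s = y (e s) - y a₀ := by simp [τ]
      have h' : dist (x s) (x i₀ + r • τ s) ≤ r * η := h
      rw [hτ, smul_sub] at h'
      rwa [show x i₀ - r • y a₀ + r • y (e s) = x i₀ + (r • y (e s) - r • y a₀) by abel]
  have hval : ν.real Q = ∫ a, ∏ b ∈ B, (densityMeasure f).real
      (Metric.closedBall (a + r • (y b - y a₀)) (r * η)) ∂(densityMeasure f) := by
    have h := pi_forall_mem_eq_lintegral (μ := densityMeasure f) (Finset.notMem_erase i₀ S) hR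
    have hprod : ∀ a, ∏ j ∈ S.erase i₀, densityMeasure f {b | (a, b) ∈ R j} =
        ∏ b ∈ B, densityMeasure f (Metric.closedBall (a + r • (y b - y a₀)) (r * η)) := by
      intro a
      symm
      refine Finset.prod_bij (fun b _ => ((e.symm b : S) : Fin n)) (fun b hb => ?_)
        (fun b _ b' _ h => e.symm.injective (Subtype.ext h)) (fun j hj => ?_) fun b hb => ?_
      · refine Finset.mem_erase.2 ⟨fun h => ?_, (e.symm b).2⟩
        exact (Finset.mem_erase.1 hb).1 (e.symm.injective (Subtype.ext h))
      · obtain ⟨h1, h2⟩ := Finset.mem_erase.1 hj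
        refine ⟨e ⟨j, h2⟩, Finset.mem_erase.2 ⟨fun h => h1 ?_, Finset.mem_univ _⟩, by simp⟩
        simp only [i₀, ← h, e.symm_apply_apply]
      · have hτ : τ (e.symm b : S) = y b - y a₀ := by simp [τ]
        simp only [R, hτ]
        rfl
    have hlt : ∀ a, ∏ b ∈ B, densityMeasure f (Metric.closedBall (a + r • (y b - y a₀)) (r * η)) <
        ∞ := fun a => ENNReal.prod_lt_top fun b _ => measure_lt_top (densityMeasure f) _
    rw [measureReal_def]
    refine (congrArg ENNReal.toReal h).trans ?_
    simp_rw [hprod, measureReal_def, ← ENNReal.toReal_prod]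
    exact (integral_toReal (Finset.measurable_prod _ fun b _ =>
      measurable_measure_closedBall_add _ _).aemeasurable
      (Eventually.of_forall hlt)).symm
  calc I / 2 * (η ^ d * unitBallVolume d) ^ (2 * m - 1) * r ^ (d * (2 * m - 1))
      = I / 2 * ((r * η) ^ d * unitBallVolume d) ^ B.card := by
        rw [hBc, mul_pow r η, pow_mul, mul_assoc, ← mul_pow]
        congr 2
        ring
    _ ≤ ν.real Q := by
        rw [hval]
        simp_rw [Finset.prod_div_distrib, Finset.prod_const] at hr1
        rw [integral_div, lt_div_iff₀ (by positivity)] at hr1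
        exact hr1.le
    _ ≤ _ := by
        rw [← integral_indicator_one hQm]
        refine integral_mono ((integrable_const (1 : ℝ)).indicator hQm)
          (integrable_indicator (measurable_crossIndicator r m) (crossIndicator_le r m) S)
          fun x => ?_
        by_cases hx : x ∈ Q
        · rw [Set.indicator_of_mem hx, crossIndicator, if_pos (hQ x hx)]
          simp
        · rw [Set.indicator_of_notMem hx]
          exact Nat.cast_nonneg _

end Density

/-! ### Normal limit of the Poisson distribution and stability under small perturbations. -/

section NormalLimit

-- This is the logarithm of the characteristic function of a normalized Poisson variable. The linear
-- term of the exponential cancels, the quadratic one gives the limit, and the cubic error is at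
-- most `|t| ^ 3 / √l`.
open Complex in
lemma tendsto_poisson_exponent {l : ℕ → ℝ} (hl : Tendsto l atTop atTop) (t : ℝ) :
    Tendsto (fun n => (l n : ℂ) * (cexp ((t / Real.sqrt (l n) : ℝ) * I) - 1) -
      t * Real.sqrt (l n) * I) atTop (𝓝 (-(t : ℂ) ^ 2 / 2)) := by
  rw [tendsto_iff_norm_sub_tendsto_zero]
  have hs : Tendsto (fun n => Real.sqrt (l n)) atTop atTop := Real.tendsto_sqrt_atTop.comp hl
  have hlim : Tendsto (fun n => |t| ^ 3 / Real.sqrt (l n)) atTop (𝓝 0) :=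
    tendsto_const_nhds.div_atTop hs
  refine squeeze_zero' (Eventually.of_forall fun _ => norm_nonneg _) ?_ hlim
  filter_upwards [hs.eventually_ge_atTop (|t| + 1), hl.eventually_gt_atTop 0] with n hn hl0
  set u := Real.sqrt (l n) with hu
  have hu0 : 0 < u := Real.sqrt_pos.2 hl0
  have hlu : l n = u ^ 2 := (Real.sq_sqrt hl0.le).symm
  set z : ℂ := ((t / u : ℝ) : ℂ) * I with hz
  have hznorm : ‖z‖ = |t| / u := by
    rw [hz, norm_mul, norm_I, mul_one, norm_real, Real.norm_eq_abs, abs_div, abs_of_pos hu0]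
  have hz1 : ‖z‖ ≤ 1 := by
    rw [hznorm, div_le_one hu0]; linarith
  have hb := Complex.exp_bound hz1 (n := 3) (by norm_num)
  have hsum : ∑ m ∈ Finset.range 3, z ^ m / (m.factorial : ℂ) = 1 + z + z ^ 2 / 2 := by
    simp [Finset.sum_range_succ]
  rw [hsum] at hb
  have huc : (u : ℂ) ≠ 0 := by exact_mod_cast hu0.ne'
  have hzu : z * u = t * I := by
    rw [hz]; push_cast; field_simp
  have e : (l n : ℂ) * (cexp z - 1) - t * u * I - -(t : ℂ) ^ 2 / 2 =
      (u : ℂ) ^ 2 * (cexp z - (1 + z + z ^ 2 / 2)) := by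
    have h1 : (u : ℂ) ^ 2 * z = t * u * I := by
      rw [show (u : ℂ) ^ 2 * z = u * (z * u) by ring, hzu]; ring
    have h2 : (u : ℂ) ^ 2 * z ^ 2 = - (t : ℂ) ^ 2 := by
      rw [show (u : ℂ) ^ 2 * z ^ 2 = (z * u) ^ 2 by ring, hzu, mul_pow, I_sq]; ring
    rw [hlu]
    push_cast
    linear_combination h1 + h2 / 2
  rw [e, norm_mul, norm_pow, norm_real, Real.norm_eq_abs, abs_of_pos hu0]
  calc u ^ 2 * ‖cexp z - (1 + z + z ^ 2 / 2)‖
      ≤ u ^ 2 * (‖z‖ ^ 3 * 1) := by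
        refine mul_le_mul_of_nonneg_left (hb.trans ?_) (by positivity)
        refine mul_le_mul_of_nonneg_left ?_ (by positivity)
        norm_num [Nat.factorial]
    _ = |t| ^ 3 / u := by rw [hznorm]; field_simp

open Complex in
/-- The normalized Poisson distribution converges to the normal distribution. -/
lemma tendsto_integral_poisson_normalized {l : ℕ → ℝ} (hl : Tendsto l atTop atTop) (t : ℝ) :
    Tendsto (fun n => ∫ j : ℕ, cexp (t * (((j : ℝ) - l n) / Real.sqrt (l n) : ℝ) * I)
      ∂(poissonMeasure (l n).toNNReal)) atTop (𝓝 (cexp (-(t : ℂ) ^ 2 / 2))) := by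
  have h := (Complex.continuous_exp.tendsto _).comp (tendsto_poisson_exponent hl t)
  refine h.congr' ?_
  filter_upwards [hl.eventually_gt_atTop 0] with n hl0
  have hu0 : 0 < Real.sqrt (l n) := Real.sqrt_pos.2 hl0
  have hlu : Real.sqrt (l n) * Real.sqrt (l n) = l n := Real.mul_self_sqrt hl0.le
  have hc := charFun_map_cast_poissonMeasure (l n).toNNReal (t / Real.sqrt (l n))
  rw [charFun_apply_real, integral_map .of_discrete
    (by fun_prop : Measurable _).aestronglyMeasurable] at hc
  have hcoe : (((l n).toNNReal : ℝ) : ℂ) = (l n : ℂ) := by rw [Real.coe_toNNReal _ hl0.le]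
  have hcoe' : (((l n).toNNReal : ℝ≥0) : ℂ) = (l n : ℂ) := hcoe
  rw [Function.comp_apply, sub_eq_add_neg, Complex.exp_add, ← hcoe', ← hc, ← integral_mul_const]
  refine integral_congr_ae (Eventually.of_forall fun j => ?_)
  dsimp only
  rw [← Complex.exp_add]
  congr 1
  have huc : (Real.sqrt (l n) : ℂ) ≠ 0 := by exact_mod_cast hu0.ne'
  have hluc : (Real.sqrt (l n) : ℂ) * Real.sqrt (l n) = l n := by exact_mod_cast hlu
  push_cast
  rw [← hluc]
  field_simp
  ring

/-- The Poisson bounds are for real test functions, characteristic functions are complex. Real and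
imaginary part are treated separately, at the cost of a factor 2. -/
lemma norm_integral_sub_le_of_forall_real {Ω : Type*} [MeasurableSpace Ω] {P : Measure Ω}
    [IsProbabilityMeasure P] {Q : Measure ℕ} [IsProbabilityMeasure Q] {W : Ω → ℕ}
    (hW : Measurable W) {B : ℝ}
    (h : ∀ g : ℕ → ℝ, (∀ n, |g n| ≤ 1) → |∫ ω, g (W ω) ∂P - ∫ n, g n ∂Q| ≤ B)
    {F : ℕ → ℂ} (hF : ∀ n, ‖F n‖ ≤ 1) :
    ‖∫ ω, F (W ω) ∂P - ∫ n, F n ∂Q‖ ≤ 2 * B := by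
  have hi1 : Integrable (fun ω => F (W ω)) P :=
    Integrable.of_bound ((measurable_from_nat (f := F)).comp hW).aestronglyMeasurable 1
      (Eventually.of_forall fun ω => hF _)
  have hi2 : Integrable F Q := Integrable.of_bound .of_discrete 1 (Eventually.of_forall hF)
  refine (Complex.norm_le_abs_re_add_abs_im _).trans ?_
  rw [two_mul]
  have r1 : (∫ ω, F (W ω) ∂P).re = ∫ ω, (F (W ω)).re ∂P :=
    (Complex.reCLM.integral_comp_comm hi1).symm
  have r2 : (∫ n, F n ∂Q).re = ∫ n, (F n).re ∂Q := (Complex.reCLM.integral_comp_comm hi2).symm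
  have i1 : (∫ ω, F (W ω) ∂P).im = ∫ ω, (F (W ω)).im ∂P :=
    (Complex.imCLM.integral_comp_comm hi1).symm
  have i2 : (∫ n, F n ∂Q).im = ∫ n, (F n).im ∂Q := (Complex.imCLM.integral_comp_comm hi2).symm
  rw [Complex.sub_re, Complex.sub_im, r1, r2, i1, i2]
  exact add_le_add (h (fun n => (F n).re) fun n => (Complex.abs_re_le_norm _).trans (hF n))
    (h (fun n => (F n).im) fun n => (Complex.abs_im_le_norm _).trans (hF n))

lemma integral_abs_sub_le_sqrt_variance {Ω : Type*} [MeasurableSpace Ω] {P : Measure Ω}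
    [IsProbabilityMeasure P] {X : Ω → ℝ} (hX : MemLp X 2 P) :
    ∫ ω, |X ω - ∫ ω', X ω' ∂P| ∂P ≤ Real.sqrt (variance X P) := by
  apply Real.le_sqrt_of_sq_le
  have hu : MemLp (fun ω => |X ω - ∫ ω', X ω' ∂P|) 2 P := (hX.sub (memLp_const _)).abs
  have h := variance_nonneg (fun ω => |X ω - ∫ ω', X ω' ∂P|) P
  rw [variance_eq_sub hu] at h
  rw [variance_eq_integral hX.aestronglyMeasurable.aemeasurable]
  simpa using h

lemma covariance_sq_le {Ω : Type*} [MeasurableSpace Ω] {P : Measure Ω} [IsProbabilityMeasure P]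
    {X Y : Ω → ℝ} (hX : MemLp X 2 P) (hY : MemLp Y 2 P) :
    covariance X Y P ^ 2 ≤ variance X P * variance Y P := by
  have h : ∀ t : ℝ, 0 ≤ variance Y P * (t * t) + 2 * covariance X Y P * t + variance X P := by
    intro t
    have := variance_nonneg (X + t • Y) P
    rw [variance_add hX (hY.const_smul t), variance_smul, covariance_smul_right] at this
    nlinarith
  have := discrim_le_zero h
  rw [discrim] at this
  nlinarith

open Complex in
/-- If the variable `W` satisfies a central limit theorem with variance asymptotic to `l` then so
does every variable `Y` for which the variance of `Y - W` is of smaller order. -/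
theorem tendsto_charFun_of_variance_sub {Ω : ℕ → Type*} [∀ n, MeasurableSpace (Ω n)]
    {P : (n : ℕ) → Measure (Ω n)} [∀ n, IsProbabilityMeasure (P n)] {Y W : (n : ℕ) → Ω n → ℝ}
    (hY : ∀ n, MemLp (Y n) 2 (P n)) (hW : ∀ n, MemLp (W n) 2 (P n)) {l : ℕ → ℝ}
    (hl : Tendsto l atTop atTop) (hmean : ∀ n, ∫ ω, W n ω ∂(P n) = l n)
    (hWvar : Tendsto (fun n => variance (W n) (P n) / l n) atTop (𝓝 1))
    (hRvar : Tendsto (fun n => variance (Y n - W n) (P n) / l n) atTop (𝓝 0))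
    {t : ℝ} {c : ℂ}
    (hchar : Tendsto (fun n => ∫ ω, cexp (t * ((W n ω - l n) / Real.sqrt (l n) : ℝ) * I) ∂(P n))
      atTop (𝓝 c)) :
    Tendsto (fun n => ∫ ω, cexp (t * ((Y n ω - ∫ ω', Y n ω' ∂(P n)) /
      Real.sqrt (variance (Y n) (P n)) : ℝ) * I) ∂(P n)) atTop (𝓝 c) := by
  have hR : ∀ n, MemLp (Y n - W n) 2 (P n) := fun n => (hY n).sub (hW n)
  have hYvar : Tendsto (fun n => variance (Y n) (P n) / l n) atTop (𝓝 1) := by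
    -- By Cauchy–Schwarz the covariance is also of smaller order than `l`, so the variances of `Y`
    -- and `W` are asymptotic.
    have hcov : Tendsto (fun n => covariance (W n) (Y n - W n) (P n) / l n) atTop (𝓝 0) := by
      have hlim : Tendsto (fun n => Real.sqrt (variance (W n) (P n) / l n *
          (variance (Y n - W n) (P n) / l n))) atTop (𝓝 0) := by
        have := (hWvar.mul hRvar).sqrt
        rwa [mul_zero, Real.sqrt_zero] at this
      refine squeeze_zero_norm' ?_ hlim
      filter_upwards [hl.eventually_gt_atTop 0] with n hl0
      rw [Real.norm_eq_abs]
      apply Real.abs_le_sqrt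
      rw [div_pow, div_mul_div_comm, ← sq]
      gcongr
      exact covariance_sq_le (hW n) (hR n)
    have h := (hWvar.add (hcov.const_mul 2)).add hRvar
    simp only [mul_zero, add_zero] at h
    refine h.congr fun n => ?_
    have : Y n = W n + (Y n - W n) := by abel
    conv_rhs => rw [this, variance_add (hW n) (hR n)]
    ring
  have hratio : Tendsto (fun n => Real.sqrt (variance (Y n) (P n) / l n)) atTop (𝓝 1) := by
    have := hYvar.sqrt
    rwa [Real.sqrt_one] at this
  have hratioR : Tendsto (fun n => Real.sqrt (variance (Y n - W n) (P n) / l n)) atTop (𝓝 0) := by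
    have := hRvar.sqrt
    rwa [Real.sqrt_zero] at this
  have hbound : Tendsto (fun n => |t| * (|1 - Real.sqrt (variance (Y n) (P n) / l n)| +
      Real.sqrt (variance (Y n - W n) (P n) / l n))) atTop (𝓝 0) := by
    have := (((hratio.const_sub 1).abs).add hratioR).const_mul |t|
    simpa using this
  have hdiff : Tendsto (fun n => (∫ ω, cexp (t * ((Y n ω - ∫ ω', Y n ω' ∂(P n)) /
      Real.sqrt (variance (Y n) (P n)) : ℝ) * I) ∂(P n)) -
      ∫ ω, cexp (t * ((W n ω - l n) / Real.sqrt (l n) : ℝ) * I) ∂(P n)) atTop (𝓝 0) := by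
    refine squeeze_zero_norm' ?_ hbound
    filter_upwards [hl.eventually_gt_atTop 0, hYvar.eventually_const_lt zero_lt_one] with n hl0 hv
    have hv0 : 0 < variance (Y n) (P n) := by
      rcases (div_pos_iff.1 hv) with h | h
      · exact h.1
      · exact absurd h.2 (not_lt.2 hl0.le)
    set s := Real.sqrt (variance (Y n) (P n)) with hs
    set u := Real.sqrt (l n) with hu
    have hs0 : 0 < s := Real.sqrt_pos.2 hv0
    have hu0 : 0 < u := Real.sqrt_pos.2 hl0
    set EY := ∫ ω', Y n ω' ∂(P n) with hEY
    have hER : ∫ ω, (Y n - W n) ω ∂(P n) = EY - l n := by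
      rw [← hmean n]
      exact integral_sub ((hY n).integrable (by norm_num)) ((hW n).integrable (by norm_num))
    have hYi : Integrable (fun ω => |Y n ω - EY|) (P n) :=
      (((hY n).integrable (by norm_num)).sub (integrable_const _)).abs
    have hRi : Integrable (fun ω => |(Y n - W n) ω - (EY - l n)|) (P n) :=
      (((hR n).integrable (by norm_num)).sub (integrable_const _)).abs
    have hexp : ∀ a b : ℝ, ‖cexp (t * a * I) - cexp (t * b * I)‖ ≤ |t| * |a - b| := by
      intro a b
      have e : cexp (t * a * I) - cexp (t * b * I) =
          cexp ((t * b : ℝ) * I) * (cexp (I * (t * (a - b) : ℝ)) - 1) := by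
        rw [mul_sub, ← Complex.exp_add, mul_one]
        congr 2
        · push_cast; ring
        · push_cast; ring
      rw [e, norm_mul, norm_exp_ofReal_mul_I, one_mul]
      refine Real.norm_exp_I_mul_ofReal_sub_one_le.trans (le_of_eq ?_)
      rw [Real.norm_eq_abs, abs_mul]
    have hint : ∀ {X : Ω n → ℝ}, AEStronglyMeasurable X (P n) →
        Integrable (fun ω => cexp (t * (X ω : ℝ) * I)) (P n) := by
      intro X hX
      refine Integrable.of_bound (C := 1) ?_ (Eventually.of_forall fun ω => ?_)
      · exact (by fun_prop : Continuous fun x : ℝ => cexp (t * (x : ℝ) * I)).comp_aestronglyMeasurable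
          hX
      · rw [← ofReal_mul, norm_exp_ofReal_mul_I]
    rw [← integral_sub
      (hint (((hY n).aestronglyMeasurable.aemeasurable.sub_const _).div_const
        _).aestronglyMeasurable)
      (hint (((hW n).aestronglyMeasurable.aemeasurable.sub_const _).div_const
        _).aestronglyMeasurable)]
    refine (norm_integral_le_of_norm_le
      (g := fun ω => |t| * (|Y n ω - EY| * |1 / s - 1 / u| +
        |(Y n - W n) ω - (EY - l n)| * (1 / u)))
      (((hYi.mul_const _).add (hRi.mul_const _)).const_mul _)
      (Eventually.of_forall fun ω => ?_)).trans ?_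
    · refine (hexp _ _).trans (mul_le_mul_of_nonneg_left ?_ (abs_nonneg t))
      -- One term accounts for the change of normalization, the other for the centred difference `Y
      -- - W`. Their means in absolute value are bounded by standard deviations.
      have e : (Y n ω - EY) / s - (W n ω - l n) / u =
          (Y n ω - EY) * (1 / s - 1 / u) + ((Y n - W n) ω - (EY - l n)) * (1 / u) := by
        simp only [Pi.sub_apply]
        ring
      rw [e]
      refine (abs_add_le _ _).trans (le_of_eq ?_)
      rw [abs_mul, abs_mul, abs_of_pos (by positivity : 0 < 1 / u)]
    · rw [integral_const_mul, integral_add (hYi.mul_const _) (hRi.mul_const _),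
        integral_mul_const, integral_mul_const]
      refine mul_le_mul_of_nonneg_left (add_le_add ?_ ?_) (abs_nonneg t)
      · calc (∫ ω, |Y n ω - EY| ∂(P n)) * |1 / s - 1 / u| ≤ s * |1 / s - 1 / u| :=
              mul_le_mul_of_nonneg_right (integral_abs_sub_le_sqrt_variance (hY n)) (abs_nonneg _)
          _ = |1 - Real.sqrt (variance (Y n) (P n) / l n)| := by
              rw [Real.sqrt_div hv0.le, ← hs, ← hu, ← abs_of_pos hs0, ← abs_mul, abs_of_pos hs0]
              congr 1
              field_simp
      · have := integral_abs_sub_le_sqrt_variance (hR n)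
        rw [hER] at this
        rw [Real.sqrt_div (variance_nonneg _ _), ← hu, mul_one_div]
        gcongr
  have := hdiff.add hchar
  simpa using this

end NormalLimit

/-! ### Asymptotics in the sparse regime: moments of the remainder and mean of the count. -/

section Asymptotics

/-- The margin `ε` in the radius turns into polynomial decay of `n * r n ^ d`. -/
lemma exists_pow_le_of_isBigO {d : ℕ} (hd : d ≠ 0) {ε : ℝ} {r : ℕ → ℝ} (hr_pos : ∀ n, 0 < r n)
    (hr : r =O[atTop] fun n : ℕ => (n : ℝ) ^ (-(1 / (d : ℝ)) - ε)) :
    ∃ K : ℝ, ∀ᶠ n : ℕ in atTop, n * r n ^ d ≤ K * (n : ℝ) ^ (-(d * ε)) := by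
  obtain ⟨K, -, hK⟩ := hr.exists_pos
  refine ⟨K ^ d, ?_⟩
  filter_upwards [hK.bound, eventually_gt_atTop 0] with n hn hn0
  have hn0' : (0 : ℝ) < n := by exact_mod_cast hn0
  have hd' : (d : ℝ) ≠ 0 := by exact_mod_cast hd
  rw [Real.norm_of_nonneg (hr_pos n).le, Real.norm_of_nonneg (by positivity)] at hn
  calc n * r n ^ d ≤ n * (K * (n : ℝ) ^ (-(1 / (d : ℝ)) - ε)) ^ d := by
        have := (hr_pos n).le
        gcongr
    _ = K ^ d * ((n : ℝ) ^ (1 : ℝ) * (n : ℝ) ^ ((-(1 / (d : ℝ)) - ε) * d)) := by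
        rw [Real.rpow_mul hn0'.le, Real.rpow_natCast, Real.rpow_one, mul_pow]
        ring
    _ = _ := by
        rw [← Real.rpow_add hn0']
        congr 2
        field_simp
        ring

lemma tendsto_pow_mul_pow_of_le_rpow {δ K : ℝ} {ν : ℕ → ℝ} (hν0 : ∀ n, 0 ≤ ν n)
    (hν : ∀ᶠ n : ℕ in atTop, ν n ≤ K * (n : ℝ) ^ (-δ)) {N j : ℕ} (hN : (N : ℝ) < δ * j) :
    Tendsto (fun n : ℕ => (n : ℝ) ^ N * ν n ^ j) atTop (𝓝 0) := by
  have hlim : Tendsto (fun n : ℕ => K ^ j * (n : ℝ) ^ (-(δ * j - N))) atTop (𝓝 0) := by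
    have := ((tendsto_rpow_neg_atTop (sub_pos.2 hN)).comp tendsto_natCast_atTop_atTop).const_mul
      (K ^ j)
    simpa using this
  refine squeeze_zero' (Eventually.of_forall fun n => ?_) ?_ hlim
  · have := hν0 n
    positivity
  · filter_upwards [hν, eventually_gt_atTop 0] with n hn hn0
    have hn0' : (0 : ℝ) < n := by exact_mod_cast hn0
    calc (n : ℝ) ^ N * ν n ^ j ≤ (n : ℝ) ^ N * (K * (n : ℝ) ^ (-δ)) ^ j := by
          have := hν0 n
          gcongr
      _ = K ^ j * ((n : ℝ) ^ (N : ℝ) * (n : ℝ) ^ ((-δ) * j)) := by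
          rw [Real.rpow_mul hn0'.le, Real.rpow_natCast, Real.rpow_natCast, mul_pow]
          ring
      _ = _ := by
          rw [← Real.rpow_add hn0']
          congr 2
          ring

lemma tendsto_radius_of_isBigO {d : ℕ} {ε : ℝ} (hε : 0 < ε) {r : ℕ → ℝ} (hr_pos : ∀ n, 0 < r n)
    (hr : r =O[atTop] fun n : ℕ => (n : ℝ) ^ (-(1 / (d : ℝ)) - ε)) :
    Tendsto r atTop (𝓝[>] 0) := by
  refine tendsto_nhdsWithin_iff.2 ⟨hr.trans_tendsto ?_, Eventually.of_forall hr_pos⟩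
  have hδ : 0 < 1 / (d : ℝ) + ε := by positivity
  refine ((tendsto_rpow_neg_atTop hδ).comp tendsto_natCast_atTop_atTop).congr fun n => ?_
  simp only [Function.comp_apply]
  congr 1
  ring

variable {d m : ℕ} {μ : Measure (EuclideanSpace ℝ (Fin d))} [IsProbabilityMeasure μ]

/-- In the sparse regime the moments of the component weights are governed by the components with
`2 m + 1` vertices. -/
lemma eventually_integral_componentWeight_pow_le {A : ℝ} (hA : HasBallBound μ A) {r : ℕ → ℝ}
    (hr : ∀ n, 0 < r n) (hν : Tendsto (fun n : ℕ => n * r n ^ d) atTop (𝓝 0))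
    (hdecay : ∀ N : ℕ, ∃ j : ℕ, Tendsto (fun n : ℕ => (n : ℝ) ^ N * (n * r n ^ d) ^ j) atTop (𝓝 0))
    {p : ℕ} (hp : p ≠ 0) :
    ∀ᶠ n : ℕ in atTop, ∀ i, ∫ x, componentWeight m (componentOf (geometricGraph x (r n)) i).card ^ p
        ∂(Measure.pi fun _ : Fin n => μ) ≤
      (((2 * m + 1 : ℝ) ^ (2 * m)) ^ p * tailConst A d (2 * m) + 1) * (n * r n ^ d) ^ (2 * m) := by
  -- `n ^ (2 * m * p)` is the loss from the trivial bound for very large components; `j` is chosen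
  -- so that the decay beats it.
  obtain ⟨j, hj⟩ := hdecay (2 * m * p)
  set ν : ℕ → ℝ := fun n => n * r n ^ d with hνdef
  set a : ℕ → ℝ := fun s => (((2 * m + s : ℕ) + 1 : ℝ) ^ (2 * m)) ^ p * tailConst A d (2 * m + s)
    with ha
  -- With `ν ^ (2 * m)` factored out, the bound is a polynomial in `ν` plus a vanishing tail, so it
  -- tends to its constant term `a 0`. The `+ 1` in the claim is slack for this limit.
  have hsum : Tendsto (fun n => ∑ s ∈ Finset.range (j + 1), a s * ν n ^ s +
      tailConst A d (2 * m + (j + 1)) * ν n * ((n : ℝ) ^ (2 * m * p) * ν n ^ j)) atTop (𝓝 (a 0)) := by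
    have h1 : Tendsto (fun n => ∑ s ∈ Finset.range (j + 1), a s * ν n ^ s) atTop
        (𝓝 (∑ s ∈ Finset.range (j + 1), a s * 0 ^ s)) :=
      tendsto_finsetSum _ fun s _ => (hν.pow s).const_mul _
    have h2 := (hν.const_mul (tailConst A d (2 * m + (j + 1)))).mul hj
    have h3 := h1.add h2
    simp only [Finset.sum_range_succ', pow_zero, mul_one, mul_zero, add_zero, pow_succ,
      Finset.sum_const_zero, zero_add] at h3
    simpa only [Finset.sum_range_succ', pow_zero, mul_one, pow_succ] using h3
  filter_upwards [hsum.eventually_lt_const (lt_add_one (a 0))] with n hn i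
  have hν0 : 0 ≤ ν n := mul_nonneg (Nat.cast_nonneg _) (pow_nonneg (hr n).le _)
  refine (integral_componentWeight_pow_le hA (hr n).le i m (J := 2 * m + (j + 1)) hp).trans ?_
  rw [Finset.sum_Ico_eq_sum_range, Nat.add_sub_cancel_left]
  have ha0 : a 0 = ((2 * m + 1 : ℝ) ^ (2 * m)) ^ p * tailConst A d (2 * m) := by
    simp [ha]
  rw [← ha0]
  refine le_trans (le_of_eq ?_) (mul_le_mul_of_nonneg_right hn.le (pow_nonneg hν0 (2 * m)))
  rw [add_mul, Finset.sum_mul]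
  congr 1
  · refine Finset.sum_congr rfl fun s _ => ?_
    simp only [ha, hνdef]
    rw [pow_add]
    ring
  · simp only [hνdef]
    rw [pow_add _ (2 * m), pow_succ, pow_mul]
    ring

variable {n : ℕ}

lemma measurable_bettiRemainder (r : ℝ) (m : ℕ) :
    Measurable fun x : Fin n → EuclideanSpace ℝ (Fin d) =>
      bettiRemainder (geometricGraph x r) Finset.univ m :=
  measurable_comp_geometricGraph r fun G => bettiRemainder G Finset.univ m

lemma abs_bettiRemainder_le_card (G : SimpleGraph (Fin n)) (m : ℕ) :
    |bettiRemainder G Finset.univ m| ≤ componentWeight m n := by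
  simpa using abs_bettiRemainder_le G Finset.univ m

lemma integrable_componentWeight_pow (r : ℝ) (i : Fin n) (m p : ℕ) :
    Integrable (fun x => componentWeight m (componentOf (geometricGraph x r) i).card ^ p)
      (Measure.pi fun _ : Fin n => μ) :=
  integrable_comp_of_le (U := fun x => (componentOf (geometricGraph x r) i).card)
    (measurable_comp_geometricGraph r fun G => (componentOf G i).card) (N := n)
    (fun x => by simpa using Finset.card_le_univ (componentOf (geometricGraph x r) i))
    fun c => componentWeight m c ^ p

lemma integral_abs_bettiRemainder_le (hm : 2 ≤ m) {r B : ℝ}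
    (hB : ∀ i, ∫ x, componentWeight m (componentOf (geometricGraph x r) i).card ^ 1
      ∂(Measure.pi fun _ : Fin n => μ) ≤ B) :
    ∫ x, |bettiRemainder (geometricGraph x r) Finset.univ m| ∂(Measure.pi fun _ : Fin n => μ) ≤
      2 * (n * B) := by
  have hi : ∀ i : Fin n, Integrable (fun x =>
      2 * componentWeight m (componentOf (geometricGraph x r) i).card)
      (Measure.pi fun _ : Fin n => μ) := fun i => by
    simpa using (integrable_componentWeight_pow (μ := μ) r i m 1).const_mul 2
  calc _ ≤ ∫ x, ∑ i, 2 * componentWeight m (componentOf (geometricGraph x r) i).card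
        ∂(Measure.pi fun _ : Fin n => μ) :=
        integral_mono (integrable_of_abs_le (measurable_bettiRemainder r m)
          fun x => abs_bettiRemainder_le_card _ m).abs (integrable_finsetSum _ fun i _ => hi i)
          fun x => abs_bettiRemainder_le_sum _ hm
    _ = ∑ i, 2 * ∫ x, componentWeight m (componentOf (geometricGraph x r) i).card ^ 1
        ∂(Measure.pi fun _ : Fin n => μ) := by
        rw [integral_finsetSum _ fun i _ => hi i]
        simp_rw [integral_const_mul, pow_one]
    _ ≤ ∑ _i : Fin n, 2 * B := Finset.sum_le_sum fun i _ => by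
        have := hB i
        linarith
    _ = _ := by simp; ring

lemma isolate_geometricGraph_congr {x y : Fin n → EuclideanSpace ℝ (Fin d)} {i : Fin n}
    (h : ∀ j, j ≠ i → x j = y j) (r : ℝ) :
    isolate (geometricGraph x r) {i} = isolate (geometricGraph y r) {i} := by
  ext u v
  simp only [isolate, geometricGraph_adj, Finset.mem_singleton]
  constructor <;> rintro ⟨⟨h1, h2⟩, hu, hv⟩
  · exact ⟨⟨h1, by rwa [← h u hu, ← h v hv]⟩, hu, hv⟩
  · exact ⟨⟨h1, by rwa [h u hu, h v hv]⟩, hu, hv⟩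

/-- Efron–Stein, with the `i`-th point isolated as comparison, bounds the variance by a sum of only
`n` local second moments. The second moment of the sum of the weights would bring in all pairs of
points. -/
lemma variance_bettiRemainder_le (hm : 2 ≤ m) {r B : ℝ}
    (hB : ∀ i, ∫ x, componentWeight m (componentOf (geometricGraph x r) i).card ^ 2
      ∂(Measure.pi fun _ : Fin n => μ) ≤ B) :
    variance (fun x => bettiRemainder (geometricGraph x r) Finset.univ m)
      (Measure.pi fun _ : Fin n => μ) ≤ 4 * (n * B) := by
  have hF := measurable_bettiRemainder (d := d) (n := n) r m
  have hF' : ∀ i, Measurable fun x : Fin n → EuclideanSpace ℝ (Fin d) =>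
      bettiRemainder (isolate (geometricGraph x r) {i}) Finset.univ m := fun i =>
    measurable_comp_geometricGraph r fun G => bettiRemainder (isolate G {i}) Finset.univ m
  rw [variance_eq_sub (MemLp.of_bound hF.aestronglyMeasurable (componentWeight m n)
    (Eventually.of_forall fun x => abs_bettiRemainder_le_card _ m))]
  refine (variance_pi_le_sum n hF (fun x => abs_bettiRemainder_le_card _ m) hF'
    (fun i x => abs_bettiRemainder_le_card _ m)
    fun i x y h => by rw [isolate_geometricGraph_congr h r]).trans ?_
  calc _ ≤ ∑ i : Fin n, 4 * ∫ x, componentWeight m (componentOf (geometricGraph x r) i).card ^ 2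
        ∂(Measure.pi fun _ : Fin n => μ) := Finset.sum_le_sum fun i _ => by
        rw [← integral_const_mul]
        refine integral_mono ?_ ((integrable_componentWeight_pow r i m 2).const_mul 4) fun x => ?_
        · refine integrable_of_abs_le ((hF.sub (hF' i)).pow_const 2)
            (B := (componentWeight m n + componentWeight m n) ^ 2) fun x => ?_
          rw [abs_pow]
          exact pow_le_pow_left₀ (abs_nonneg _) ((abs_sub _ _).trans (add_le_add
            (abs_bettiRemainder_le_card _ m) (abs_bettiRemainder_le_card _ m))) 2
        · have h := abs_bettiRemainder_sub_isolate_le (geometricGraph x r) i hm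
          have h2 := pow_le_pow_left₀ (abs_nonneg _) h 2
          rw [sq_abs, mul_pow] at h2
          norm_num at h2
          exact h2
    _ ≤ ∑ _i : Fin n, 4 * B := Finset.sum_le_sum fun i _ => by
        have := hB i
        linarith
    _ = _ := by simp; ring

lemma integral_crossPolytopeCount (r : ℝ) (m : ℕ) :
    ∫ x, (crossPolytopeCount (geometricGraph x r) Finset.univ m : ℝ)
      ∂(Measure.pi fun _ : Fin n => μ) =
    ∑ S ∈ (Finset.univ : Finset (Fin n)).powersetCard (2 * m),
      ∫ x, (crossIndicator r m S x : ℝ) ∂(Measure.pi fun _ : Fin n => μ) := by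
  simp_rw [crossPolytopeCount_eq_sum, Nat.cast_sum]
  exact integral_finsetSum _ fun S _ =>
    integrable_indicator (measurable_crossIndicator r m) (crossIndicator_le r m) S

lemma integral_crossPolytopeCount_le {A : ℝ} (hA : HasBallBound μ A) {r : ℝ} (hr : 0 ≤ r)
    (hm : 2 ≤ m) :
    ∫ x, (crossPolytopeCount (geometricGraph x r) Finset.univ m : ℝ)
      ∂(Measure.pi fun _ : Fin n => μ) ≤ n ^ (2 * m) * (A * (4 * r) ^ d) ^ (2 * m - 1) := by
  rw [integral_crossPolytopeCount]
  refine (Finset.sum_le_card_nsmul _ _ _ fun S hS => integral_crossIndicator_le hA hr hm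
    (Finset.mem_powersetCard.1 hS).2).trans ?_
  rw [nsmul_eq_mul, Finset.card_powersetCard, Finset.card_univ, Fintype.card_fin]
  have := hA.1
  refine mul_le_mul_of_nonneg_right ?_ (by positivity)
  exact_mod_cast Nat.choose_le_pow n (2 * m)

lemma le_integral_crossPolytopeCount {r b : ℝ} (hb : 0 ≤ b) (hn : 4 * m ≤ n)
    (h : ∀ S : Finset (Fin n), S.card = 2 * m →
      b ≤ ∫ x, (crossIndicator r m S x : ℝ) ∂(Measure.pi fun _ : Fin n => μ)) :
    (n / 2 : ℝ) ^ (2 * m) / (2 * m).factorial * b ≤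
      ∫ x, (crossPolytopeCount (geometricGraph x r) Finset.univ m : ℝ)
        ∂(Measure.pi fun _ : Fin n => μ) := by
  rw [integral_crossPolytopeCount]
  refine le_trans ?_ (Finset.card_nsmul_le_sum _ _ _ fun S hS =>
    h S (Finset.mem_powersetCard.1 hS).2)
  rw [nsmul_eq_mul, Finset.card_powersetCard, Finset.card_univ, Fintype.card_fin]
  refine mul_le_mul_of_nonneg_right ?_ hb
  -- For `4 * m ≤ n` each factor in this lower bound for the binomial coefficient is at least `n /
  -- 2`.
  refine le_trans ?_ (Nat.pow_le_choose (2 * m) n)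
  gcongr
  rw [Nat.cast_sub (by omega)]
  have : (4 * m : ℝ) ≤ n := by exact_mod_cast hn
  push_cast
  linarith

end Asymptotics

/-! ### The three regimes for points on the product space. -/

section SparseRegime

variable {d m n : ℕ} {μ : Measure (EuclideanSpace ℝ (Fin d))}

/-- The estimates for `n` random points in the sparse regime: those for the cross-polytopes are in
terms of `n ^ (2 m) r ^ (d (2 m - 1))`, and all errors are smaller by the factor `n r ^ d`. -/
structure SparseBounds (μ : Measure (EuclideanSpace ℝ (Fin d))) (m n : ℕ) (r C c : ℝ) : Prop where
  integral_remainder_le :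
    ∫ x, |bettiRemainder (geometricGraph x r) Finset.univ m| ∂(Measure.pi fun _ : Fin n => μ) ≤
      C * ((n : ℝ) ^ (2 * m) * r ^ (d * (2 * m - 1)) * (n * r ^ d))
  variance_remainder_le :
    variance (fun x => bettiRemainder (geometricGraph x r) Finset.univ m)
      (Measure.pi fun _ : Fin n => μ) ≤
      C * ((n : ℝ) ^ (2 * m) * r ^ (d * (2 * m - 1)) * (n * r ^ d))
  dependencyError_le :
    dependencyError (Measure.pi fun _ : Fin n => μ) (Finset.univ.powersetCard (2 * m))
      (crossIndicator r m) Overlap ≤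
      C * ((n : ℝ) ^ (2 * m) * r ^ (d * (2 * m - 1)) * (n * r ^ d))
  le_mean : c * ((n : ℝ) ^ (2 * m) * r ^ (d * (2 * m - 1))) ≤
    ∫ x, (crossPolytopeCount (geometricGraph x r) Finset.univ m : ℝ)
      ∂(Measure.pi fun _ : Fin n => μ)
  mean_le : ∫ x, (crossPolytopeCount (geometricGraph x r) Finset.univ m : ℝ)
      ∂(Measure.pi fun _ : Fin n => μ) ≤ C * ((n : ℝ) ^ (2 * m) * r ^ (d * (2 * m - 1)))

/-- The order of quantifiers matters: the constants come from the density, `d` and `m` alone, while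
the index from which the estimates hold may depend on `ε` and the radii. -/
theorem exists_sparseBounds {f : EuclideanSpace ℝ (Fin d) → ℝ} (hd : 2 ≤ d) (hm : 2 ≤ m)
    (hf_meas : Measurable f) (hf0 : ∀ x, 0 ≤ f x) (hf_int : ∫ x, f x = 1)
    (hf_bdd : ∃ M : ℝ, ∀ x, f x ≤ M) :
    ∃ C c : ℝ, 0 < C ∧ 0 < c ∧ ∀ (ε : ℝ), 0 < ε → ∀ r : ℕ → ℝ, (∀ n, 0 < r n) →
      (r =O[atTop] fun n : ℕ => (n : ℝ) ^ (-(1 / (d : ℝ)) - ε)) →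
      Tendsto (fun n : ℕ => n * r n ^ d) atTop (𝓝 0) ∧
      ∀ᶠ n : ℕ in atTop, SparseBounds (densityMeasure f) m n (r n) C c := by
  obtain ⟨M, hM⟩ := hf_bdd
  have hprob := isProbabilityMeasure_densityMeasure hf0 hf_int
  have hA := hasBallBound_densityMeasure hf0 hf_int hM
  obtain ⟨c₀, hc₀, hlow⟩ := exists_le_integral_crossIndicator hd (by omega : 1 ≤ m) hf_meas hf0
    hf_int hM
  set A := M * unitBallVolume d
  have hA0 : 0 ≤ A := hA.1
  have hT := tailConst_nonneg hA0 d (2 * m)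
  set a : ℕ → ℝ := fun p => ((2 * m + 1 : ℝ) ^ (2 * m)) ^ p * tailConst A d (2 * m) + 1 with ha
  have ha0 : ∀ p, 0 < a p := fun p => by positivity
  set C₁ := 2 * a 1
  set C₂ := 4 * a 2
  set C₃ : ℝ := 2 ^ (2 * m) * (4 * m) * (A * 4 ^ d) ^ (2 * m)
  set C₄ : ℝ := (A * 4 ^ d) ^ (2 * m - 1)
  have hC₁ : 0 < C₁ := mul_pos two_pos (ha0 1)
  have hC₂ : 0 < C₂ := mul_pos four_pos (ha0 2)
  have hC₃ : 0 ≤ C₃ := by positivity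
  have hC₄ : 0 ≤ C₄ := by positivity
  refine ⟨C₁ + C₂ + C₃ + C₄, (1 / 2 : ℝ) ^ (2 * m) / (2 * m).factorial * c₀, by positivity,
    by positivity, fun ε hε r hr hrO => ?_⟩
  have hd0 : (0 : ℝ) < d := by exact_mod_cast (by omega : 0 < d)
  obtain ⟨K, hK⟩ := exists_pow_le_of_isBigO (by omega : d ≠ 0) hr hrO
  have hν0 : ∀ n : ℕ, 0 ≤ n * r n ^ d := fun n =>
    mul_nonneg (Nat.cast_nonneg _) (pow_nonneg (hr n).le _)
  have hdecay : ∀ N : ℕ, ∃ j : ℕ,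
      Tendsto (fun n : ℕ => (n : ℝ) ^ N * (n * r n ^ d) ^ j) atTop (𝓝 0) := fun N => by
    -- Any `j` with `N < d * ε * j` works, since `n * r n ^ d` decays at least like `n ^ (-(d *
    -- ε))`.
    obtain ⟨j, hj⟩ := exists_nat_gt ((N : ℝ) / (d * ε))
    rw [div_lt_iff₀' (by positivity)] at hj
    exact ⟨j, tendsto_pow_mul_pow_of_le_rpow hν0 hK hj⟩
  have hν : Tendsto (fun n : ℕ => n * r n ^ d) atTop (𝓝 0) := by
    have := tendsto_pow_mul_pow_of_le_rpow (N := 0) (j := 1) hν0 hK (by simp; positivity)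
    simpa using this
  refine ⟨hν, ?_⟩
  have hνA : Tendsto (fun n : ℕ => n * (A * (4 * r n) ^ d)) atTop (𝓝 0) := by
    have := hν.const_mul (A * 4 ^ d)
    rw [mul_zero] at this
    refine this.congr fun n => ?_
    ring
  filter_upwards [eventually_integral_componentWeight_pow_le (m := m) hA hr hν hdecay one_ne_zero,
    eventually_integral_componentWeight_pow_le (m := m) hA hr hν hdecay two_ne_zero,
    (tendsto_radius_of_isBigO hε hr hrO).eventually hlow, eventually_ge_atTop (4 * m),
    hνA.eventually_lt_const one_pos] with n h1 h2 hlown hn hnq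
  have hrn := hr n
  -- All errors arise in the form on the left; the right side exhibits them as the order of the mean
  -- times `n * r n ^ d`.
  have hMν : n * (n * r n ^ d) ^ (2 * m) =
      (n : ℝ) ^ (2 * m) * r n ^ (d * (2 * m - 1)) * (n * r n ^ d) := by
    obtain ⟨q, hq⟩ : ∃ q, 2 * m = q + 1 := ⟨2 * m - 1, by omega⟩
    rw [hq, Nat.add_sub_cancel, mul_pow, ← pow_mul, mul_add, pow_add (r n)]
    ring
  have hX0 : 0 ≤ (n : ℝ) ^ (2 * m) * r n ^ (d * (2 * m - 1)) * (n * r n ^ d) := by positivity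
  have hM0 : 0 ≤ (n : ℝ) ^ (2 * m) * r n ^ (d * (2 * m - 1)) := by positivity
  refine ⟨?_, ?_, ?_, ?_, ?_⟩
  · refine (integral_abs_bettiRemainder_le hm h1).trans ?_
    calc _ = C₁ * (n * (n * r n ^ d) ^ (2 * m)) := by ring
      _ ≤ _ := by rw [hMν]; gcongr; linarith
  · refine (variance_bettiRemainder_le hm h2).trans ?_
    calc _ = C₂ * (n * (n * r n ^ d) ^ (2 * m)) := by ring
      _ ≤ _ := by rw [hMν]; gcongr; linarith
  · refine (dependencyError_crossIndicator_le hA hrn.le hm (by omega) hnq.le).trans ?_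
    calc _ = C₃ * (n * (n * r n ^ d) ^ (2 * m)) := by ring
      _ ≤ _ := by rw [hMν]; gcongr; linarith
  · refine le_trans (le_of_eq ?_) (le_integral_crossPolytopeCount
      (b := c₀ * r n ^ (d * (2 * m - 1))) (by positivity) hn (hlown n))
    ring
  · refine (integral_crossPolytopeCount_le hA hrn.le hm).trans ?_
    calc _ = C₄ * ((n : ℝ) ^ (2 * m) * r n ^ (d * (2 * m - 1))) := by
          rw [pow_mul (r n)]; ring
      _ ≤ _ := by gcongr; linarith

lemma measurable_cliqueBetti (r : ℝ) (m : ℕ) :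
    Measurable fun x : Fin n → EuclideanSpace ℝ (Fin d) =>
      cliqueBetti (geometricGraph x r) Finset.univ m :=
  measurable_comp_geometricGraph r fun G => cliqueBetti G Finset.univ m

lemma measurable_crossPolytopeCount (r : ℝ) (m : ℕ) :
    Measurable fun x : Fin n → EuclideanSpace ℝ (Fin d) =>
      crossPolytopeCount (geometricGraph x r) Finset.univ m :=
  measurable_comp_geometricGraph r fun G => crossPolytopeCount G Finset.univ m

variable [IsProbabilityMeasure μ]

lemma integrable_comp_cliqueBetti (r : ℝ) (m : ℕ) (g : ℕ → ℝ) :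
    Integrable (fun x => g (cliqueBetti (geometricGraph x r) Finset.univ m))
      (Measure.pi fun _ : Fin n => μ) :=
  integrable_comp_of_le (measurable_cliqueBetti r m) (fun _ => cliqueBetti_le _ _ m) g

lemma integrable_comp_crossPolytopeCount (r : ℝ) (m : ℕ) (g : ℕ → ℝ) :
    Integrable (fun x => g (crossPolytopeCount (geometricGraph x r) Finset.univ m))
      (Measure.pi fun _ : Fin n => μ) :=
  integrable_comp_of_le (measurable_crossPolytopeCount r m) (fun _ => crossPolytopeCount_le _ _ m) g

lemma integrable_abs_bettiRemainder (r : ℝ) (m : ℕ) :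
    Integrable (fun x => |bettiRemainder (geometricGraph x r) Finset.univ m|)
      (Measure.pi fun _ : Fin n => μ) :=
  (integrable_of_abs_le (measurable_bettiRemainder r m) fun _ => abs_bettiRemainder_le_card _ m).abs

lemma abs_integral_cliqueBetti_sub_le (r : ℝ) (m : ℕ) :
    |∫ x, (cliqueBetti (geometricGraph x r) Finset.univ m : ℝ) ∂(Measure.pi fun _ : Fin n => μ) -
      ∫ x, (crossPolytopeCount (geometricGraph x r) Finset.univ m : ℝ)
        ∂(Measure.pi fun _ : Fin n => μ)| ≤
      ∫ x, |bettiRemainder (geometricGraph x r) Finset.univ m|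
        ∂(Measure.pi fun _ : Fin n => μ) := by
  rw [← integral_sub (integrable_comp_cliqueBetti r m fun j => (j : ℝ))
    (integrable_comp_crossPolytopeCount r m fun j => (j : ℝ))]
  exact abs_integral_le_integral_abs

lemma abs_integral_comp_crossPolytopeCount_sub_poisson_le (hm : 1 ≤ m) {r : ℝ} {l : ℝ} (hl : 0 < l)
    (hmean : ∫ x, (crossPolytopeCount (geometricGraph x r) Finset.univ m : ℝ)
      ∂(Measure.pi fun _ : Fin n => μ) = l) {g : ℕ → ℝ} (hg : ∀ j, |g j| ≤ 1) :
    |∫ x, g (crossPolytopeCount (geometricGraph x r) Finset.univ m)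
        ∂(Measure.pi fun _ : Fin n => μ) - ∫ j, g j ∂(poissonMeasure l.toNNReal)| ≤
      2 * min 1 (1 / l) * dependencyError (Measure.pi fun _ : Fin n => μ)
        (Finset.univ.powersetCard (2 * m)) (crossIndicator r m) Overlap := by
  have h := abs_integral_sub_poisson_le (P := Measure.pi fun _ : Fin n => μ)
    (s := Finset.univ.powersetCard (2 * m)) (nb := Overlap)
    (measurable_crossIndicator (d := d) r m) (crossIndicator_le r m) (overlap_self hm)
    (fun S _ => indepFun_crossIndicator r m S _) (Real.toNNReal_pos.2 hl)
    (by rw [Real.coe_toNNReal _ hl.le, ← hmean, integral_crossPolytopeCount]) hg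
  rw [Real.coe_toNNReal _ hl.le] at h
  simpa only [crossPolytopeCount_eq_sum] using h

lemma abs_variance_crossPolytopeCount_sub_mean_le (hm : 1 ≤ m) (r : ℝ) :
    |variance (fun x => (crossPolytopeCount (geometricGraph x r) Finset.univ m : ℝ))
        (Measure.pi fun _ : Fin n => μ) -
      ∫ x, (crossPolytopeCount (geometricGraph x r) Finset.univ m : ℝ)
        ∂(Measure.pi fun _ : Fin n => μ)| ≤
      dependencyError (Measure.pi fun _ : Fin n => μ)
        (Finset.univ.powersetCard (2 * m)) (crossIndicator r m) Overlap := by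
  have h := abs_variance_sub_mean_le (P := Measure.pi fun _ : Fin n => μ)
    (s := Finset.univ.powersetCard (2 * m)) (nb := Overlap)
    (measurable_crossIndicator (d := d) r m) (crossIndicator_le r m) (overlap_self hm)
    (fun S _ => indepFun_crossIndicator r m S _)
  rw [integral_crossPolytopeCount]
  simpa only [crossPolytopeCount_eq_sum] using h

/-- Distinct integers differ by at least 1, while values of `g` differ by at most 2. -/
lemma abs_comp_sub_comp_le {g : ℕ → ℝ} (hg : ∀ j, |g j| ≤ 1) (a b : ℕ) :
    |g a - g b| ≤ 2 * |(a : ℝ) - b| := by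
  rcases eq_or_ne a b with rfl | hab
  · simp
  · have h1 : (1 : ℝ) ≤ |(a : ℝ) - b| := by
      have : (1 : ℤ) ≤ |(a : ℤ) - b| := Int.one_le_abs (sub_ne_zero.2 (by exact_mod_cast hab))
      exact_mod_cast this
    linarith [abs_sub (g a) (g b), hg a, hg b]

/-- Three comparisons: the Betti number with the count, the count with the Poisson law of its own
mean, and that law with the Poisson law of the mean of the Betti number. The first and the third
each cost twice the mean absolute remainder. -/
lemma abs_integral_comp_cliqueBetti_sub_poisson_le (hm : 1 ≤ m) {r : ℝ}
    (hl : 0 < ∫ x, (crossPolytopeCount (geometricGraph x r) Finset.univ m : ℝ)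
      ∂(Measure.pi fun _ : Fin n => μ)) {g : ℕ → ℝ} (hg : ∀ j, |g j| ≤ 1) :
    |∫ x, g (cliqueBetti (geometricGraph x r) Finset.univ m) ∂(Measure.pi fun _ : Fin n => μ) -
      ∫ j, g j ∂(poissonMeasure (∫ x, (cliqueBetti (geometricGraph x r) Finset.univ m : ℝ)
        ∂(Measure.pi fun _ : Fin n => μ)).toNNReal)| ≤
      4 * ∫ x, |bettiRemainder (geometricGraph x r) Finset.univ m|
        ∂(Measure.pi fun _ : Fin n => μ) +
      2 * dependencyError (Measure.pi fun _ : Fin n => μ)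
        (Finset.univ.powersetCard (2 * m)) (crossIndicator r m) Overlap := by
  set l := ∫ x, (crossPolytopeCount (geometricGraph x r) Finset.univ m : ℝ)
      ∂(Measure.pi fun _ : Fin n => μ) with hldef
  set b := ∫ x, (cliqueBetti (geometricGraph x r) Finset.univ m : ℝ)
      ∂(Measure.pi fun _ : Fin n => μ) with hb
  set D := dependencyError (Measure.pi fun _ : Fin n => μ)
        (Finset.univ.powersetCard (2 * m)) (crossIndicator r m) Overlap
  have hb0 : 0 ≤ b := integral_nonneg fun _ => Nat.cast_nonneg _
  have hD0 : 0 ≤ D := (abs_nonneg _).trans (abs_variance_crossPolytopeCount_sub_mean_le hm r)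
  have h1 : |∫ x, g (cliqueBetti (geometricGraph x r) Finset.univ m)
        ∂(Measure.pi fun _ : Fin n => μ) -
      ∫ x, g (crossPolytopeCount (geometricGraph x r) Finset.univ m)
        ∂(Measure.pi fun _ : Fin n => μ)| ≤
      2 * ∫ x, |bettiRemainder (geometricGraph x r) Finset.univ m|
        ∂(Measure.pi fun _ : Fin n => μ) := by
    rw [← integral_sub (integrable_comp_cliqueBetti r m g)
      (integrable_comp_crossPolytopeCount r m g), ← integral_const_mul]
    refine abs_integral_le_integral_abs.trans (integral_mono
      ((integrable_comp_cliqueBetti r m g).sub (integrable_comp_crossPolytopeCount r m g)).abs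
      ((integrable_abs_bettiRemainder r m).const_mul 2) fun x => abs_comp_sub_comp_le hg _ _)
  have h2 := abs_integral_comp_crossPolytopeCount_sub_poisson_le hm hl hldef.symm hg
  have h3 := abs_integral_poisson_sub_le l.toNNReal b.toNNReal hg
  rw [Real.coe_toNNReal _ hl.le, Real.coe_toNNReal _ hb0] at h3
  have h4 := abs_integral_cliqueBetti_sub_le (n := n) (μ := μ) r m
  rw [← hldef, ← hb, abs_sub_comm] at h4
  have h5 : 2 * min 1 (1 / l) * D ≤ 2 * D := by
    have : min 1 (1 / l) ≤ 1 := min_le_left _ _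
    nlinarith
  have h6 := abs_sub_le (∫ x, g (cliqueBetti (geometricGraph x r) Finset.univ m)
        ∂(Measure.pi fun _ : Fin n => μ))
      (∫ x, g (crossPolytopeCount (geometricGraph x r) Finset.univ m)
        ∂(Measure.pi fun _ : Fin n => μ)) (∫ j, g j ∂(poissonMeasure b.toNNReal))
  have h7 := abs_sub_le (∫ x, g (crossPolytopeCount (geometricGraph x r) Finset.univ m)
        ∂(Measure.pi fun _ : Fin n => μ)) (∫ j, g j ∂(poissonMeasure l.toNNReal))
        (∫ j, g j ∂(poissonMeasure b.toNNReal))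
  linarith

lemma one_sub_integral_le_measure_eq_zero {Ω : Type*} [MeasurableSpace Ω] {P : Measure Ω}
    [IsProbabilityMeasure P] {U : Ω → ℕ} (hU : Measurable U)
    (hi : Integrable (fun ω => (U ω : ℝ)) P) :
    1 - ∫ ω, (U ω : ℝ) ∂P ≤ P.real {ω | U ω = 0} := by
  have h := mul_meas_ge_le_integral_of_nonneg (Eventually.of_forall fun ω => Nat.cast_nonneg (U ω))
    hi 1
  have hc : {ω | (1 : ℝ) ≤ U ω} = {ω | U ω = 0}ᶜ := by
    ext ω
    simp [Nat.one_le_iff_ne_zero]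
  have hz : MeasurableSet {ω | U ω = 0} := hU (measurableSet_singleton 0)
  rw [hc, probReal_compl_eq_one_sub hz] at h
  linarith

/-- The mean of the Betti number tends to 0, and an integer-valued variable is nonzero with
probability at most its mean. -/
theorem tendsto_measure_cliqueBetti_eq_zero {r : ℕ → ℝ} {C c : ℝ}
    (hν : Tendsto (fun n : ℕ => n * r n ^ d) atTop (𝓝 0))
    (hb : ∀ᶠ n : ℕ in atTop, SparseBounds μ m n (r n) C c)
    (hM : Tendsto (fun n : ℕ => (n : ℝ) ^ (2 * m) * r n ^ (d * (2 * m - 1))) atTop (𝓝 0)) :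
    Tendsto (fun n : ℕ => (Measure.pi fun _ : Fin n => μ)
      {x | cliqueBetti (geometricGraph x (r n)) Finset.univ m = 0}) atTop (𝓝 1) := by
  have hlim : Tendsto (fun n : ℕ => 1 - (C * ((n : ℝ) ^ (2 * m) * r n ^ (d * (2 * m - 1)) *
      (n * r n ^ d)) + C * ((n : ℝ) ^ (2 * m) * r n ^ (d * (2 * m - 1))))) atTop (𝓝 1) := by
    have := (((hM.mul hν).const_mul C).add (hM.const_mul C)).const_sub 1
    simpa using this
  have h : Tendsto (fun n : ℕ => (Measure.pi fun _ : Fin n => μ).real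
      {x | cliqueBetti (geometricGraph x (r n)) Finset.univ m = 0}) atTop (𝓝 1) := by
    refine tendsto_of_tendsto_of_tendsto_of_le_of_le' hlim tendsto_const_nhds ?_
      (Eventually.of_forall fun n => measureReal_le_one)
    filter_upwards [hb] with n hn
    refine le_trans ?_ (one_sub_integral_le_measure_eq_zero (measurable_cliqueBetti (r n) m)
      (integrable_comp_cliqueBetti (r n) m fun j => (j : ℝ)))
    have h1 := abs_integral_cliqueBetti_sub_le (n := n) (μ := μ) (r n) m
    have h2 := hn.integral_remainder_le
    have h3 := hn.mean_le
    linarith [le_abs_self (∫ x, (cliqueBetti (geometricGraph x (r n)) Finset.univ m : ℝ)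
      ∂(Measure.pi fun _ : Fin n => μ) -
      ∫ x, (crossPolytopeCount (geometricGraph x (r n)) Finset.univ m : ℝ)
        ∂(Measure.pi fun _ : Fin n => μ))]
  have h' := ENNReal.tendsto_ofReal h
  rw [ENNReal.ofReal_one] at h'
  refine h'.congr fun n => ?_
  rw [ofReal_measureReal]

theorem eventually_abs_integral_comp_cliqueBetti_sub_poisson_le (hm : 1 ≤ m) {r : ℕ → ℝ}
    (hr : ∀ n, 0 < r n) {C c : ℝ} (hC : 0 < C) (hc : 0 < c)
    (hb : ∀ᶠ n : ℕ in atTop, SparseBounds μ m n (r n) C c) {α : ℝ} (hα : 0 < α)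
    (hM : Tendsto (fun n : ℕ => (n : ℝ) ^ (2 * m) * r n ^ (d * (2 * m - 1))) atTop (𝓝 α)) :
    ∀ᶠ n : ℕ in atTop, ∀ g : ℕ → ℝ, (∀ j, |g j| ≤ 1) →
      |∫ x, g (cliqueBetti (geometricGraph x (r n)) Finset.univ m)
          ∂(Measure.pi fun _ : Fin n => μ) -
        ∫ j, g j ∂(poissonMeasure (∫ x, (cliqueBetti (geometricGraph x (r n)) Finset.univ m : ℝ)
          ∂(Measure.pi fun _ : Fin n => μ)).toNNReal)| ≤ 12 * C * α * (n * r n ^ d) := by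
  filter_upwards [hb, hM.eventually_const_lt hα,
    hM.eventually_lt_const (by linarith : α < 2 * α)] with n hn hn0 hn2 g hg
  have hl := (mul_pos hc hn0).trans_le hn.le_mean
  refine (abs_integral_comp_cliqueBetti_sub_poisson_le hm hl hg).trans ?_
  have h1 := hn.integral_remainder_le
  have h2 := hn.dependencyError_le
  have hν0 : 0 ≤ n * r n ^ d := mul_nonneg (Nat.cast_nonneg _) (pow_nonneg (hr n).le _)
  -- Eventually the order of the mean is below `2 * α`; with the weights 4 and 2 of the two errors
  -- this yields the constant 12.
  have h3 : C * ((n : ℝ) ^ (2 * m) * r n ^ (d * (2 * m - 1)) * (n * r n ^ d)) ≤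
      C * (2 * α * (n * r n ^ d)) := by gcongr
  linarith

-- Relative to the mean `l` of the count, the dependency error and the variance of the remainder are
-- both `O(n * r n ^ d)`. So the count is close to Poisson, its variance is asymptotic to `l → ∞`,
-- and the remainder does not affect the limit.
open Complex in
theorem tendsto_charFun_cliqueBetti (hm : 1 ≤ m) {r : ℕ → ℝ} {C c : ℝ} (hC : 0 < C) (hc : 0 < c)
    (hr : ∀ n, 0 < r n) (hν : Tendsto (fun n : ℕ => n * r n ^ d) atTop (𝓝 0))
    (hb : ∀ᶠ n : ℕ in atTop, SparseBounds μ m n (r n) C c)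
    (hM : Tendsto (fun n : ℕ => (n : ℝ) ^ (2 * m) * r n ^ (d * (2 * m - 1))) atTop atTop) (t : ℝ) :
    Tendsto (fun n : ℕ => ∫ x, cexp (t *
      (((cliqueBetti (geometricGraph x (r n)) Finset.univ m : ℝ) -
        ∫ y, (cliqueBetti (geometricGraph y (r n)) Finset.univ m : ℝ)
          ∂(Measure.pi fun _ : Fin n => μ)) /
        Real.sqrt (variance (fun y => (cliqueBetti (geometricGraph y (r n)) Finset.univ m : ℝ))
          (Measure.pi fun _ : Fin n => μ)) : ℝ) * I) ∂(Measure.pi fun _ : Fin n => μ))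
      atTop (𝓝 (cexp (-(t : ℂ) ^ 2 / 2))) := by
  set l : ℕ → ℝ := fun n => ∫ x, (crossPolytopeCount (geometricGraph x (r n)) Finset.univ m : ℝ)
      ∂(Measure.pi fun _ : Fin n => μ) with hldef
  have hl : Tendsto l atTop atTop :=
    tendsto_atTop_mono' _ (hb.mono fun n hn => hn.le_mean) (hM.const_mul_atTop hc)
  have hsmall : Tendsto (fun n : ℕ => C / c * (n * r n ^ d)) atTop (𝓝 0) := by
    simpa using hν.const_mul (C / c)
  have hkey : ∀ n, SparseBounds μ m n (r n) C c → 0 < l n → ∀ {X : ℝ},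
      X ≤ C * ((n : ℝ) ^ (2 * m) * r n ^ (d * (2 * m - 1)) * (n * r n ^ d)) →
      X / l n ≤ C / c * (n * r n ^ d) := by
    intro n hn hl0 X hX
    have hν0 : 0 ≤ n * r n ^ d := mul_nonneg (Nat.cast_nonneg _) (pow_nonneg (hr n).le _)
    rw [div_le_iff₀ hl0]
    calc X ≤ C / c * (n * r n ^ d) * (c * ((n : ℝ) ^ (2 * m) * r n ^ (d * (2 * m - 1)))) := by
          refine hX.trans (le_of_eq ?_)
          field_simp
      _ ≤ _ := mul_le_mul_of_nonneg_left hn.le_mean (by positivity)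
  refine tendsto_charFun_of_variance_sub
    (Y := fun n x => (cliqueBetti (geometricGraph x (r n)) Finset.univ m : ℝ))
    (W := fun n x => (crossPolytopeCount (geometricGraph x (r n)) Finset.univ m : ℝ))
    (l := l) (fun n => ?_) (fun n => ?_) hl (fun n => rfl) ?_ ?_ ?_
  · refine MemLp.of_bound (integrable_comp_cliqueBetti (r n) m
      fun j => (j : ℝ)).aestronglyMeasurable ((n ^ m : ℕ) : ℝ) (Eventually.of_forall fun x => ?_)
    rw [Real.norm_of_nonneg (Nat.cast_nonneg _)]
    exact_mod_cast (cliqueBetti_le (geometricGraph x (r n)) Finset.univ m).trans_eq (by simp)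
  · refine MemLp.of_bound (integrable_comp_crossPolytopeCount (r n) m
      fun j => (j : ℝ)).aestronglyMeasurable ((n ^ (2 * m) : ℕ) : ℝ)
      (Eventually.of_forall fun x => ?_)
    rw [Real.norm_of_nonneg (Nat.cast_nonneg _)]
    exact_mod_cast (crossPolytopeCount_le (geometricGraph x (r n)) Finset.univ m).trans_eq (by simp)
  · rw [tendsto_iff_norm_sub_tendsto_zero]
    refine squeeze_zero' (Eventually.of_forall fun n => norm_nonneg _) ?_ hsmall
    filter_upwards [hb, hl.eventually_gt_atTop 0] with n hn hl0
    rw [Real.norm_eq_abs, div_sub_one hl0.ne', abs_div, abs_of_pos hl0]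
    exact hkey n hn hl0 ((abs_variance_crossPolytopeCount_sub_mean_le hm (r n)).trans
      hn.dependencyError_le)
  · refine squeeze_zero' ?_ ?_ hsmall
    · filter_upwards [hl.eventually_gt_atTop 0] with n hl0
      exact div_nonneg (variance_nonneg _ _) hl0.le
    · filter_upwards [hb, hl.eventually_gt_atTop 0] with n hn hl0
      exact hkey n hn hl0 hn.variance_remainder_le
  · have hP := tendsto_integral_poisson_normalized hl t
    have hdiff : Tendsto (fun n : ℕ => (∫ x, cexp (t *
        (((crossPolytopeCount (geometricGraph x (r n)) Finset.univ m : ℝ) - l n) /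
          Real.sqrt (l n) : ℝ) * I) ∂(Measure.pi fun _ : Fin n => μ)) -
        ∫ j : ℕ, cexp (t * (((j : ℝ) - l n) / Real.sqrt (l n) : ℝ) * I)
          ∂(poissonMeasure (l n).toNNReal)) atTop (𝓝 0) := by
      refine squeeze_zero_norm' ?_ (by simpa using hsmall.const_mul 4 :
        Tendsto (fun n : ℕ => 4 * (C / c * (n * r n ^ d))) atTop (𝓝 0))
      filter_upwards [hb, hl.eventually_gt_atTop 0] with n hn hl0
      have hD := hkey n hn hl0 hn.dependencyError_le
      have hD0 := (abs_nonneg _).trans (abs_variance_crossPolytopeCount_sub_mean_le (μ := μ)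
        (n := n) hm (r n))
      refine (norm_integral_sub_le_of_forall_real
        (F := fun j : ℕ => cexp (t * (((j : ℝ) - l n) / Real.sqrt (l n) : ℝ) * I))
        (measurable_crossPolytopeCount (r n) m) (B := 2 * (C / c * (n * r n ^ d)))
        (fun g hg => ?_) fun j => ?_).trans (le_of_eq (by ring))
      · refine (abs_integral_comp_crossPolytopeCount_sub_poisson_le hm hl0 rfl hg).trans ?_
        rw [mul_assoc]
        refine mul_le_mul_of_nonneg_left (le_trans ?_ hD) two_pos.le
        -- Here the factor `1 / l` is essential: the dependency error itself need not tend to 0 in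
        -- this regime.
        refine (mul_le_mul_of_nonneg_right (min_le_right _ _) hD0).trans (le_of_eq ?_)
        rw [one_div, div_eq_inv_mul]
      · rw [← ofReal_mul, norm_exp_ofReal_mul_I]
    simpa using hdiff.add hP

end SparseRegime

/-! ### Transfer from arbitrary samples to the product measure. -/

section Sample

variable {d n : ℕ} {Ω : Type*} [MeasurableSpace Ω] {P : Measure Ω} [IsProbabilityMeasure P]
  {X : Fin n → Ω → EuclideanSpace ℝ (Fin d)} {f : EuclideanSpace ℝ (Fin d) → ℝ}

lemma IsIIDSample.map_eq_pi (hX : IsIIDSample P X f) :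
    P.map (fun ω i => X i ω) = Measure.pi fun _ : Fin n => densityMeasure f := by
  rw [(iIndepFun_iff_map_fun_eq_pi_map fun i => (hX.measurable i).aemeasurable).1 hX.indep]
  congr 1
  funext i
  exact hX.law i

lemma IsIIDSample.measurable_points (hX : IsIIDSample P X f) : Measurable fun ω i => X i ω :=
  measurable_pi_lambda _ hX.measurable

lemma randomBetti_eq_cliqueBetti {k : ℕ} (hk : 1 ≤ k) (r : ℝ) :
    randomBetti X r k =
      fun ω => cliqueBetti (geometricGraph (fun i => X i ω) r) Finset.univ (k + 1) :=
  funext fun _ => betti_cliqueComplex _ hk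

lemma IsIIDSample.measurable_randomBetti (hX : IsIIDSample P X f) {k : ℕ} (hk : 1 ≤ k) (r : ℝ) :
    Measurable (randomBetti X r k) := by
  rw [randomBetti_eq_cliqueBetti hk]
  exact (measurable_cliqueBetti r (k + 1)).comp hX.measurable_points

lemma IsIIDSample.map_randomBetti (hX : IsIIDSample P X f) {k : ℕ} (hk : 1 ≤ k) (r : ℝ) :
    P.map (randomBetti X r k) = (Measure.pi fun _ : Fin n => densityMeasure f).map
      fun x => cliqueBetti (geometricGraph x r) Finset.univ (k + 1) := by
  rw [← hX.map_eq_pi, Measure.map_map (measurable_cliqueBetti r (k + 1)) hX.measurable_points,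
    randomBetti_eq_cliqueBetti hk]
  rfl

lemma IsIIDSample.integral_comp_randomBetti {F : Type*} [NormedAddCommGroup F] [NormedSpace ℝ F]
    (hX : IsIIDSample P X f) {k : ℕ} (hk : 1 ≤ k) (r : ℝ) {g : ℕ → F}
    (hg : StronglyMeasurable g) :
    ∫ ω, g (randomBetti X r k ω) ∂P =
      ∫ x, g (cliqueBetti (geometricGraph x r) Finset.univ (k + 1))
        ∂(Measure.pi fun _ : Fin n => densityMeasure f) := by
  rw [← integral_map (hX.measurable_randomBetti hk r).aemeasurable hg.aestronglyMeasurable,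
    hX.map_randomBetti hk r,
    integral_map (measurable_cliqueBetti r (k + 1)).aemeasurable hg.aestronglyMeasurable]

lemma IsIIDSample.variance_randomBetti (hX : IsIIDSample P X f) {k : ℕ} (hk : 1 ≤ k) (r : ℝ) :
    variance (fun ω => (randomBetti X r k ω : ℝ)) P =
      variance (fun x => (cliqueBetti (geometricGraph x r) Finset.univ (k + 1) : ℝ))
        (Measure.pi fun _ : Fin n => densityMeasure f) := by
  have h1 := variance_map (μ := P) (X := fun j : ℕ => (j : ℝ)) (Y := randomBetti X r k)
    (measurable_of_countable _).aemeasurable (hX.measurable_randomBetti hk r).aemeasurable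
  have h2 := variance_map (μ := Measure.pi fun _ : Fin n => densityMeasure f)
    (X := fun j : ℕ => (j : ℝ))
    (Y := fun x => cliqueBetti (geometricGraph x r) Finset.univ (k + 1))
    (measurable_of_countable _).aemeasurable (measurable_cliqueBetti r (k + 1)).aemeasurable
  rw [hX.map_randomBetti hk r, h2] at h1
  exact h1.symm

end Sample

/-- Continuity of the test functions is dropped, which only strengthens what has to be shown; for
laws on ℕ it is no restriction. The zero function shows that the supremum is over a nonempty set. -/
lemma dTV_le {E : Type*} [TopologicalSpace E] [MeasurableSpace E] {μ ν : Measure E} {b : ℝ}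
    (h : ∀ g : E → ℝ, (∀ y, |g y| ≤ 1) → |∫ y, g y ∂μ - ∫ y, g y ∂ν| ≤ b) : dTV μ ν ≤ b := by
  refine csSup_le ⟨_, 0, continuous_zero, fun _ => by simp, rfl⟩ ?_
  rintro _ ⟨g, -, hg, rfl⟩
  exact h g hg

end RandomRips

end

/-! ### The limit theorem for the Betti numbers. -/

theorem theorem4 (d k : ℕ) (hd : 2 ≤ d) (hk : 1 ≤ k)
    (f : EuclideanSpace ℝ (Fin d) → ℝ) (hf_meas : Measurable f) (hf_nonneg : ∀ x, 0 ≤ f x)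
    (hf_bdd : ∃ M : ℝ, ∀ x, f x ≤ M) (hf_int : ∫ x, f x = 1) :
    ∃ c : ℝ, 0 < c ∧
      ∀ (Ω : ℕ → Type*) [∀ n, MeasurableSpace (Ω n)] (P : (n : ℕ) → Measure (Ω n))
        [∀ n, IsProbabilityMeasure (P n)]
        (X : (n : ℕ) → Fin n → Ω n → EuclideanSpace ℝ (Fin d))
        (_hX : ∀ n, RandomRips.IsIIDSample (P n) (X n) f)
        (ε : ℝ) (_hε : 0 < ε) (r : ℕ → ℝ) (_hr_pos : ∀ n, 0 < r n)
        (_hr : r =O[atTop] fun n : ℕ => (n : ℝ) ^ (-(1 / (d : ℝ)) - ε)),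
        -- vanishing regime
        (Tendsto (fun n : ℕ => (n : ℝ) ^ (2 * k + 2) * r n ^ (d * (2 * k + 1))) atTop (𝓝 0) →
          Tendsto (fun n => P n {ω | RandomRips.randomBetti (X n) (r n) k ω = 0}) atTop (𝓝 1)) ∧
        -- Poisson regime
        (∀ α : ℝ, 0 < α →
          Tendsto (fun n : ℕ => (n : ℝ) ^ (2 * k + 2) * r n ^ (d * (2 * k + 1))) atTop (𝓝 α) →
          ∀ᶠ n : ℕ in atTop,
            RandomRips.dTV ((P n).map (RandomRips.randomBetti (X n) (r n) k))
              (poissonMeasure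
                (∫ ω, (RandomRips.randomBetti (X n) (r n) k ω : ℝ) ∂(P n)).toNNReal) ≤
              c * α * (n * r n ^ d)) ∧
        -- normal regime
        (Tendsto (fun n : ℕ => (n : ℝ) ^ (2 * k + 2) * r n ^ (d * (2 * k + 1))) atTop atTop →
          TendstoInDistribution
            (fun n ω => ((RandomRips.randomBetti (X n) (r n) k ω : ℝ)
                - ∫ ω', (RandomRips.randomBetti (X n) (r n) k ω' : ℝ) ∂(P n)) /
              Real.sqrt (variance (fun ω' => (RandomRips.randomBetti (X n) (r n) k ω' : ℝ)) (P n)))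
            atTop (id : ℝ → ℝ) P (gaussianReal 0 1)) := by

  -- Dimension `k` corresponds to cross-polytopes of dimension `m = k + 1`, with `2 * k + 2`
  -- vertices.
  have hM : ∀ r : ℕ → ℝ, (fun n : ℕ => (n : ℝ) ^ (2 * k + 2) * r n ^ (d * (2 * k + 1))) =
      fun n : ℕ => (n : ℝ) ^ (2 * (k + 1)) * r n ^ (d * (2 * (k + 1) - 1)) := fun r => by
    rw [show 2 * (k + 1) = 2 * k + 2 by ring, show 2 * k + 2 - 1 = 2 * k + 1 by omega]
  have hprob := RandomRips.isProbabilityMeasure_densityMeasure hf_nonneg hf_int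
  obtain ⟨C, c, hC, hc, hbounds⟩ := RandomRips.exists_sparseBounds hd (by omega : 2 ≤ k + 1)
    hf_meas hf_nonneg hf_int hf_bdd
  refine ⟨12 * C, by positivity, ?_⟩
  intro Ω _ P _ X hX ε hε r hr_pos hr
  obtain ⟨hν, hb⟩ := hbounds ε hε r hr_pos hr
  have hk1 : 1 ≤ k + 1 := by omega
  have hmean : ∀ n, ∫ ω, (RandomRips.randomBetti (X n) (r n) k ω : ℝ) ∂(P n) =
      ∫ x, (RandomRips.cliqueBetti (RandomRips.geometricGraph x (r n)) Finset.univ (k + 1) : ℝ)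
        ∂(Measure.pi fun _ : Fin n => RandomRips.densityMeasure f) := fun n =>
    (hX n).integral_comp_randomBetti hk (r n) (g := fun j : ℕ => (j : ℝ))
      (measurable_of_countable _).stronglyMeasurable
  rw [hM r]
  refine ⟨fun h => ?_, fun α hα h => ?_, fun h => ?_⟩
  · refine (RandomRips.tendsto_measure_cliqueBetti_eq_zero hν hb h).congr fun n => ?_
    have h0 := congrArg (fun ρ : Measure ℕ => ρ {0}) ((hX n).map_randomBetti hk (r n))
    rw [Measure.map_apply ((hX n).measurable_randomBetti hk (r n)) (measurableSet_singleton 0),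
      Measure.map_apply (RandomRips.measurable_cliqueBetti (r n) (k + 1))
        (measurableSet_singleton 0)] at h0
    exact h0.symm
  · filter_upwards [RandomRips.eventually_abs_integral_comp_cliqueBetti_sub_poisson_le hk1 hr_pos hC
      hc hb hα h] with n hn
    refine RandomRips.dTV_le fun g hg => ?_
    rw [integral_map ((hX n).measurable_randomBetti hk (r n)).aemeasurable
      (measurable_of_countable g).aestronglyMeasurable, hmean n,
      (hX n).integral_comp_randomBetti hk (r n) (measurable_of_countable g).stronglyMeasurable]
    exact hn g hg
  · have hmeas : ∀ n, Measurable fun ω => ((RandomRips.randomBetti (X n) (r n) k ω : ℝ)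
        - ∫ ω', (RandomRips.randomBetti (X n) (r n) k ω' : ℝ) ∂(P n)) /
        Real.sqrt (variance (fun ω' => (RandomRips.randomBetti (X n) (r n) k ω' : ℝ)) (P n)) :=
      fun n => (((measurable_of_countable (fun j : ℕ => (j : ℝ))).comp
        ((hX n).measurable_randomBetti hk (r n))).sub_const _).div_const _
    -- Lévy's continuity theorem reduces the claim to pointwise convergence of characteristic
    -- functions.
    refine ⟨fun n => (hmeas n).aemeasurable, aemeasurable_id,
      ProbabilityMeasure.tendsto_of_tendsto_charFun fun t => ?_⟩
    have hlim := RandomRips.tendsto_charFun_cliqueBetti hk1 hC hc hr_pos hν hb h t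
    simp only [ProbabilityMeasure.coe_mk, Measure.map_id, charFun_gaussianReal]
    have e : Complex.exp (t * (0 : ℝ) * Complex.I - (1 : ℝ≥0) * t ^ 2 / 2) =
        Complex.exp (-(t : ℂ) ^ 2 / 2) := by
      congr 1
      simp [neg_div]
    rw [e]
    refine hlim.congr fun n => ?_
    rw [charFun_apply_real, integral_map (hmeas n).aemeasurable
      (by fun_prop : Measurable fun x : ℝ => Complex.exp (t * x * Complex.I)).aestronglyMeasurable,
      hmean n, (hX n).variance_randomBetti hk (r n)]
    exact ((hX n).integral_comp_randomBetti hk (r n)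
      (g := fun j : ℕ => Complex.exp (t * (((j : ℝ) - ∫ y, (RandomRips.cliqueBetti
        (RandomRips.geometricGraph y (r n)) Finset.univ (k + 1) : ℝ)
          ∂(Measure.pi fun _ : Fin n => RandomRips.densityMeasure f)) /
        Real.sqrt (variance (fun y => (RandomRips.cliqueBetti
          (RandomRips.geometricGraph y (r n)) Finset.univ (k + 1) : ℝ))
          (Measure.pi fun _ : Fin n => RandomRips.densityMeasure f)) : ℝ) * Complex.I))
      (measurable_of_countable _).stronglyMeasurable).symm
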